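/- **Setting.** Let $n\ge 1$ and consider $$\min_{x\in\mathbb R^n} F(x):=f(x)+h(x)\quad\text{s.t. } g(x)\le 0$$ with one constraint $g:\mathbb R^n\to\mathbb R$. Here $f,g$ are differentiable, $\nabla f$ is $L_f$-Lipschitz, $J_g=\nabla g^\top$ is $L_g$-Lipschitz, $f$ is $\mu$-strongly convex with $\mu>0$, $g$ is convex, and $h:\mathbb R^n\to(-\infty,+\infty]$ is proper, closed and convex with bounded domain of diameter $D_h$. Some $(x^*,z^*)$ satisfies the KKT conditions $0\in\partial F(x^*)+z^*\nabla g(x^*)$, $z^*\ge 0$, $g(x^*)\le 0$, $z^*g(x^*)=0$. Put $B_g=\sup_{x\in\mathrm{dom}\,h}\|\nabla g(x)\|$. A pair $(\bar x,\bar z)$ with $\bar x\in\mathrm{dom}\,h$, $\bar z\ge 0$ is an $\varepsilon$-KKT pair, and $\bar x$ an $\varepsilon$-KKT point, if $\mathrm{dist}(0,\partial(F+\bar z g)(\bar x))\le\varepsilon$, $[g(\bar x)]_+\le\varepsilon$ and $|\bar z g(\bar x)|\le\varepsilon$. **Subroutine APG** (parameters $L_{\min}>0$, $\gamma_1>1$,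 $\gamma_2\ge 1$) for $P=\psi+h$ with tolerance $\tau$. A *proximal step with line search* from a point $y$ starts with a value $L$ and repeatedly computes $x=\arg\min_u\langle\nabla\psi(y),u\rangle+\frac L2\|u-y\|^2+h(u)$, multiplying $L$ by $\gamma_1$ until $\psi(x)\le\psi(y)+\langle\nabla\psi(y),x-y\rangle+\frac L2\|x-y\|^2$. First, one such step is made from an arbitrary $y^0\in\mathrm{dom}\,h$, starting with $L_{\min}$; it gives $x^0=x^{-1}$ and, with accepted value $\tilde L$, $L_0=\max\{L_{\min},\tilde L/\gamma_2\}$; put $\alpha_{-1}=1$. For $k=0,1,\dots$: (i) make a step with initial value $L_k$, where for the trial value $\tilde L$ one uses $\alpha_k=\sqrt{\mu/\tilde L}$ and the point $y=x^k+\frac{\alpha_k(1-\alpha_{k-1})}{\alpha_{k-1}(1+\alpha_k)}(x^k-x^{k-1})$; this gives $x^{k+1}$, the accepted $\tilde L$ and $\alpha_k$; (ii) make a step from $x^{k+1}$ with initial value $\tilde L$, which gives $\hat x$; (iii) set $L_{k+1}=\max\{L_{\min},\tilde L/\gamma_2\}$ and return $\hat x$ if $\mathrm{dist}(0,\partial P(\hat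 x))\le\tau$. **Subroutine BiSec** for given $\beta>0$, $z\ge 0$, $\delta>0$. Let $\theta=g+z/\beta$ and, for $y\ge 0$, let $\hat x(y)$ denote the output of APG with $\psi=f+\beta(y\theta-\frac12y^2)$ and $\tau=\frac{\mu\delta}{4B_g}$. Call $y$ *accepted* if $|[\theta(\hat x(y))]_+-y|\le\frac{3\delta}4$. *Interval search:* if $0$ is accepted, put $a=b=0$; otherwise start with $a=0$, $b=1/\beta$ and, as long as $b$ is not accepted and $\theta(\hat x(b))>b$, replace $(a,b)$ by $(b,2b)$; if the final $b$ is accepted, put $a=b$. *Bisection:* while $b-a>\frac{\mu\delta}{\mu+\beta B_g^2}$, let $c=\frac{a+b}2$; if $c$ is accepted return $(\hat x(c),c)$; otherwise put $a=c$ if $\theta(\hat x(c))>c$ and $b=c$ if not. When the loop ends, return $(\hat x(y),y)$ with $y=\frac{a+b}2$. **Main algorithm** (inputs $\beta_0>0$, $\sigma>1$, $\varepsilon>0$, $L_{\min}>0$, $\gamma_1>1$, $\gamma_2\ge 1$). Put $z^0=0$ and $\beta_k=\beta_0\sigma^k$. For $k=0,1,\dots$, with tolerance $\varepsilon_k$,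 let $(x^{k+1},y^{k+1})$ be the output of BiSec for $\beta_k$, $z^k$ and $\delta_k=\frac{\varepsilon_k}{3\beta_kB_g}$; if $\frac{\mu}{4\beta_kB_g^2}>1$, replace $x^{k+1}$ by the output of APG with $\psi=f+\beta_ky^{k+1}g$ and $\tau=\varepsilon_k/3$. Set $z^{k+1}=[z^k+\beta_kg(x^{k+1})]_+$, and stop with output $(x^{k+1},z^{k+1})$ if this is an $\varepsilon$-KKT pair. **Theorem.** Let $$\bar\varepsilon=\min\Big\{\varepsilon,\sqrt{\tfrac{\varepsilon\mu(\sigma-1)}{8\sigma+1}}\Big\},\qquad\text{suppose } \bar\varepsilon\le\min\Big\{\varepsilon,\tfrac{24B_g(\mu+\beta_kB_g^2)}{\mu}\Big\}\ \text{ for all }k\ge0,$$ and let $\varepsilon_k=\bar\varepsilon$ for all $k$. Then, whatever initial points in $\mathrm{dom}\,h$ are used in the calls of APG, the main algorithm stops after finitely many steps, and its output is an $\varepsilon$-KKT point. Moreover, the total number of evaluations of $f$, $\nabla f$, $g$ and $J_g$ is $$T_{\rm total}=O\Big(\sqrt{\tfrac{L_f+L_g(1+\|z^*\|)}{\mu}}\;|\log\varepsilon|^3\Big)\qquad(\varepsilon\to0)$$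 in the following sense. For all $\sigma>1$, $\gamma_1>1$, $\gamma_2\ge1$ and $\rho$ there is a constant $C>0$ such that for every $M$ there is $\varepsilon_0>0$ for which $$T_{\rm total}\le C\sqrt{\tfrac{L_f+L_g(1+\|z^*\|)}{\mu}}\;|\log\varepsilon|^3$$ holds whenever $\varepsilon\le\varepsilon_0$, $L_{\min}\le\rho\,(L_f+L_g(1+\|z^*\|))$, and all of $L_f,L_g,\|z^*\|,D_h,B_g,\mu^{-1},\beta_0,\beta_0^{-1},L_{\min}^{-1}$ are at most $M$. (So $C$ does not depend on $n$, $f$, $g$, $h$, $\mu$, $L_f$, $L_g$, $z^*$, $D_h$, $B_g$ or $\beta_0$.) -/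

import Mathlib

/-! ### Extended-real-valued convex functions -/

section Convexity

variable {E : Type*} [NormedAddCommGroup E] [InnerProductSpace ℝ E]

/-- The effective domain of an extended-real-valued function. -/
def effDom (h : E → EReal) : Set E := {x | h x < ⊤}

/-- Proper closed (lower semicontinuous) convex functions with values in `(-∞, +∞]`. -/
structure IsProperClosedConvex (h : E → EReal) : Prop where
  ne_bot : ∀ x, h x ≠ ⊥
  dom_nonempty : (effDom h).Nonempty
  lsc : LowerSemicontinuous h
  convex_epigraph : Convex ℝ {q : E × ℝ | h q.1 ≤ (q.2 : EReal)}

/-- The extended-real-valued sum `ψ + r` of a real-valued and an extended-real-valued function. -/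
noncomputable def addExt (ψ : E → ℝ) (r : E → EReal) : E → EReal := fun x => (ψ x : EReal) + r x

/-- The convex subdifferential `∂P(x)`. -/
def subdiff (P : E → EReal) (x : E) : Set E :=
  {v | ∀ u, P x + ((inner ℝ v (u - x) : ℝ) : EReal) ≤ P u}

/-- `dist(0, ∂P(x)) ≤ ε`; the distance to the empty set is `+∞`. -/
def NearStationary (P : E → EReal) (ε : ℝ) (x : E) : Prop :=
  Metric.infEDist (0 : E) (subdiff P x) ≤ ENNReal.ofReal ε

end Convexity

/-! ### The adaptive accelerated proximal gradient method, with a count of evaluations -/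

section APG

variable {E : Type*} [NormedAddCommGroup E] [InnerProductSpace ℝ E] [CompleteSpace E]

/-- `x = argmin_u ⟨∇ψ(y), u⟩ + (L/2) ‖u - y‖² + r(u)`. -/
def IsProxGradStep (ψ : E → ℝ) (r : E → EReal) (L : ℝ) (y x : E) : Prop :=
  ∀ u : E,
    addExt (fun w => inner ℝ (gradient ψ y) w + L / 2 * ‖w - y‖ ^ 2) r x ≤
      addExt (fun w => inner ℝ (gradient ψ y) w + L / 2 * ‖w - y‖ ^ 2) r u

/-- The acceptance test of the line search. -/
def SufficientDecrease (ψ : E → ℝ) (L : ℝ) (y x : E) : Prop :=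
  ψ x ≤ ψ y + inner ℝ (gradient ψ y) (x - y) + L / 2 * ‖x - y‖ ^ 2

/-- The loop `repeat L ← γ₁ L; y ← Y(L); x ← proximal gradient step from y until accepted`.
`Backtrack ψ r γ₁ Y L L' x t`: started with the value `L`, the loop ends after exactly `t` trials
with the accepted value `L'` and the accepted point `x`. -/
inductive Backtrack (ψ : E → ℝ) (r : E → EReal) (γ₁ : ℝ) (Y : ℝ → E) :
    ℝ → ℝ → E → ℕ → Prop
  | accept {L : ℝ} {x : E} :
      IsProxGradStep ψ r (γ₁ * L) (Y (γ₁ * L)) x →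
      SufficientDecrease ψ (γ₁ * L) (Y (γ₁ * L)) x →
      Backtrack ψ r γ₁ Y L (γ₁ * L) x 1
  | reject {L L' : ℝ} {x x' : E} {t : ℕ} :
      IsProxGradStep ψ r (γ₁ * L) (Y (γ₁ * L)) x →
      ¬ SufficientDecrease ψ (γ₁ * L) (Y (γ₁ * L)) x →
      Backtrack ψ r γ₁ Y (γ₁ * L) L' x' t →
      Backtrack ψ r γ₁ Y L L' x' (t + 1)

/-- The line-search parameters: minimum Lipschitz estimate, increase rate, decrease rate. -/
structure LineSearch where
  Lmin : ℝ
  γ₁ : ℝ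
  γ₂ : ℝ

/-- The state `(x^k, x^{k-1}, L_k, α_{k-1})` of the method. -/
structure APGState (E : Type*) where
  x : E
  xPrev : E
  L : ℝ
  αPrev : ℝ

/-- The extrapolated point for the trial value `L`, where `α = √(μ/L)`. -/
noncomputable def APGState.extrapolate (s : APGState E) (μ L : ℝ) : E :=
  s.x + ((Real.sqrt (μ / L) * (1 - s.αPrev)) / (s.αPrev * (1 + Real.sqrt (μ / L)))) •
    (s.x - s.xPrev)

/-- One pass of the main loop, from state `s` to state `s'`, with candidate output `xhat`.
Each line-search trial is charged 3 evaluations (`ψ` at two points and `∇ψ` at one point), and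
the stationarity test at `xhat` is charged one evaluation of `∇ψ`. -/
def APGIteration (ψ : E → ℝ) (r : E → EReal) (μ : ℝ) (ls : LineSearch)
    (s s' : APGState E) (xhat : E) (N : ℕ) : Prop :=
  ∃ (Lt : ℝ) (xt : E) (t₁ : ℕ) (Lh : ℝ) (t₂ : ℕ),
    Backtrack ψ r ls.γ₁ (fun L => s.extrapolate μ L) (s.L / ls.γ₁) Lt xt t₁ ∧
    Backtrack ψ r ls.γ₁ (fun _ => xt) (Lt / ls.γ₁) Lh xhat t₂ ∧
    s' = ⟨xt, s.x, max ls.Lmin (Lt / ls.γ₂), Real.sqrt (μ / Lt)⟩ ∧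
    N = 3 * t₁ + 3 * t₂ + 1

/-- The main loop, started in a given state; it stops as soon as `dist(0, ∂(ψ + r)(xhat)) ≤ tol`. -/
inductive APGLoop (ψ : E → ℝ) (r : E → EReal) (μ : ℝ) (ls : LineSearch) (tol : ℝ) :
    APGState E → E → ℕ → Prop
  | finish {s s' : APGState E} {xhat : E} {N : ℕ} :
      APGIteration ψ r μ ls s s' xhat N →
      NearStationary (addExt ψ r) tol xhat →
      APGLoop ψ r μ ls tol s xhat N
  | next {s s' : APGState E} {xhat x : E} {N N' : ℕ} :
      APGIteration ψ r μ ls s s' xhat N →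
      ¬ NearStationary (addExt ψ r) tol xhat →
      APGLoop ψ r μ ls tol s' x N' →
      APGLoop ψ r μ ls tol s x (N + N')

/-- `APG ψ r μ ls tol y₀ x N`: the method for `min ψ + r`, started at `y₀`, stops and returns `x`
after exactly `N` evaluations of `ψ` and `∇ψ`. -/
def APG (ψ : E → ℝ) (r : E → EReal) (μ : ℝ) (ls : LineSearch) (tol : ℝ)
    (y₀ x : E) (N : ℕ) : Prop :=
  ∃ (Lt : ℝ) (xt : E) (t N' : ℕ),
    Backtrack ψ r ls.γ₁ (fun _ => y₀) (ls.Lmin / ls.γ₁) Lt xt t ∧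
    APGLoop ψ r μ ls tol ⟨xt, xt, max ls.Lmin (Lt / ls.γ₂), 1⟩ x N' ∧
    N = 3 * t + N'

end APG

/-! ### The problem `min f(x) + h(x)` subject to one constraint `g(x) ≤ 0` -/

/-- The data of `min f(x) + h(x)` subject to `g(x) ≤ 0`. -/
structure Problem (E : Type*) where
  f : E → ℝ
  h : E → EReal
  g : E → ℝ

namespace Problem

variable {E : Type*} [NormedAddCommGroup E] [InnerProductSpace ℝ E] [CompleteSpace E]

/-- The ordinary Lagrangian `L₀(·, z) = f + h + z g`. -/
noncomputable def lagrangian (p : Problem E) (z : ℝ) : E → EReal :=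
  addExt (fun x => p.f x + z * p.g x) p.h

/-- `(x, z)` satisfies the conditions that make `x` an `ε`-KKT point. -/
def IsEpsKKTPair (p : Problem E) (ε : ℝ) (x : E) (z : ℝ) : Prop :=
  x ∈ effDom p.h ∧ 0 ≤ z ∧ NearStationary (p.lagrangian z) ε x ∧
    |max (p.g x) 0| ≤ ε ∧ |z * p.g x| ≤ ε

/-- `x` is an `ε`-KKT point. -/
def IsEpsKKT (p : Problem E) (ε : ℝ) (x : E) : Prop := ∃ z : ℝ, p.IsEpsKKTPair ε x z

/-- `B_g = sup_{x ∈ dom h} ‖∇g(x)‖`. -/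
noncomputable def Bg (p : Problem E) : ℝ := sSup ((fun x => ‖gradient p.g x‖) '' effDom p.h)

/-- The standing assumptions: smoothness, bounded domain and convexity, strong convexity, and a
KKT point `xs` with multiplier `zs`. -/
structure Assumptions (p : Problem E) (μ Lf Lg : ℝ) (xs : E) (zs : ℝ) : Prop where
  f_diff : Differentiable ℝ p.f
  f_smooth : ∀ x y, ‖gradient p.f x - gradient p.f y‖ ≤ Lf * ‖x - y‖
  g_diff : Differentiable ℝ p.g
  g_smooth : ∀ x y, ‖gradient p.g x - gradient p.g y‖ ≤ Lg * ‖x - y‖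
  h_closed_convex : IsProperClosedConvex p.h
  dom_bounded : Bornology.IsBounded (effDom p.h)
  g_convex : ConvexOn ℝ Set.univ p.g
  mu_pos : 0 < μ
  f_strong : StrongConvexOn Set.univ μ p.f
  kkt_stationary : ∃ v ∈ subdiff (addExt p.f p.h) xs, v + zs • gradient p.g xs = 0
  kkt_dual : 0 ≤ zs
  kkt_primal : p.g xs ≤ 0
  kkt_compl : p.g xs * zs = 0

/-- `θ(x) = g(x) + z/β`. -/
noncomputable def θ (p : Problem E) (β z : ℝ) (x : E) : ℝ := p.g x + z / β

/-- The smooth part `Φ(·, y) - h` of the saddle function, i.e. `f + β (y θ - y²/2)`. -/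
noncomputable def Φsmooth (p : Problem E) (β z y : ℝ) (x : E) : ℝ :=
  p.f x + β * (y * p.θ β z x - y ^ 2 / 2)

/-- A call of APG on `f`-and-`g`-based smooth part `ψ` plus `h`. The cost `N` counts evaluations of
`f`, `∇f`, `g` and `J_g`: a value of `ψ` costs one of `f` and one of `g`, a gradient of `ψ` one of
`∇f` and one of `J_g`. -/
def Solve (p : Problem E) (μ : ℝ) (ls : LineSearch) (ψ : E → ℝ) (tol : ℝ)
    (y₀ x : E) (N : ℕ) : Prop :=
  ∃ t : ℕ, APG ψ p.h μ ls tol y₀ x t ∧ N = 2 * t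

/-- The tolerance `μδ/(4 B_g)` used in the interval search and in the bisection. -/
noncomputable def tol (p : Problem E) (μ δ : ℝ) : ℝ := μ * δ / (4 * p.Bg)

/-! Below, `start : ℕ → E` lists the initial points for the successive calls of APG (each of them
may be chosen freely), and `i` is the number of calls made so far. -/

/-- The while loop of the interval search, with current interval `[a, b]` and current point `x`, and
the `if` after it. It returns `[a', b']`, with `a' = b'` if a single point is returned. The
evaluation `g(x)` for the tests is charged 1. -/
inductive IntVLoop (p : Problem E) (μ : ℝ) (ls : LineSearch) (β z δ : ℝ) (start : ℕ → E) :
    ℝ → ℝ → E → ℕ → ℝ → ℝ → ℕ → ℕ → Prop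
  | grow {a b : ℝ} {x x' : E} {i : ℕ} {a' b' : ℝ} {i' N N' : ℕ} :
      |max (p.θ β z x) 0 - b| > 3 * δ / 4 →
      p.θ β z x - b > 0 →
      p.Solve μ ls (p.Φsmooth β z (2 * b)) (p.tol μ δ) (start i) x' N →
      IntVLoop p μ ls β z δ start b (2 * b) x' (i + 1) a' b' i' N' →
      IntVLoop p μ ls β z δ start a b x i a' b' i' (1 + N + N')
  | point {a b : ℝ} {x : E} {i : ℕ} :
      |max (p.θ β z x) 0 - b| ≤ 3 * δ / 4 →
      IntVLoop p μ ls β z δ start a b x i b b i 1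
  | interval {a b : ℝ} {x : E} {i : ℕ} :
      |max (p.θ β z x) 0 - b| > 3 * δ / 4 →
      ¬ (p.θ β z x - b > 0) →
      IntVLoop p μ ls β z δ start a b x i a b i 1

/-- The interval search: after `i` earlier calls of APG it returns `[a, b]` at cost `N`, with `i'`
calls of APG made in total. -/
inductive IntV (p : Problem E) (μ : ℝ) (ls : LineSearch) (β z δ : ℝ) (start : ℕ → E) :
    ℕ → ℝ → ℝ → ℕ → ℕ → Prop
  | zero {i : ℕ} {x : E} {N : ℕ} :
      p.Solve μ ls (p.Φsmooth β z 0) (p.tol μ δ) (start i) x N →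
      max (p.θ β z x) 0 ≤ 3 * δ / 4 →
      IntV p μ ls β z δ start i 0 0 (i + 1) (N + 1)
  | search {i : ℕ} {x x' : E} {a b : ℝ} {i' N₁ N₂ N₃ : ℕ} :
      p.Solve μ ls (p.Φsmooth β z 0) (p.tol μ δ) (start i) x N₁ →
      ¬ (max (p.θ β z x) 0 ≤ 3 * δ / 4) →
      p.Solve μ ls (p.Φsmooth β z (1 / β)) (p.tol μ δ) (start (i + 1)) x' N₂ →
      IntVLoop p μ ls β z δ start 0 (1 / β) x' (i + 2) a b i' N₃ →
      IntV p μ ls β z δ start i a b i' (N₁ + 1 + N₂ + N₃)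

/-- The while loop of the bisection method with current interval `[a, b]`, together with the final
step; it returns `(x, y)`. -/
inductive BiSecLoop (p : Problem E) (μ : ℝ) (ls : LineSearch) (β z δ : ℝ) (start : ℕ → E) :
    ℝ → ℝ → ℕ → E → ℝ → ℕ → ℕ → Prop
  | done {a b : ℝ} {i : ℕ} {x : E} {N : ℕ} :
      ¬ (b - a > μ * δ / (μ + β * p.Bg ^ 2)) →
      p.Solve μ ls (p.Φsmooth β z ((a + b) / 2)) (p.tol μ δ) (start i) x N →
      BiSecLoop p μ ls β z δ start a b i x ((a + b) / 2) (i + 1) N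
  | hit {a b : ℝ} {i : ℕ} {x : E} {N : ℕ} :
      b - a > μ * δ / (μ + β * p.Bg ^ 2) →
      p.Solve μ ls (p.Φsmooth β z ((a + b) / 2)) (p.tol μ δ) (start i) x N →
      |max (p.θ β z x) 0 - (a + b) / 2| ≤ 3 * δ / 4 →
      BiSecLoop p μ ls β z δ start a b i x ((a + b) / 2) (i + 1) (N + 1)
  | raise_left {a b : ℝ} {i : ℕ} {x x' : E} {y : ℝ} {i' N N' : ℕ} :
      b - a > μ * δ / (μ + β * p.Bg ^ 2) →
      p.Solve μ ls (p.Φsmooth β z ((a + b) / 2)) (p.tol μ δ) (start i) x N →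
      ¬ (|max (p.θ β z x) 0 - (a + b) / 2| ≤ 3 * δ / 4) →
      p.θ β z x - (a + b) / 2 > 0 →
      BiSecLoop p μ ls β z δ start ((a + b) / 2) b (i + 1) x' y i' N' →
      BiSecLoop p μ ls β z δ start a b i x' y i' (N + 1 + N')
  | lower_right {a b : ℝ} {i : ℕ} {x x' : E} {y : ℝ} {i' N N' : ℕ} :
      b - a > μ * δ / (μ + β * p.Bg ^ 2) →
      p.Solve μ ls (p.Φsmooth β z ((a + b) / 2)) (p.tol μ δ) (start i) x N →
      ¬ (|max (p.θ β z x) 0 - (a + b) / 2| ≤ 3 * δ / 4) →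
      ¬ (p.θ β z x - (a + b) / 2 > 0) →
      BiSecLoop p μ ls β z δ start a ((a + b) / 2) (i + 1) x' y i' N' →
      BiSecLoop p μ ls β z δ start a b i x' y i' (N + 1 + N')

/-- The bisection subroutine: interval search followed by bisection. -/
def BiSec (p : Problem E) (μ : ℝ) (ls : LineSearch) (β z δ : ℝ) (start : ℕ → E)
    (i : ℕ) (x : E) (y : ℝ) (i' N : ℕ) : Prop :=
  ∃ (a b : ℝ) (j N₁ N₂ : ℕ),
    IntV p μ ls β z δ start i a b j N₁ ∧
    BiSecLoop p μ ls β z δ start a b j x y i' N₂ ∧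
    N = N₁ + N₂

/-- Computation of the next primal iterate of the augmented Lagrangian method: the bisection with
`δ = ε_k / (3 β B_g)`, and then, if `μ / (4 β B_g²) > 1`, a further call of APG with tolerance
`ε_k / 3` and smooth part `f + β y g`. -/
def PrimalUpdate (p : Problem E) (μ : ℝ) (ls : LineSearch) (β z εk : ℝ) (start : ℕ → E)
    (i : ℕ) (x : E) (i' N : ℕ) : Prop :=
  ∃ (x₁ : E) (y : ℝ) (i₁ N₁ : ℕ),
    p.BiSec μ ls β z (εk / (3 * β * p.Bg)) start i x₁ y i₁ N₁ ∧
    ((μ / (4 * β * p.Bg ^ 2) > 1 ∧ i' = i₁ + 1 ∧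
        ∃ N₂ : ℕ, p.Solve μ ls (fun u => p.f u + β * (y * p.g u)) (εk / 3) (start i₁) x N₂ ∧
          N = N₁ + N₂) ∨
      (¬ (μ / (4 * β * p.Bg ^ 2) > 1) ∧ i' = i₁ ∧ x = x₁ ∧ N = N₁))

/-- The outer loop of the augmented Lagrangian method, entered at iteration `k` with multiplier `z`
after `i` calls of APG, with penalty parameters `β_k = β₀ σ^k` and subproblem tolerances `εs k`.
It returns `(x, z')` at total cost `N`. Per iteration the multiplier update is charged one
evaluation of `g`, and the stopping test one evaluation of each of `∇f`, `g`, `J_g`. -/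
inductive IALMLoop (p : Problem E) (μ : ℝ) (ls : LineSearch) (β₀ σ ε : ℝ) (εs : ℕ → ℝ)
    (start : ℕ → E) : ℕ → ℝ → ℕ → E → ℝ → ℕ → Prop
  | finish {k : ℕ} {z : ℝ} {i : ℕ} {x : E} {i' N : ℕ} :
      p.PrimalUpdate μ ls (β₀ * σ ^ k) z (εs k) start i x i' N →
      p.IsEpsKKTPair ε x (max (z + β₀ * σ ^ k * p.g x) 0) →
      IALMLoop p μ ls β₀ σ ε εs start k z i x (max (z + β₀ * σ ^ k * p.g x) 0) (N + 4)
  | next {k : ℕ} {z : ℝ} {i : ℕ} {x x' : E} {z' : ℝ} {i' N N' : ℕ} :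
      p.PrimalUpdate μ ls (β₀ * σ ^ k) z (εs k) start i x i' N →
      ¬ p.IsEpsKKTPair ε x (max (z + β₀ * σ ^ k * p.g x) 0) →
      IALMLoop p μ ls β₀ σ ε εs start (k + 1) (max (z + β₀ * σ ^ k * p.g x) 0) i' x' z' N' →
      IALMLoop p μ ls β₀ σ ε εs start k z i x' z' (N + 4 + N')

/-- `p.IALM μ ls β₀ σ ε εs start x z N`: the cutting-plane based inexact augmented Lagrangian method
for one constraint, with `z⁰ = 0`, stops with output `(x, z)` after exactly `N` evaluations of
`f`, `∇f`, `g` and `J_g`. -/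
def IALM (p : Problem E) (μ : ℝ) (ls : LineSearch) (β₀ σ ε : ℝ) (εs : ℕ → ℝ) (start : ℕ → E)
    (x : E) (z : ℝ) (N : ℕ) : Prop :=
  IALMLoop p μ ls β₀ σ ε εs start 0 0 0 x z N

end Problem

/-- The subproblem tolerance `min {ε, √(ε μ (σ - 1) / (8 σ + 1))}`. -/
noncomputable def subTol (μ σ ε : ℝ) : ℝ := min ε (Real.sqrt (ε * μ * (σ - 1) / (8 * σ + 1)))

/-!
The claim that the output is an `ε`-KKT point is the stopping test. What has to be shown is that
every loop ends, and how long it takes.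

*The accelerated method.* With `v^k = x^{k-1} + (x^k - x^{k-1}) / α_{k-1}`, the function
`P(x^k) - P* + (μ / 2) ‖v^k - x*‖²` contracts by the factor `1 - √(μ / L)` in a pass whose accepted
value is `L ≥ μ` (`APGSetup.lyap_le`); the weight `μ / 2` does not involve `L`, so the accepted values
may vary freely. A step accepted with `L < μ` does not move, and so has found the minimizer. The two
line searches of a pass continue each other up to the largest admissible value `Λ`, so that a pass
costs `O(1 + log (Λ / L))`, with `L` the value accepted in the preceding pass up to a constant. As
`1 + log (Λ / L) = O(√(Λ / L))`, this is at most a constant times `√(Λ / μ)` per unit by which the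
preceding pass decreased the logarithm of the Lyapunov function, and one call costs
`O(√(Λ / μ) log (1 / τ))` with a constant independent of all bounds on the data
(`APGSetup.loop_cost`).

*The bisection.* Let `q(y) = [θ(x(y))]_+ - y`, where `x(y)` is the exact subproblem solution. It is
Lipschitz with constant `(μ + β B_g²) / μ`, and an approximate solution determines it up to `δ / 4`.
The search keeps `q(a) > δ / 2` and `q(b) < -δ / 2`, and returns `y` with `|q(y)| ≤ δ`
(`Problem.SearchOracle.biSec_spec`). Strong monotonicity of the Lagrangian saddle operator
(`Problem.Assumptions.norm_sq_le_of_nearStationary`), applied at the KKT pair, shows that `q(y) > 0`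
forces `β y ≤ max (z*, z)`, which bounds the interval and hence the smoothness constants of the
subproblems.

*The outer loop.* The returned point is nearly stationary for the Lagrangian with the updated
multiplier. The same monotonicity makes the multiplier update nonexpansive towards `z*` up to an
error `β ε̄² / (2 μ)` (`Problem.Assumptions.multiplier_step`). Summing the geometric series of errors,
the definition of `ε̄` keeps `(z^k - z*)² ≤ z*² + ε β_k / (2 (8 σ + 1))`, and the stopping test holds
as soon as `β_k ≥ 4 (1 + z*)² / ε` (`Problem.Assumptions.isEpsKKTPair_of_le`). So there are
`O(log (1 / ε))` outer iterations, each with `O(log (1 / ε))` calls of the accelerated method, and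
`z^k ≤ 3 (1 + z*)` throughout, whence `Λ = O(L_f + L_g (1 + z*))`.

For small `ε`, every datum is at most `H = 1 / ε`. All ratios inside logarithms are then at most
fixed powers of `H`, so the constant in front depends only on `σ`, `γ₁`, `γ₂` and `ρ`.
-/

/-! ### Smooth convex functions and real-valued subgradient inequalities -/

section ConvexBasics

theorem addExt_eq_top {X : Type*} {h : X → EReal} (ψ : X → ℝ) {x : X} (hx : x ∉ effDom h) :
    addExt ψ h x = ⊤ := by
  have : h x = ⊤ := by simpa [effDom] using hx
  rw [addExt, this, EReal.coe_add_top]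

variable {E : Type*} [NormedAddCommGroup E] [InnerProductSpace ℝ E]

/-- The subgradient inequality for `h` at `x`, stated between real numbers: it only involves points
of the effective domain, where `EReal.toReal` is faithful. -/
def IsSubgradAt (h : E → EReal) (x v : E) : Prop :=
  ∀ u ∈ effDom h, (h x).toReal + inner ℝ v (u - x) ≤ (h u).toReal

theorem IsProperClosedConvex.coe_toReal {h : E → EReal} (hh : IsProperClosedConvex h) {x : E}
    (hx : x ∈ effDom h) : ((h x).toReal : EReal) = h x :=
  EReal.coe_toReal (ne_of_lt hx) (hh.ne_bot x)

theorem IsProperClosedConvex.addExt_eq {h : E → EReal} (hh : IsProperClosedConvex h) (ψ : E → ℝ)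
    {x : E} (hx : x ∈ effDom h) : addExt ψ h x = ((ψ x + (h x).toReal : ℝ) : EReal) := by
  rw [addExt, EReal.coe_add, hh.coe_toReal hx]

theorem IsProperClosedConvex.mem_subdiff_iff {h : E → EReal} (hh : IsProperClosedConvex h)
    (ψ : E → ℝ) {x v : E} (hx : x ∈ effDom h) :
    v ∈ subdiff (addExt ψ h) x ↔
      ∀ u ∈ effDom h, ψ x + (h x).toReal + inner ℝ v (u - x) ≤ ψ u + (h u).toReal := by
  constructor
  · intro hv u hu
    have := hv u
    rw [hh.addExt_eq ψ hx, hh.addExt_eq ψ hu, ← EReal.coe_add, EReal.coe_le_coe_iff] at this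
    exact this
  · intro hv u
    by_cases hu : u ∈ effDom h
    · rw [hh.addExt_eq ψ hx, hh.addExt_eq ψ hu, ← EReal.coe_add, EReal.coe_le_coe_iff]
      exact hv u hu
    · rw [addExt_eq_top ψ hu]
      exact le_top

/-- A point with nonempty subdifferential lies in the domain. -/
theorem IsProperClosedConvex.mem_effDom_of_subdiff {h : E → EReal} (hh : IsProperClosedConvex h)
    (ψ : E → ℝ) {x v : E} (hv : v ∈ subdiff (addExt ψ h) x) : x ∈ effDom h := by
  by_contra hx
  obtain ⟨u, hu⟩ := hh.dom_nonempty
  have := hv u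
  rw [addExt_eq_top ψ hx, EReal.top_add_coe, hh.addExt_eq ψ hu] at this
  exact absurd this (not_le.2 (EReal.coe_lt_top _))

theorem IsProperClosedConvex.convex_comb {h : E → EReal} (hh : IsProperClosedConvex h) {x u : E}
    (hx : x ∈ effDom h) (hu : u ∈ effDom h) {t : ℝ} (ht : 0 ≤ t) (ht1 : t ≤ 1) :
    x + t • (u - x) ∈ effDom h ∧
      (h (x + t • (u - x))).toReal ≤ (1 - t) * (h x).toReal + t * (h u).toReal := by
  have key := hh.convex_epigraph (x := (x, (h x).toReal)) (y := (u, (h u).toReal))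
    (by simp [hh.coe_toReal hx]) (by simp [hh.coe_toReal hu])
    (sub_nonneg.2 ht1) ht (by ring)
  have e : (1 - t) • x + t • u = x + t • (u - x) := by module
  simp only [Set.mem_ofPred_eq, Prod.smul_mk, Prod.mk_add_mk, smul_eq_mul, e] at key
  have hm : x + t • (u - x) ∈ effDom h := lt_of_le_of_lt key (EReal.coe_lt_top _)
  refine ⟨hm, ?_⟩
  rwa [← hh.coe_toReal hm, EReal.coe_le_coe_iff] at key

/-- First-order comparison: dividing by `t` and letting `t → 0` removes the quadratic term. -/
theorem nonneg_of_forall_mul_add_sq {a b : ℝ}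
    (H : ∀ t : ℝ, 0 < t → t ≤ 1 → 0 ≤ t * a + t ^ 2 * b) : 0 ≤ a := by
  have h1 : ∀ t : ℝ, 0 < t → t ≤ 1 → 0 ≤ a + t * b := by
    intro t ht ht1
    have := H t ht ht1
    have e : t * a + t ^ 2 * b = t * (a + t * b) := by ring
    rw [e] at this
    exact nonneg_of_mul_nonneg_right this ht
  have ht : Filter.Tendsto (fun t : ℝ => a + t * b) (nhdsWithin 0 (Set.Ioi 0)) (nhds a) := by
    have : Filter.Tendsto (fun t : ℝ => a + t * b) (nhds 0) (nhds (a + 0 * b)) :=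
      (by fun_prop : Continuous fun t : ℝ => a + t * b).tendsto 0
    simp only [zero_mul, add_zero] at this
    exact this.mono_left nhdsWithin_le_nhds
  refine ge_of_tendsto ht ?_
  filter_upwards [Ioc_mem_nhdsGT (zero_lt_one' ℝ)] with t ht
  exact h1 t ht.1 ht.2

/-- Sum rule: if `ψ` has a quadratic upper model with slope `w` at `x`, then subtracting `w` from a
subgradient of `ψ + h` at `x` leaves a subgradient of `h`. -/
theorem IsProperClosedConvex.isSubgradAt_sub {h : E → EReal} (hh : IsProperClosedConvex h)
    {ψ : E → ℝ} {x v w : E} {L : ℝ} (hx : x ∈ effDom h)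
    (hup : ∀ u, ψ u ≤ ψ x + inner ℝ w (u - x) + L / 2 * ‖u - x‖ ^ 2)
    (hv : ∀ u ∈ effDom h, ψ x + (h x).toReal + inner ℝ v (u - x) ≤ ψ u + (h u).toReal) :
    IsSubgradAt h x (v - w) := by
  intro u hu
  suffices 0 ≤ (h u).toReal - (h x).toReal - inner ℝ (v - w) (u - x) by linarith
  refine nonneg_of_forall_mul_add_sq (b := L / 2 * ‖u - x‖ ^ 2) fun t ht ht1 => ?_
  obtain ⟨hm, hc⟩ := hh.convex_comb hx hu ht.le ht1
  have h1 := hv _ hm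
  have h2 := hup (x + t • (u - x))
  simp only [add_sub_cancel_left, inner_smul_right, norm_smul, mul_pow, Real.norm_eq_abs,
    sq_abs] at h1 h2
  rw [inner_sub_left]
  nlinarith

/-- Minimizers of `ψ + h` exist for continuous `ψ` when `h` has bounded domain. -/
theorem IsProperClosedConvex.exists_isMin [ProperSpace E] {h : E → EReal}
    (hh : IsProperClosedConvex h) (hb : Bornology.IsBounded (effDom h)) {ψ : E → ℝ}
    (hψ : Continuous ψ) : ∃ x ∈ effDom h, ∀ u, addExt ψ h x ≤ addExt ψ h u := by
  obtain ⟨x₀, hx₀⟩ := hh.dom_nonempty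
  have hl : LowerSemicontinuous (addExt ψ h) := by
    refine LowerSemicontinuous.add' (continuous_coe_real_ereal.comp hψ).lowerSemicontinuous
      hh.lsc fun x => EReal.continuousAt_add (Or.inl (EReal.coe_ne_top _))
        (Or.inl (EReal.coe_ne_bot _))
  obtain ⟨a, -, hmin⟩ := (hl.lowerSemicontinuousOn (closure (effDom h))).exists_isMinOn
    ⟨x₀, subset_closure hx₀⟩ hb.isCompact_closure
  have hall : ∀ u, addExt ψ h a ≤ addExt ψ h u := by
    intro u
    by_cases hu : u ∈ effDom h
    · exact hmin (subset_closure hu)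
    · rw [addExt_eq_top ψ hu]; exact le_top
  refine ⟨a, ?_, hall⟩
  by_contra ha
  have := hall x₀
  rw [addExt_eq_top ψ ha, hh.addExt_eq ψ hx₀] at this
  exact absurd this (not_le.2 (EReal.coe_lt_top _))

theorem IsProperClosedConvex.mem_effDom_of_isMin {h : E → EReal} (hh : IsProperClosedConvex h)
    {ψ : E → ℝ} {x : E} (hx : ∀ u, addExt ψ h x ≤ addExt ψ h u) : x ∈ effDom h :=
  hh.mem_effDom_of_subdiff (v := 0) ψ (by intro u; simpa using hx u)

theorem IsProperClosedConvex.real_isMin {h : E → EReal} (hh : IsProperClosedConvex h)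
    {ψ : E → ℝ} {x : E} (hx : ∀ u, addExt ψ h x ≤ addExt ψ h u) {u : E} (hu : u ∈ effDom h) :
    ψ x + (h x).toReal ≤ ψ u + (h u).toReal := by
  have h1 := (hh.mem_subdiff_iff ψ (v := 0) (hh.mem_effDom_of_isMin hx)).1
    (by intro u; simpa using hx u) u hu
  simpa using h1

/-- Near-stationarity from a single short subgradient. -/
theorem nearStationary_of_mem {P : E → EReal} {ε : ℝ} {x v : E} (hv : v ∈ subdiff P x)
    (hε : ‖v‖ ≤ ε) : NearStationary P ε x := by
  refine (Metric.infEDist_le_edist_of_mem hv).trans ?_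
  rw [edist_dist, dist_zero_left]
  exact ENNReal.ofReal_le_ofReal hε

theorem NearStationary.mono {P : E → EReal} {ε ε' : ℝ} {x : E} (h : NearStationary P ε x)
    (hε : ε ≤ ε') : NearStationary P ε' x :=
  le_trans h (ENNReal.ofReal_le_ofReal hε)

theorem NearStationary.exists_mem {P : E → EReal} {ε : ℝ} {x : E} (hP : NearStationary P ε x)
    (hε : 0 ≤ ε) {η : ℝ} (hη : 0 < η) : ∃ v ∈ subdiff P x, ‖v‖ < ε + η := by
  have : Metric.infEDist (0 : E) (subdiff P x) < ENNReal.ofReal (ε + η) :=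
    lt_of_le_of_lt hP ((ENNReal.ofReal_lt_ofReal_iff (by linarith)).2 (by linarith))
  obtain ⟨v, hv, hlt⟩ := Metric.infEDist_lt_iff.1 this
  refine ⟨v, hv, ?_⟩
  rw [edist_dist, dist_zero_left] at hlt
  exact (ENNReal.ofReal_lt_ofReal_iff (by linarith)).1 hlt

theorem nearStationary_of_forall_pos {P : E → EReal} {ε : ℝ} {x : E} (hε : 0 ≤ ε)
    (H : ∀ η : ℝ, 0 < η → ∃ v ∈ subdiff P x, ‖v‖ ≤ ε + η) : NearStationary P ε x := by
  refine ENNReal.le_of_forall_pos_le_add fun η hη _ => ?_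
  obtain ⟨v, hv, hle⟩ := H η hη
  have := nearStationary_of_mem hv hle
  rw [NearStationary, ENNReal.ofReal_add hε η.coe_nonneg] at this
  simpa using this

variable [CompleteSpace E]

/-- Descent lemma, in two-sided form. -/
theorem abs_sub_linear_le_of_lipschitz_gradient {ψ : E → ℝ} {G : E → E} {L : ℝ}
    (hG : ∀ x, HasGradientAt ψ (G x) x) (hL : ∀ x y, ‖G x - G y‖ ≤ L * ‖x - y‖) (x u : E) :
    |ψ u - ψ x - inner ℝ (G x) (u - x)| ≤ L / 2 * ‖u - x‖ ^ 2 := by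
  have key : ∀ (s : ℝ), |s| = 1 → s * (ψ u - ψ x - inner ℝ (G x) (u - x)) ≤
      L / 2 * ‖u - x‖ ^ 2 := by
    intro s hs
    set d := u - x with hd
    have hder : ∀ t : ℝ, HasDerivAt (fun t : ℝ => ψ (x + t • d)) (inner ℝ (G (x + t • d)) d) t := by
      intro t
      have h1 : HasDerivAt (fun t : ℝ => x + t • d) d t := by
        simpa using ((hasDerivAt_id t).smul_const d).const_add x
      have h2 := (hG (x + t • d)).hasFDerivAt.comp_hasDerivAt t h1
      rw [InnerProductSpace.toDual_apply_apply] at h2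
      exact h2
    have hk : ∀ t : ℝ, HasDerivAt (fun t : ℝ => s * (ψ (x + t • d) - t * inner ℝ (G x) d) -
        L / 2 * ‖d‖ ^ 2 * t ^ 2)
        (s * (inner ℝ (G (x + t • d)) d - inner ℝ (G x) d) - L / 2 * ‖d‖ ^ 2 * (2 * t)) t := by
      intro t
      have h1 := (((hder t).sub ((hasDerivAt_id t).mul_const (inner ℝ (G x) d))).const_mul s).sub
        ((hasDerivAt_pow 2 t).const_mul (L / 2 * ‖d‖ ^ 2))
      refine h1.congr_deriv ?_
      simp
    have hanti : AntitoneOn (fun t : ℝ => s * (ψ (x + t • d) - t * inner ℝ (G x) d) -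
        L / 2 * ‖d‖ ^ 2 * t ^ 2) (Set.Icc 0 1) := by
      refine antitoneOn_of_deriv_nonpos (convex_Icc 0 1)
        (fun t _ => (hk t).continuousAt.continuousWithinAt)
        (fun t _ => (hk t).differentiableAt.differentiableWithinAt) ?_
      intro t ht
      rw [interior_Icc] at ht
      rw [(hk t).deriv, ← inner_sub_left]
      have h1 : |inner ℝ (G (x + t • d) - G x) d| ≤ L * t * ‖d‖ * ‖d‖ := by
        refine (abs_real_inner_le_norm _ _).trans ?_
        refine mul_le_mul_of_nonneg_right ?_ (norm_nonneg _)
        have := hL (x + t • d) x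
        rw [add_sub_cancel_left, norm_smul, Real.norm_eq_abs, abs_of_pos ht.1] at this
        linarith
      have h2 : s * inner ℝ (G (x + t • d) - G x) d ≤ |inner ℝ (G (x + t • d) - G x) d| := by
        refine (le_abs_self _).trans ?_
        rw [abs_mul, hs, one_mul]
      nlinarith
    have h01 := hanti (Set.left_mem_Icc.2 zero_le_one) (Set.right_mem_Icc.2 zero_le_one)
      zero_le_one
    simp only [one_smul, zero_smul, add_zero, hd, add_sub_cancel] at h01
    rw [← hd] at h01
    nlinarith
  rw [abs_le]
  constructor
  · have := key (-1) (by simp)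
    linarith
  · have := key 1 (by simp)
    linarith

theorem StrongConvexOn.gradient_lower_bound {ψ : E → ℝ} {G : E → E} {L μ : ℝ}
    (hs : StrongConvexOn Set.univ μ ψ)
    (hG : ∀ x, HasGradientAt ψ (G x) x) (hL : ∀ x y, ‖G x - G y‖ ≤ L * ‖x - y‖) (x u : E) :
    ψ x + inner ℝ (G x) (u - x) + μ / 2 * ‖u - x‖ ^ 2 ≤ ψ u := by
  suffices 0 ≤ ψ u - ψ x - inner ℝ (G x) (u - x) - μ / 2 * ‖u - x‖ ^ 2 by linarith
  refine nonneg_of_forall_mul_add_sq (b := (L / 2 + μ / 2) * ‖u - x‖ ^ 2) fun t ht ht1 => ?_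
  have h1 := hs.2 (Set.mem_univ x) (Set.mem_univ u) (sub_nonneg.2 ht1) ht.le (by ring)
  have e : (1 - t) • x + t • u = x + t • (u - x) := by module
  rw [e] at h1
  simp only [smul_eq_mul] at h1
  have h2 := (abs_le.1 (abs_sub_linear_le_of_lipschitz_gradient hG hL x (x + t • (u - x)))).1
  simp only [add_sub_cancel_left, inner_smul_right, norm_smul, mul_pow, Real.norm_eq_abs,
    sq_abs] at h2
  rw [norm_sub_rev x u] at h1
  nlinarith

/-- `ψ` is differentiable, has an `L`-Lipschitz gradient and lies between its quadratic models of
curvature `μ` and `L`. -/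
structure SmoothStrong (ψ : E → ℝ) (μ L : ℝ) : Prop where
  cont : Continuous ψ
  lip : ∀ x y, ‖gradient ψ x - gradient ψ y‖ ≤ L * ‖x - y‖
  lower : ∀ x u, ψ x + inner ℝ (gradient ψ x) (u - x) + μ / 2 * ‖u - x‖ ^ 2 ≤ ψ u
  upper : ∀ x u, ψ u ≤ ψ x + inner ℝ (gradient ψ x) (u - x) + L / 2 * ‖u - x‖ ^ 2

theorem smoothStrong_of_strongConvexOn {ψ : E → ℝ} {L μ : ℝ} (hd : Differentiable ℝ ψ)
    (hL : ∀ x y, ‖gradient ψ x - gradient ψ y‖ ≤ L * ‖x - y‖)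
    (hs : StrongConvexOn Set.univ μ ψ) : SmoothStrong ψ μ L where
  cont := hd.continuous
  lip := hL
  lower := hs.gradient_lower_bound (fun x => (hd x).hasGradientAt) hL
  upper x u := by
    have := (abs_le.1 (abs_sub_linear_le_of_lipschitz_gradient
      (fun x => (hd x).hasGradientAt) hL x u)).2
    linarith

theorem SmoothStrong.mono {ψ : E → ℝ} {μ L L' : ℝ} (hψ : SmoothStrong ψ μ L) (h : L ≤ L') :
    SmoothStrong ψ μ L' where
  cont := hψ.cont
  lip x y := (hψ.lip x y).trans (mul_le_mul_of_nonneg_right h (norm_nonneg _))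
  lower := hψ.lower
  upper x u := (hψ.upper x u).trans (by gcongr)

/-- Adding the gradient of the smooth part turns subgradients of `h` into subgradients of `ψ + h`,
and the strong convexity of `ψ` improves the subgradient inequality. -/
theorem SmoothStrong.growth {ψ : E → ℝ} {μ L : ℝ} (hψ : SmoothStrong ψ μ L) {h : E → EReal}
    {x v : E} (hv : IsSubgradAt h x (v - gradient ψ x)) {u : E} (hu : u ∈ effDom h) :
    ψ x + (h x).toReal + inner ℝ v (u - x) + μ / 2 * ‖u - x‖ ^ 2 ≤ ψ u + (h u).toReal := by
  have h1 := hv u hu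
  have h2 := hψ.lower x u
  rw [inner_sub_left] at h1
  linarith

theorem SmoothStrong.mem_subdiff_iff {ψ : E → ℝ} {μ L : ℝ} (hψ : SmoothStrong ψ μ L) (hμ : 0 ≤ μ)
    {h : E → EReal} (hh : IsProperClosedConvex h) {x v : E} (hx : x ∈ effDom h) :
    v ∈ subdiff (addExt ψ h) x ↔ IsSubgradAt h x (v - gradient ψ x) := by
  rw [hh.mem_subdiff_iff ψ hx]
  constructor
  · exact hh.isSubgradAt_sub hx (hψ.upper x)
  · intro hv u hu
    have := hψ.growth hv hu
    have : 0 ≤ μ / 2 * ‖u - x‖ ^ 2 := by positivity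
    linarith

end ConvexBasics

/-! ### Proximal gradient steps and the backtracking line search -/

section ProxStep

variable {E : Type*} [NormedAddCommGroup E] [InnerProductSpace ℝ E] [CompleteSpace E]

/-- The value of `ψ + h` as a real number; meaningful on the effective domain of `h`. -/
noncomputable def objVal (ψ : E → ℝ) (h : E → EReal) (x : E) : ℝ := ψ x + (h x).toReal

theorem IsProxGradStep.mem_effDom {ψ : E → ℝ} {h : E → EReal} {L : ℝ} {y x : E}
    (hh : IsProperClosedConvex h) (hx : IsProxGradStep ψ h L y x) : x ∈ effDom h :=
  hh.mem_effDom_of_isMin hx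

theorem IsProxGradStep.isSubgradAt {ψ : E → ℝ} {h : E → EReal} {L : ℝ} {y x : E}
    (hh : IsProperClosedConvex h) (hx : IsProxGradStep ψ h L y x) :
    IsSubgradAt h x (-gradient ψ y - L • (x - y)) := by
  have hm := hx.mem_effDom hh
  have := hh.isSubgradAt_sub (v := 0) (w := gradient ψ y + L • (x - y)) (L := L)
    (ψ := fun w => inner ℝ (gradient ψ y) w + L / 2 * ‖w - y‖ ^ 2) hm
    (fun u => ?_) (fun u hu => ?_)
  · rwa [zero_sub, neg_add'] at this
  · have e : u - y = (u - x) + (x - y) := by abel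
    have e' : inner ℝ (gradient ψ y) u = inner ℝ (gradient ψ y) x + inner ℝ (gradient ψ y) (u - x) := by
      rw [← inner_add_right]; congr 1; abel
    simp only [e, e', norm_add_sq_real, inner_add_left, inner_smul_left, RCLike.conj_to_real]
    rw [real_inner_comm (u - x) (x - y)]
    apply le_of_eq; ring
  · have := hh.real_isMin hx hu
    simpa using this

theorem IsProperClosedConvex.exists_isProxGradStep [ProperSpace E] {h : E → EReal}
    (hh : IsProperClosedConvex h) (hb : Bornology.IsBounded (effDom h)) (ψ : E → ℝ) (L : ℝ) (y : E) :
    ∃ x, IsProxGradStep ψ h L y x := by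
  obtain ⟨x, -, hx⟩ := hh.exists_isMin hb
    (ψ := fun w => inner ℝ (gradient ψ y) w + L / 2 * ‖w - y‖ ^ 2) (by fun_prop)
  exact ⟨x, hx⟩

/-- The basic inequality of an accepted proximal gradient step. -/
theorem IsProxGradStep.objVal_le {ψ : E → ℝ} {h : E → EReal} {μ Lψ L : ℝ} {y x : E}
    (hψ : SmoothStrong ψ μ Lψ) (hh : IsProperClosedConvex h) (hx : IsProxGradStep ψ h L y x)
    (hd : SufficientDecrease ψ L y x) {u : E} (hu : u ∈ effDom h) :
    objVal ψ h x ≤ objVal ψ h u + L / 2 * (‖u - y‖ ^ 2 - ‖u - x‖ ^ 2) - μ / 2 * ‖u - y‖ ^ 2 := by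
  have h1 := hx.isSubgradAt hh u hu
  have h2 := hψ.lower y u
  have h3 : ψ x ≤ _ := hd
  have e : u - y = (u - x) + (x - y) := by abel
  have e1 : ‖u - y‖ ^ 2 = ‖u - x‖ ^ 2 + 2 * inner ℝ (u - x) (x - y) + ‖x - y‖ ^ 2 := by
    rw [e, norm_add_sq_real]
  have e2 : inner ℝ (gradient ψ y) (u - y) =
      inner ℝ (gradient ψ y) (u - x) + inner ℝ (gradient ψ y) (x - y) := by
    rw [e, inner_add_right]
  rw [inner_sub_left, inner_neg_left, inner_smul_left, RCLike.conj_to_real,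
    real_inner_comm (u - x) (x - y)] at h1
  rw [e2] at h2
  unfold objVal
  linear_combination h1 + h2 + h3 - L / 2 * e1

/-- A step accepted with a value below the strong convexity modulus does not move, so that it has
reached a minimizer. -/
theorem IsProxGradStep.objVal_le_of_lt {ψ : E → ℝ} {h : E → EReal} {μ Lψ L : ℝ} {y x : E}
    (hψ : SmoothStrong ψ μ Lψ) (hh : IsProperClosedConvex h) (hx : IsProxGradStep ψ h L y x)
    (hd : SufficientDecrease ψ L y x) (hμ : 0 ≤ μ) (hL : L < μ) {u : E} (hu : u ∈ effDom h) :
    objVal ψ h x ≤ objVal ψ h u := by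
  have h2 := hψ.lower y x
  have h3 : ψ x ≤ _ := hd
  have h4 : ‖x - y‖ ^ 2 ≤ 0 := by nlinarith [sq_nonneg ‖x - y‖]
  have h5 : x = y := by
    have : ‖x - y‖ = 0 := by nlinarith [norm_nonneg (x - y)]
    exact sub_eq_zero.1 (norm_eq_zero.1 this)
  have h6 := hx.objVal_le hψ hh hd hu
  rw [← h5] at h6
  nlinarith [mul_nonneg hμ (sq_nonneg ‖u - x‖)]

theorem SmoothStrong.sufficientDecrease {ψ : E → ℝ} {μ Lψ L : ℝ} (hψ : SmoothStrong ψ μ Lψ)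
    (hL : Lψ ≤ L) (y x : E) : SufficientDecrease ψ L y x :=
  (hψ.mono hL).upper y x

theorem Backtrack.spec {ψ : E → ℝ} {h : E → EReal} {μ Lψ γ Λ : ℝ} {Y : ℝ → E}
    (hψ : SmoothStrong ψ μ Lψ) (hγ : 1 < γ) (hΛ' : γ * Lψ ≤ Λ) {L L' : ℝ} {x : E} {t : ℕ}
    (hb : Backtrack ψ h γ Y L L' x t) (hΛ : γ * L ≤ Λ) :
    L' = γ ^ t * L ∧ 1 ≤ t ∧ L' ≤ Λ ∧ IsProxGradStep ψ h L' (Y L') x ∧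
      SufficientDecrease ψ L' (Y L') x := by
  induction hb with
  | accept h1 h2 => exact ⟨by ring, le_rfl, hΛ, h1, h2⟩
  | @reject L L' x x' t h1 h2 h3 ih =>
    have hlt : γ * L < Lψ := by
      by_contra hge
      exact h2 (hψ.sufficientDecrease (not_lt.1 hge) _ _)
    obtain ⟨a, b, c⟩ := ih ((mul_le_mul_of_nonneg_left hlt.le (by linarith)).trans hΛ')
    exact ⟨by rw [a]; ring, by omega, c⟩

theorem exists_backtrack [ProperSpace E] {ψ : E → ℝ} {h : E → EReal} {μ Lψ γ : ℝ} (Y : ℝ → E)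
    (hψ : SmoothStrong ψ μ Lψ) (hh : IsProperClosedConvex h)
    (hb : Bornology.IsBounded (effDom h)) (hγ : 1 < γ) {L : ℝ} (hL : 0 < L) :
    ∃ L' x t, Backtrack ψ h γ Y L L' x t := by
  have key : ∀ (n : ℕ) (L : ℝ), 0 < L → Lψ ≤ γ ^ n * L → ∃ L' x t, Backtrack ψ h γ Y L L' x t := by
    intro n
    induction n with
    | zero =>
      intro L hL hn
      obtain ⟨x, hx⟩ := hh.exists_isProxGradStep hb ψ (γ * L) (Y (γ * L))
      by_cases hd : SufficientDecrease ψ (γ * L) (Y (γ * L)) x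
      · exact ⟨_, _, _, .accept hx hd⟩
      · exact absurd (hψ.sufficientDecrease (by nlinarith) _ _) hd
    | succ n ih =>
      intro L hL hn
      obtain ⟨x, hx⟩ := hh.exists_isProxGradStep hb ψ (γ * L) (Y (γ * L))
      by_cases hd : SufficientDecrease ψ (γ * L) (Y (γ * L)) x
      · exact ⟨_, _, _, .accept hx hd⟩
      · obtain ⟨L', x', t, ht⟩ := ih (γ * L) (by positivity) (by rw [pow_succ, mul_assoc] at hn; exact hn)
        exact ⟨_, _, _, .reject hx hd ht⟩
  obtain ⟨n, hn⟩ := pow_unbounded_of_one_lt (Lψ / L) hγ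
  exact key n L hL (by rw [div_lt_iff₀ hL] at hn; exact hn.le)

end ProxStep

/-! ### The accelerated proximal gradient method -/

section Accelerated

variable {E : Type*} [NormedAddCommGroup E] [InnerProductSpace ℝ E] [CompleteSpace E]

/-- What the analysis of the accelerated method needs: `ψ` is `μ`-strongly convex and `Lψ`-smooth,
`h` is proper closed convex, `xo` minimizes `ψ + h`, and `Λ` bounds every value which the line search
can accept. -/
structure APGSetup (ψ : E → ℝ) (h : E → EReal) (μ Lψ Λ : ℝ) (ls : LineSearch) (xo : E) :
    Prop where
  proper : IsProperClosedConvex h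
  smooth : SmoothStrong ψ μ Lψ
  mu_pos : 0 < μ
  mu_le : μ ≤ Lψ
  one_lt : 1 < ls.γ₁
  one_le : 1 ≤ ls.γ₂
  Lmin_pos : 0 < ls.Lmin
  Lmin_le : ls.Lmin ≤ Λ
  mul_le : ls.γ₁ * Lψ ≤ Λ
  mem : xo ∈ effDom h
  opt : ∀ u ∈ effDom h, objVal ψ h xo ≤ objVal ψ h u

namespace APGSetup

variable {ψ : E → ℝ} {h : E → EReal} {μ Lψ Λ : ℝ} {ls : LineSearch} {xo : E}

theorem Lψ_le (S : APGSetup ψ h μ Lψ Λ ls xo) : Lψ ≤ Λ := by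
  nlinarith [S.mul_le, S.one_lt, S.mu_pos, S.mu_le]

theorem mu_le_Λ (S : APGSetup ψ h μ Lψ Λ ls xo) : μ ≤ Λ := S.mu_le.trans S.Lψ_le

theorem Λ_pos (S : APGSetup ψ h μ Lψ Λ ls xo) : 0 < Λ := S.mu_pos.trans_le S.mu_le_Λ

theorem log_pos (S : APGSetup ψ h μ Lψ Λ ls xo) : 0 < Real.log ls.γ₁ := Real.log_pos S.one_lt

/-- A line search whose first trial value is `L`: the accepted value lies between `L` and `Λ`, and
the number of trials is the logarithm of the increase. -/
theorem backtrack (S : APGSetup ψ h μ Lψ Λ ls xo) {Y : ℝ → E} {L L' : ℝ} {x : E} {t : ℕ}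
    (hL : 0 < L) (hLΛ : L ≤ Λ) (hb : Backtrack ψ h ls.γ₁ Y (L / ls.γ₁) L' x t) :
    L ≤ L' ∧ L' ≤ Λ ∧ (t : ℝ) = 1 + (Real.log L' - Real.log L) / Real.log ls.γ₁ ∧
      IsProxGradStep ψ h L' (Y L') x ∧ SufficientDecrease ψ L' (Y L') x := by
  have hγ := S.one_lt
  have hγ0 : 0 < ls.γ₁ := by linarith
  obtain ⟨h1, h2, h3, h4, h5⟩ := hb.spec S.smooth hγ S.mul_le
    (by rw [mul_div_cancel₀ _ hγ0.ne']; exact hLΛ)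
  obtain ⟨s, rfl⟩ := Nat.exists_eq_add_of_le h2
  have e : L' = ls.γ₁ ^ s * L := by
    rw [h1, pow_add, pow_one]; field_simp
  refine ⟨?_, h3, ?_, h4, h5⟩
  · rw [e]
    exact le_mul_of_one_le_left hL.le (one_le_pow₀ hγ.le)
  · rw [e, Real.log_mul (by positivity) hL.ne', Real.log_pow]
    have := S.log_pos
    push_cast
    field_simp
    ring

/-- A proximal gradient step from a point with small optimality gap is nearly stationary. -/
theorem nearStationary (S : APGSetup ψ h μ Lψ Λ ls xo) {L τ thr : ℝ} {y x : E}
    (hx : IsProxGradStep ψ h L y x) (hd : SufficientDecrease ψ L y x) (hy : y ∈ effDom h)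
    (hL : ls.Lmin ≤ L) (hLΛ : L ≤ Λ) (hτ : 0 ≤ τ) (hthr : 8 * Λ ^ 2 * thr ≤ τ ^ 2 * ls.Lmin)
    (hgap : objVal ψ h y - objVal ψ h xo ≤ thr) : NearStationary (addExt ψ h) τ x := by
  have hm := hx.mem_effDom S.proper
  have hL0 : 0 < L := S.Lmin_pos.trans_le hL
  refine nearStationary_of_mem (v := gradient ψ x - gradient ψ y - L • (x - y)) ?_ ?_
  · rw [S.smooth.mem_subdiff_iff S.mu_pos.le S.proper hm]
    have := hx.isSubgradAt S.proper
    convert this using 1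
    abel
  · have h1 : ‖gradient ψ x - gradient ψ y - L • (x - y)‖ ≤ 2 * Λ * ‖x - y‖ := by
      have a := norm_sub_le (gradient ψ x - gradient ψ y) (L • (x - y))
      have b := S.smooth.lip x y
      rw [norm_smul, Real.norm_eq_abs, abs_of_pos hL0] at a
      nlinarith [norm_nonneg (x - y), S.Lψ_le]
    have h2 := hx.objVal_le S.smooth S.proper hd hy
    have h3 := S.opt x hm
    rw [sub_self, norm_zero, norm_sub_rev y x] at h2
    have h4 : L * ‖x - y‖ ^ 2 ≤ 2 * thr := by linarith
    have h5 : ls.Lmin * ‖x - y‖ ^ 2 ≤ 2 * thr :=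
      (mul_le_mul_of_nonneg_right hL (sq_nonneg _)).trans h4
    have h6 : ls.Lmin * (2 * Λ * ‖x - y‖) ^ 2 ≤ ls.Lmin * τ ^ 2 := by
      have := mul_le_mul_of_nonneg_left h5 (by positivity : 0 ≤ 4 * Λ ^ 2)
      nlinarith
    exact h1.trans (abs_le_of_sq_le_sq' (le_of_mul_le_mul_left h6 S.Lmin_pos) hτ).2

end APGSetup

/-- The auxiliary point `x^{k-1} + (x^k - x^{k-1}) / α_{k-1}` of the estimate sequence. -/
noncomputable def APGState.aux (s : APGState E) : E := s.xPrev + (1 / s.αPrev) • (s.x - s.xPrev)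

/-- The Lyapunov function of the accelerated method. -/
noncomputable def APGState.lyap (s : APGState E) (ψ : E → ℝ) (h : E → EReal) (μ : ℝ) (xo : E) : ℝ :=
  objVal ψ h s.x - objVal ψ h xo + μ / 2 * ‖s.aux - xo‖ ^ 2

/-- The states that the method can reach. -/
structure APGState.Reachable (s : APGState E) (h : E → EReal) (ls : LineSearch) (Λ : ℝ) : Prop where
  mem : s.x ∈ effDom h
  α_pos : 0 < s.αPrev
  Lmin_le : ls.Lmin ≤ s.L
  L_le : s.L ≤ Λ

/-- The identity behind the Lyapunov estimate, with the minimizer as origin, `Y` the extrapolated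
point, `V` the auxiliary point, `Z` the new iterate, and `(1 + α) Y - α V` the current iterate. -/
theorem norm_sq_accel {F : Type*} [NormedAddCommGroup F] [InnerProductSpace ℝ F] {α μ L : ℝ}
    (hL : L * α ^ 2 = μ) (Y V Z : F) :
    (1 - α) * (L / 2 * (‖((1 + α) • Y - α • V) - Y‖ ^ 2 - ‖((1 + α) • Y - α • V) - Z‖ ^ 2)
        - μ / 2 * ‖((1 + α) • Y - α • V) - Y‖ ^ 2)
      + α * (L / 2 * (‖Y‖ ^ 2 - ‖Z‖ ^ 2) - μ / 2 * ‖Y‖ ^ 2)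
      + L / 2 * ‖Z - (1 - α) • ((1 + α) • Y - α • V)‖ ^ 2
      + μ / 2 * (α * (1 - α) * ‖V - Y‖ ^ 2 + (1 - α) * ‖((1 + α) • Y - α • V) - Y‖ ^ 2)
      = (1 - α) * (μ / 2 * ‖V‖ ^ 2) := by
  have e1 : ((1 + α) • Y - α • V) - Y = α • (Y - V) := by module
  rw [e1, ← hL]
  simp only [norm_smul, mul_pow, Real.norm_eq_abs, sq_abs, norm_sub_sq_real, inner_sub_left,
    inner_sub_right, inner_smul_left, inner_smul_right, RCLike.conj_to_real]
  rw [real_inner_comm Y V, real_inner_comm Y Z, real_inner_comm V Z]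
  ring

/-- One accepted extrapolated step contracts the Lyapunov function by the factor `1 - √(μ/L)`. -/
theorem APGSetup.lyap_le {ψ : E → ℝ} {h : E → EReal} {μ Lψ Λ : ℝ} {ls : LineSearch} {xo : E}
    (S : APGSetup ψ h μ Lψ Λ ls xo) {s : APGState E} (hs : s.Reachable h ls Λ) {L L₁ : ℝ} {x : E}
    (hx : IsProxGradStep ψ h L (s.extrapolate μ L) x)
    (hd : SufficientDecrease ψ L (s.extrapolate μ L) x) (hL : μ ≤ L) :
    (APGState.mk x s.x L₁ (Real.sqrt (μ / L))).lyap ψ h μ xo ≤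
      (1 - Real.sqrt (μ / L)) * s.lyap ψ h μ xo := by
  have hL0 : 0 < L := S.mu_pos.trans_le hL
  have hμ := S.mu_pos
  set α := Real.sqrt (μ / L) with hα
  have hα0 : 0 < α := Real.sqrt_pos.2 (by positivity)
  have hα1 : α ≤ 1 := Real.sqrt_le_one.2 ((div_le_one hL0).2 hL)
  have hLα : L * α ^ 2 = μ := by
    rw [hα, Real.sq_sqrt (by positivity)]; field_simp
  set y := s.extrapolate μ L with hy
  have h1 := hx.objVal_le S.smooth S.proper hd hs.mem
  have h2 := hx.objVal_le S.smooth S.proper hd S.mem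
  have hxe : s.x - xo = (1 + α) • (y - xo) - α • (s.aux - xo) := by
    have hp := hs.α_pos
    have e : (1 + α) • (y - s.x) = α • (s.aux - s.x) := by
      rw [hy, APGState.extrapolate, APGState.aux, add_sub_cancel_left, smul_smul, ← hα,
        show s.xPrev + (1 / s.αPrev) • (s.x - s.xPrev) - s.x
          = (1 / s.αPrev - 1) • (s.x - s.xPrev) by module, smul_smul]
      congr 1
      field_simp
    have : (1 + α) • (y - xo) - α • (s.aux - xo) - (s.x - xo) =
      (1 + α) • (y - s.x) - α • (s.aux - s.x) := by module
    rw [e, sub_self] at this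
    exact (sub_eq_zero.1 this).symm
  have key := norm_sq_accel hLα (y - xo) (s.aux - xo) (x - xo)
  rw [← hxe] at key
  have e3 : L * ‖(x - xo) - (1 - α) • (s.x - xo)‖ ^ 2 =
      μ * ‖(APGState.mk x s.x L₁ α).aux - xo‖ ^ 2 := by
    have : (x - xo) - (1 - α) • (s.x - xo) = α • ((APGState.mk x s.x L₁ α).aux - xo) := by
      rw [APGState.aux]
      simp only
      rw [smul_sub α, smul_add α, smul_smul α, mul_one_div_cancel hα0.ne']
      module
    rw [this, norm_smul, mul_pow, Real.norm_eq_abs, sq_abs, ← mul_assoc, hLα]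
  have e4 : s.x - xo - (y - xo) = s.x - y := by abel
  have e5 : s.x - xo - (x - xo) = s.x - x := by abel
  rw [e4, e5, norm_sub_rev y xo, norm_sub_rev x xo] at key
  have h3 := mul_le_mul_of_nonneg_left h1 (sub_nonneg.2 hα1)
  have h4 := mul_le_mul_of_nonneg_left h2 hα0.le
  have h5 : 0 ≤ μ / 2 * (α * (1 - α) * ‖s.aux - xo - (y - xo)‖ ^ 2 + (1 - α) * ‖s.x - y‖ ^ 2) := by
    have := sub_nonneg.2 hα1
    positivity
  unfold APGState.lyap
  simp only
  linear_combination h3 + h4 + h5 + key - e3 / 2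

end Accelerated

/-! ### Termination and cost of the accelerated method -/

section APGRuns

variable {E : Type*} [NormedAddCommGroup E] [InnerProductSpace ℝ E] [CompleteSpace E]

namespace APGSetup

variable {ψ : E → ℝ} {h : E → EReal} {μ Lψ Λ : ℝ} {ls : LineSearch} {xo : E}

theorem initial_le (S : APGSetup ψ h μ Lψ Λ ls xo) {Lt : ℝ} (h0 : 0 ≤ Lt) (hL : Lt ≤ Λ) :
    max ls.Lmin (Lt / ls.γ₂) ≤ Λ :=
  max_le S.Lmin_le ((div_le_self h0 S.one_le).trans hL)

theorem sqrt_div_le_one (S : APGSetup ψ h μ Lψ Λ ls xo) : Real.sqrt (μ / Λ) ≤ 1 :=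
  Real.sqrt_le_one.2 ((div_le_one S.Λ_pos).2 S.mu_le_Λ)

/-- The outcome of one pass of the main loop: either the Lyapunov function contracts or a minimizer
has been found; the candidate is nearly stationary when the gap is small; and the cost depends only
on the initial trial value, because the trials of the second line search continue the first. -/
theorem iteration (S : APGSetup ψ h μ Lψ Λ ls xo) {s s' : APGState E} {xhat : E} {N : ℕ}
    (hs : s.Reachable h ls Λ) (hi : APGIteration ψ h μ ls s s' xhat N) :
    ∃ Lt, 0 < Lt ∧ Lt ≤ Λ ∧ s'.L = max ls.Lmin (Lt / ls.γ₂) ∧ s'.αPrev = Real.sqrt (μ / Lt) ∧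
      s'.Reachable h ls Λ ∧ xhat ∈ effDom h ∧
      (N : ℝ) ≤ 7 + 3 * (Real.log Λ - Real.log s.L) / Real.log ls.γ₁ ∧
      (∀ τ thr, 0 ≤ τ → 8 * Λ ^ 2 * thr ≤ τ ^ 2 * ls.Lmin →
        objVal ψ h s'.x - objVal ψ h xo ≤ thr → NearStationary (addExt ψ h) τ xhat) ∧
      ((μ ≤ Lt ∧ s'.lyap ψ h μ xo ≤ (1 - Real.sqrt (μ / Lt)) * s.lyap ψ h μ xo) ∨
        objVal ψ h s'.x ≤ objVal ψ h xo) := by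
  obtain ⟨Lt, xt, t₁, Lh, t₂, hb₁, hb₂, rfl, rfl⟩ := hi
  have hsL : 0 < s.L := S.Lmin_pos.trans_le hs.Lmin_le
  obtain ⟨a1, a2, a3, a4, a5⟩ := S.backtrack hsL hs.L_le hb₁
  have hLt : 0 < Lt := hsL.trans_le a1
  obtain ⟨b1, b2, b3, b4, b5⟩ := S.backtrack hLt a2 hb₂
  have hm := a4.mem_effDom S.proper
  refine ⟨Lt, hLt, a2, rfl, rfl, ⟨hm, Real.sqrt_pos.2 (div_pos S.mu_pos hLt), le_max_left _ _,
    S.initial_le hLt.le a2⟩, b4.mem_effDom S.proper, ?_, ?_, ?_⟩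
  · push_cast
    rw [a3, b3]
    have : Real.log Lh ≤ Real.log Λ := Real.log_le_log (hLt.trans_le b1) b2
    have hG := S.log_pos
    have e : 3 * (1 + (Real.log Lt - Real.log s.L) / Real.log ls.γ₁) +
        3 * (1 + (Real.log Lh - Real.log Lt) / Real.log ls.γ₁) + 1 =
        7 + 3 * (Real.log Lh - Real.log s.L) / Real.log ls.γ₁ := by ring
    rw [e]
    gcongr
  · intro τ thr hτ hthr hgap
    exact S.nearStationary b4 b5 hm (hs.Lmin_le.trans (a1.trans b1)) b2 hτ hthr hgap
  · rcases le_or_gt μ Lt with hμ | hμ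
    · exact Or.inl ⟨hμ, S.lyap_le hs a4 a5 hμ⟩
    · exact Or.inr (a4.objVal_le_of_lt S.smooth S.proper a5 S.mu_pos.le hμ S.mem)

theorem gap_le_lyap (S : APGSetup ψ h μ Lψ Λ ls xo) (s : APGState E) :
    objVal ψ h s.x - objVal ψ h xo ≤ s.lyap ψ h μ xo := by
  have := S.mu_pos
  unfold APGState.lyap
  nlinarith [mul_nonneg this.le (sq_nonneg ‖s.aux - xo‖)]

/-- A pass of the main loop that does not reach the tolerance contracts the Lyapunov function, which
still exceeds the stationarity threshold afterwards. -/
theorem iteration_next (S : APGSetup ψ h μ Lψ Λ ls xo) {s s' : APGState E} {xhat : E} {N : ℕ}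
    {τ thr : ℝ} (hs : s.Reachable h ls Λ) (hi : APGIteration ψ h μ ls s s' xhat N) (hτ : 0 ≤ τ)
    (hthr0 : 0 < thr) (hthr : 8 * Λ ^ 2 * thr ≤ τ ^ 2 * ls.Lmin)
    (hn : ¬ NearStationary (addExt ψ h) τ xhat) :
    s'.Reachable h ls Λ ∧ thr < s'.lyap ψ h μ xo ∧
      ∃ Lt, 0 < Lt ∧ s'.L = max ls.Lmin (Lt / ls.γ₂) ∧ Real.sqrt (μ / Λ) ≤ Real.sqrt (μ / Lt) ∧
        Real.sqrt (μ / Lt) ≤ 1 ∧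
        s'.lyap ψ h μ xo ≤ (1 - Real.sqrt (μ / Lt)) * s.lyap ψ h μ xo := by
  obtain ⟨Lt, hLt, h1, h2, h3, h4, h5, h6, h7, h8⟩ := S.iteration hs hi
  have hgap : thr < objVal ψ h s'.x - objVal ψ h xo := by
    by_contra hle
    exact hn (h7 τ thr hτ hthr (not_lt.1 hle))
  refine ⟨h4, hgap.trans_le (S.gap_le_lyap s'), Lt, hLt, h2, ?_, ?_⟩
  · exact Real.sqrt_le_sqrt (div_le_div_of_nonneg_left S.mu_pos.le hLt h1)
  · rcases h8 with ⟨h8, h9⟩ | h8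
    · exact ⟨Real.sqrt_le_one.2 ((div_le_one hLt).2 h8), h9⟩
    · linarith

/-- Whatever the main loop returns lies in the domain and has the required accuracy. -/
theorem loop_spec {s : APGState E} {x : E} {N : ℕ} {τ : ℝ} (S : APGSetup ψ h μ Lψ Λ ls xo)
    (hl : APGLoop ψ h μ ls τ s x N) (hs : s.Reachable h ls Λ) :
    x ∈ effDom h ∧ NearStationary (addExt ψ h) τ x := by
  induction hl with
  | finish hi hn =>
    obtain ⟨_, _, _, _, _, _, hm, _⟩ := S.iteration hs hi
    exact ⟨hm, hn⟩
  | next hi _ _ ih =>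
    obtain ⟨_, _, _, _, _, hs', _⟩ := S.iteration hs hi
    exact ih hs'

/-- The cost of the main loop. A pass costs `O(1 + log (Λ / L))` evaluations for an initial trial
value `L`, while the preceding pass has decreased the logarithm of the Lyapunov function by about
`√(μ / L)`; since `1 + log (Λ / L) = O(√(Λ / L))`, the total is `O(√(Λ / μ))` per unit of decrease. -/
theorem loop_cost {s : APGState E} {x : E} {N : ℕ} {τ thr : ℝ} (S : APGSetup ψ h μ Lψ Λ ls xo)
    (hl : APGLoop ψ h μ ls τ s x N) (hτ : 0 ≤ τ) (hthr0 : 0 < thr)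
    (hthr : 8 * Λ ^ 2 * thr ≤ τ ^ 2 * ls.Lmin) :
    ∀ W, s.Reachable h ls Λ → s.lyap ψ h μ xo ≤ W → thr ≤ W →
    (N : ℝ) ≤ 7 + 3 * (Real.log Λ - Real.log s.L) / Real.log ls.γ₁ +
      (7 + 3 * Real.log ls.γ₂ / Real.log ls.γ₁ + 6 / Real.log ls.γ₁) / Real.sqrt (μ / Λ) *
        (Real.log W - Real.log thr) := by
  have hG := S.log_pos
  have hΛ := S.Λ_pos
  have hμ := S.mu_pos
  have hq : 0 < Real.sqrt (μ / Λ) := Real.sqrt_pos.2 (by positivity)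
  have hγ₂ : 0 ≤ Real.log ls.γ₂ := Real.log_nonneg S.one_le
  set A := 7 + 3 * Real.log ls.γ₂ / Real.log ls.γ₁ + 6 / Real.log ls.γ₁ with hA
  have hA0 : 0 < A := by positivity
  induction hl with
  | finish hi hn =>
    intro W hs hW hthrW
    obtain ⟨_, _, _, _, _, _, _, hN, _⟩ := S.iteration hs hi
    have : 0 ≤ Real.log W - Real.log thr := sub_nonneg.2 (Real.log_le_log hthr0 hthrW)
    have : 0 ≤ A / Real.sqrt (μ / Λ) * (Real.log W - Real.log thr) := by positivity
    linarith
  | @next s s' xhat x N N' hi hn hl ih =>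
    intro W hs hW hthrW
    obtain ⟨_, _, _, _, _, _, _, hN, _⟩ := S.iteration hs hi
    obtain ⟨hs', hthr', Lt, hLt, hL', hqα, hα1, hlyap⟩ := S.iteration_next hs hi hτ hthr0 hthr hn
    set α := Real.sqrt (μ / Lt) with hα
    have hW' : s'.lyap ψ h μ xo ≤ (1 - α) * W :=
      hlyap.trans (mul_le_mul_of_nonneg_left hW (sub_nonneg.2 hα1))
    have hW0 : 0 < W := hthr0.trans_le hthrW
    have h1α : 0 < 1 - α := by
      by_contra hle
      have : (1 - α) * W ≤ 0 := mul_nonpos_of_nonpos_of_nonneg (not_lt.1 hle) hW0.le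
      linarith
    have hih := ih ((1 - α) * W) hs' hW' (hthr'.le.trans hW')
    have hlog : Real.log ((1 - α) * W) ≤ Real.log W - α := by
      rw [Real.log_mul h1α.ne' hW0.ne']
      have := Real.log_le_sub_one_of_pos h1α
      linarith
    have hα0 : 0 < α := hq.trans_le hqα
    -- The initial trial value of the next pass is at least `Lt / γ₂`.
    have hcost : 7 + 3 * (Real.log Λ - Real.log s'.L) / Real.log ls.γ₁ ≤
        A / Real.sqrt (μ / Λ) * α := by
      have hγ₂0 : 0 < ls.γ₂ := by linarith [S.one_le]
      have e1 : Real.log Lt - Real.log ls.γ₂ ≤ Real.log s'.L := by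
        rw [← Real.log_div hLt.ne' hγ₂0.ne', hL']
        exact Real.log_le_log (by positivity) (le_max_right _ _)
      have e2 : Real.log Λ - Real.log Lt = 2 * Real.log (α / Real.sqrt (μ / Λ)) := by
        rw [Real.log_div hα0.ne' hq.ne', hα, Real.log_sqrt (by positivity),
          Real.log_sqrt (by positivity), Real.log_div hμ.ne' hLt.ne', Real.log_div hμ.ne' hΛ.ne']
        ring
      have e3 : Real.log (α / Real.sqrt (μ / Λ)) ≤ α / Real.sqrt (μ / Λ) :=
        (Real.log_le_sub_one_of_pos (by positivity)).trans (by linarith)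
      have e4 : 1 ≤ α / Real.sqrt (μ / Λ) := (one_le_div hq).2 hqα
      have e5 : 3 * (Real.log Λ - Real.log s'.L) / Real.log ls.γ₁ ≤
          3 * (2 * (α / Real.sqrt (μ / Λ)) + Real.log ls.γ₂) / Real.log ls.γ₁ := by
        gcongr
        linarith
      have e6 : A / Real.sqrt (μ / Λ) * α =
          (7 + 3 * Real.log ls.γ₂ / Real.log ls.γ₁) * (α / Real.sqrt (μ / Λ)) +
          3 * (2 * (α / Real.sqrt (μ / Λ))) / Real.log ls.γ₁ := by
        rw [hA]; ring
      have e7 : 0 ≤ 7 + 3 * Real.log ls.γ₂ / Real.log ls.γ₁ := by positivity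
      have e8 : 3 * (2 * (α / Real.sqrt (μ / Λ)) + Real.log ls.γ₂) / Real.log ls.γ₁ =
          3 * (2 * (α / Real.sqrt (μ / Λ))) / Real.log ls.γ₁ +
            3 * Real.log ls.γ₂ / Real.log ls.γ₁ := by ring
      rw [e6]
      nlinarith
    have hfin : A / Real.sqrt (μ / Λ) * (Real.log ((1 - α) * W) - Real.log thr) ≤
        A / Real.sqrt (μ / Λ) * (Real.log W - Real.log thr) - A / Real.sqrt (μ / Λ) * α := by
      rw [← mul_sub]
      refine mul_le_mul_of_nonneg_left ?_ (by positivity)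
      linarith
    push_cast
    linarith

theorem exists_iteration [ProperSpace E] (S : APGSetup ψ h μ Lψ Λ ls xo)
    (hb : Bornology.IsBounded (effDom h)) {s : APGState E} (hs : s.Reachable h ls Λ) :
    ∃ s' xhat N, APGIteration ψ h μ ls s s' xhat N := by
  have hsL : 0 < s.L := S.Lmin_pos.trans_le hs.Lmin_le
  have hγ : 0 < ls.γ₁ := by linarith [S.one_lt]
  obtain ⟨Lt, xt, t₁, hb₁⟩ := exists_backtrack (fun L => s.extrapolate μ L) S.smooth S.proper hb
    S.one_lt (div_pos hsL hγ)
  have hLt := hsL.trans_le (S.backtrack hsL hs.L_le hb₁).1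
  obtain ⟨Lh, xh, t₂, hb₂⟩ := exists_backtrack (fun _ => xt) S.smooth S.proper hb
    S.one_lt (div_pos hLt hγ)
  exact ⟨_, _, _, Lt, xt, t₁, Lh, t₂, hb₁, hb₂, rfl, rfl⟩

/-- The main loop ends: the Lyapunov function decays at least geometrically with ratio
`1 - √(μ / Λ)`, and cannot stay above the stationarity threshold. -/
theorem exists_loop [ProperSpace E] (S : APGSetup ψ h μ Lψ Λ ls xo)
    (hb : Bornology.IsBounded (effDom h)) {τ : ℝ} (hτ : 0 < τ) {s : APGState E}
    (hs : s.Reachable h ls Λ) : ∃ x N, APGLoop ψ h μ ls τ s x N := by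
  have hΛ := S.Λ_pos
  have hμ := S.mu_pos
  have hm := S.Lmin_pos
  set thr := τ ^ 2 * ls.Lmin / (8 * Λ ^ 2) with hthr_def
  have hthr0 : 0 < thr := by positivity
  have hthr : 8 * Λ ^ 2 * thr ≤ τ ^ 2 * ls.Lmin := by
    rw [hthr_def, mul_div_cancel₀ _ (by positivity)]
  set q := Real.sqrt (μ / Λ) with hq_def
  have hq : 0 < q := Real.sqrt_pos.2 (by positivity)
  have hq1 : 0 ≤ 1 - q := sub_nonneg.2 S.sqrt_div_le_one
  have key : ∀ (n : ℕ) (s : APGState E), s.Reachable h ls Λ →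
      (1 - q) ^ n * s.lyap ψ h μ xo ≤ thr → ∃ x N, APGLoop ψ h μ ls τ s x N := by
    intro n
    induction n with
    | zero =>
      intro s hs hV
      obtain ⟨s', xhat, N, hi⟩ := S.exists_iteration hb hs
      by_cases hn : NearStationary (addExt ψ h) τ xhat
      · exact ⟨_, _, .finish hi hn⟩
      · obtain ⟨hs', hthr', Lt, hLt, hL', hqα, hα1, hlyap⟩ :=
          S.iteration_next hs hi hτ.le hthr0 hthr hn
        rw [pow_zero, one_mul] at hV
        have h1 := mul_le_mul_of_nonneg_left hV (sub_nonneg.2 hα1)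
        have h2 : 0 ≤ Real.sqrt (μ / Lt) * thr := by positivity
        nlinarith
    | succ n ih =>
      intro s hs hV
      obtain ⟨s', xhat, N, hi⟩ := S.exists_iteration hb hs
      by_cases hn : NearStationary (addExt ψ h) τ xhat
      · exact ⟨_, _, .finish hi hn⟩
      · obtain ⟨hs', hthr', Lt, hLt, hL', hqα, hα1, hlyap⟩ :=
          S.iteration_next hs hi hτ.le hthr0 hthr hn
        have hV0 : 0 ≤ s.lyap ψ h μ xo := by
          by_contra hneg
          have := mul_nonpos_of_nonneg_of_nonpos (sub_nonneg.2 hα1) (not_le.1 hneg).le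
          linarith
        have h1 : s'.lyap ψ h μ xo ≤ (1 - q) * s.lyap ψ h μ xo :=
          hlyap.trans (mul_le_mul_of_nonneg_right (by linarith) hV0)
        obtain ⟨x, N', hl⟩ := ih s' hs' (by
          refine le_trans (mul_le_mul_of_nonneg_left h1 (pow_nonneg hq1 n)) ?_
          rwa [← mul_assoc, ← pow_succ])
        exact ⟨_, _, .next hi hn hl⟩
  obtain ⟨n, hn⟩ := exists_pow_lt_of_lt_one
    (show 0 < thr / (|s.lyap ψ h μ xo| + 1) by positivity) (show 1 - q < 1 by linarith)
  refine key n s hs ?_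
  rw [lt_div_iff₀ (by positivity)] at hn
  have := le_abs_self (s.lyap ψ h μ xo)
  have hp := pow_nonneg hq1 n
  nlinarith

theorem reachable_initial (S : APGSetup ψ h μ Lψ Λ ls xo) {y₀ xt : E} {Lt : ℝ} {t : ℕ}
    (hb : Backtrack ψ h ls.γ₁ (fun _ => y₀) (ls.Lmin / ls.γ₁) Lt xt t) :
    (APGState.mk xt xt (max ls.Lmin (Lt / ls.γ₂)) 1).Reachable h ls Λ := by
  obtain ⟨a1, a2, a3, a4, a5⟩ := S.backtrack S.Lmin_pos S.Lmin_le hb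
  exact ⟨a4.mem_effDom S.proper, one_pos, le_max_left _ _,
    S.initial_le (S.Lmin_pos.le.trans a1) a2⟩

theorem exists_apg [ProperSpace E] (S : APGSetup ψ h μ Lψ Λ ls xo)
    (hb : Bornology.IsBounded (effDom h)) {τ : ℝ} (hτ : 0 < τ) (y₀ : E) :
    ∃ x N, APG ψ h μ ls τ y₀ x N := by
  have hγ : 0 < ls.γ₁ := by linarith [S.one_lt]
  obtain ⟨Lt, xt, t, hbt⟩ := exists_backtrack (fun _ => y₀) S.smooth S.proper hb
    S.one_lt (div_pos S.Lmin_pos hγ)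
  obtain ⟨x, N, hl⟩ := S.exists_loop hb hτ (S.reachable_initial hbt)
  exact ⟨x, _, Lt, xt, t, N, hbt, hl, rfl⟩

theorem apg_spec (S : APGSetup ψ h μ Lψ Λ ls xo) {τ : ℝ} {y₀ x : E} {N : ℕ}
    (hr : APG ψ h μ ls τ y₀ x N) : x ∈ effDom h ∧ NearStationary (addExt ψ h) τ x := by
  obtain ⟨Lt, xt, t, N', hb, hl, rfl⟩ := hr
  exact S.loop_spec hl (S.reachable_initial hb)

/-- The cost of a call: the first proximal gradient step brings the Lyapunov function below `Λ R²`,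
and `thr` is the gap below which a step is nearly stationary. -/
theorem apg_cost (S : APGSetup ψ h μ Lψ Λ ls xo) {τ thr R : ℝ} {y₀ x : E} {N : ℕ}
    (hr : APG ψ h μ ls τ y₀ x N) (hτ : 0 ≤ τ) (hthr0 : 0 < thr)
    (hthr : 8 * Λ ^ 2 * thr ≤ τ ^ 2 * ls.Lmin) (hR : ‖xo - y₀‖ ≤ R) :
    (N : ℝ) ≤ 10 + 6 * (Real.log Λ - Real.log ls.Lmin) / Real.log ls.γ₁ +
      (7 + 3 * Real.log ls.γ₂ / Real.log ls.γ₁ + 6 / Real.log ls.γ₁) / Real.sqrt (μ / Λ) *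
        (Real.log (Λ * R ^ 2 + thr) - Real.log thr) := by
  obtain ⟨Lt, xt, t, N', hb, hl, rfl⟩ := hr
  have hs := S.reachable_initial hb
  obtain ⟨a1, a2, a3, a4, a5⟩ := S.backtrack S.Lmin_pos S.Lmin_le hb
  have hLt : 0 < Lt := S.Lmin_pos.trans_le a1
  have hG := S.log_pos
  have hΛ := S.Λ_pos
  have hμ := S.mu_pos
  have hR0 : ‖xo - y₀‖ ^ 2 ≤ R ^ 2 := pow_le_pow_left₀ (norm_nonneg _) hR 2
  have hV : (APGState.mk xt xt (max ls.Lmin (Lt / ls.γ₂)) 1).lyap ψ h μ xo ≤ Λ * R ^ 2 + thr := by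
    have h1 := a4.objVal_le S.smooth S.proper a5 S.mem
    have h2 := S.opt xt (a4.mem_effDom S.proper)
    have h3 : Lt * ‖xo - xt‖ ^ 2 ≤ Lt * ‖xo - y₀‖ ^ 2 := by
      nlinarith [mul_nonneg hμ.le (sq_nonneg ‖xo - y₀‖)]
    have h4 : ‖xo - xt‖ ^ 2 ≤ R ^ 2 := (le_of_mul_le_mul_left h3 hLt).trans hR0
    have h5 : Lt * ‖xo - y₀‖ ^ 2 ≤ Λ * R ^ 2 := by gcongr
    have h6 : μ * ‖xo - xt‖ ^ 2 ≤ Λ * R ^ 2 := mul_le_mul S.mu_le_Λ h4 (sq_nonneg _) hΛ.le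
    unfold APGState.lyap APGState.aux
    simp only [sub_self, smul_zero, add_zero]
    rw [norm_sub_rev xt xo]
    nlinarith [mul_nonneg hμ.le (sq_nonneg ‖xo - y₀‖), mul_nonneg hLt.le (sq_nonneg ‖xo - xt‖)]
  have hc := S.loop_cost hl hτ hthr0 hthr _ hs hV (by nlinarith [sq_nonneg R])
  have h1 : 3 * (Real.log Λ - Real.log (max ls.Lmin (Lt / ls.γ₂))) / Real.log ls.γ₁ ≤
      3 * (Real.log Λ - Real.log ls.Lmin) / Real.log ls.γ₁ := by
    have := Real.log_le_log S.Lmin_pos (le_max_left ls.Lmin (Lt / ls.γ₂))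
    gcongr
  have h2 : (Real.log Lt - Real.log ls.Lmin) / Real.log ls.γ₁ ≤
      (Real.log Λ - Real.log ls.Lmin) / Real.log ls.γ₁ := by
    have := Real.log_le_log hLt a2
    gcongr
  have e : 6 * (Real.log Λ - Real.log ls.Lmin) / Real.log ls.γ₁ =
      3 * ((Real.log Λ - Real.log ls.Lmin) / Real.log ls.γ₁) +
      3 * (Real.log Λ - Real.log ls.Lmin) / Real.log ls.γ₁ := by ring
  push_cast
  rw [a3, e]
  simp only at hc
  linarith

end APGSetup

end APGRuns

/-! ### The Lagrangian subproblems -/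

/-- The restrictions on the line-search parameters. -/
structure LineSearch.Valid (ls : LineSearch) : Prop where
  Lmin_pos : 0 < ls.Lmin
  one_lt : 1 < ls.γ₁
  one_le : 1 ≤ ls.γ₂

namespace Problem

/-- The smooth part of a Lagrangian, up to the constant `d`. -/
def smoothPart {E : Type*} (p : Problem E) (c d : ℝ) : E → ℝ := fun x => p.f x + c * p.g x + d

theorem lagrangian_eq {E : Type*} (p : Problem E) (c : ℝ) :
    p.lagrangian c = addExt (p.smoothPart c 0) p.h := by
  unfold lagrangian smoothPart
  simp

theorem Φsmooth_eq {E : Type*} (p : Problem E) (β z y : ℝ) :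
    p.Φsmooth β z y = p.smoothPart (β * y) (β * (y * (z / β) - y ^ 2 / 2)) := by
  funext x
  unfold Φsmooth smoothPart θ
  ring

section Lagrangian

variable {E : Type*} [NormedAddCommGroup E] [InnerProductSpace ℝ E] [CompleteSpace E]

/-- `x` minimizes the Lagrangian `f + c g + h`, as a first-order condition. -/
def IsLagMin (p : Problem E) (c : ℝ) (x : E) : Prop :=
  x ∈ effDom p.h ∧ IsSubgradAt p.h x (-(gradient p.f x + c • gradient p.g x))

namespace Assumptions

variable {p : Problem E} {μ Lf Lg : ℝ} {xs : E} {zs : ℝ}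

theorem hasGradientAt_smoothPart (hA : p.Assumptions μ Lf Lg xs zs) (c d : ℝ) (x : E) :
    HasGradientAt (p.smoothPart c d) (gradient p.f x + c • gradient p.g x) x := by
  have h1 := (hA.f_diff x).hasGradientAt.hasFDerivAt
  have h2 := (hA.g_diff x).hasGradientAt.hasFDerivAt
  have h3 := (h1.add (h2.const_mul c)).add_const d
  rw [hasGradientAt_iff_hasFDerivAt]
  rw [map_add, map_smul]
  exact h3

theorem gradient_smoothPart (hA : p.Assumptions μ Lf Lg xs zs) (c d : ℝ) (x : E) :
    gradient (p.smoothPart c d) x = gradient p.f x + c • gradient p.g x :=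
  (hA.hasGradientAt_smoothPart c d x).gradient

theorem smoothStrong_f (hA : p.Assumptions μ Lf Lg xs zs) : SmoothStrong p.f μ Lf :=
  smoothStrong_of_strongConvexOn hA.f_diff hA.f_smooth hA.f_strong

theorem smoothStrong_g (hA : p.Assumptions μ Lf Lg xs zs) : SmoothStrong p.g 0 Lg :=
  smoothStrong_of_strongConvexOn hA.g_diff hA.g_smooth (strongConvexOn_zero.2 hA.g_convex)

theorem smoothStrong_smoothPart (hA : p.Assumptions μ Lf Lg xs zs) {c : ℝ} (hc : 0 ≤ c) (d : ℝ) :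
    SmoothStrong (p.smoothPart c d) μ (Lf + c * Lg) where
  cont := continuous_iff_continuousAt.2 fun x => (hA.hasGradientAt_smoothPart c d x).continuousAt
  lip x y := by
    rw [hA.gradient_smoothPart, hA.gradient_smoothPart]
    have e : gradient p.f x + c • gradient p.g x - (gradient p.f y + c • gradient p.g y) =
        (gradient p.f x - gradient p.f y) + c • (gradient p.g x - gradient p.g y) := by module
    rw [e]
    refine (norm_add_le _ _).trans ?_
    rw [norm_smul, Real.norm_eq_abs, abs_of_nonneg hc]
    have h1 := hA.f_smooth x y
    have h2 := mul_le_mul_of_nonneg_left (hA.g_smooth x y) hc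
    linarith
  lower x u := by
    rw [hA.gradient_smoothPart, inner_add_left, inner_smul_left, RCLike.conj_to_real]
    have h1 := hA.smoothStrong_f.lower x u
    have h2 := mul_le_mul_of_nonneg_left (hA.smoothStrong_g.lower x u) hc
    unfold smoothPart
    linarith
  upper x u := by
    rw [hA.gradient_smoothPart, inner_add_left, inner_smul_left, RCLike.conj_to_real]
    have h1 := hA.smoothStrong_f.upper x u
    have h2 := mul_le_mul_of_nonneg_left (hA.smoothStrong_g.upper x u) hc
    unfold smoothPart
    linarith

theorem mu_le [Nontrivial E] (hA : p.Assumptions μ Lf Lg xs zs) : μ ≤ Lf := by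
  obtain ⟨v, hv⟩ := exists_ne (0 : E)
  have h1 := hA.smoothStrong_f.lower 0 v
  have h2 := hA.smoothStrong_f.upper 0 v
  rw [sub_zero] at h1 h2
  have : 0 < ‖v‖ ^ 2 := by positivity
  have h3 : μ * ‖v‖ ^ 2 ≤ Lf * ‖v‖ ^ 2 := by linarith
  exact le_of_mul_le_mul_right h3 this

theorem Lg_nonneg [Nontrivial E] (hA : p.Assumptions μ Lf Lg xs zs) : 0 ≤ Lg := by
  obtain ⟨v, hv⟩ := exists_ne (0 : E)
  have h1 := (norm_nonneg _).trans (hA.g_smooth v 0)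
  rw [sub_zero] at h1
  exact nonneg_of_mul_nonneg_left h1 (norm_pos_iff.2 hv)

theorem norm_gradient_le (hA : p.Assumptions μ Lf Lg xs zs) {x : E} (hx : x ∈ effDom p.h) :
    ‖gradient p.g x‖ ≤ p.Bg := by
  refine le_csSup ?_ (Set.mem_image_of_mem _ hx)
  have hc : ∀ u ∈ effDom p.h, ‖gradient p.g u‖ ≤ ‖gradient p.g x‖ +
      |Lg| * Metric.diam (effDom p.h) := by
    intro u hu
    have h1 := hA.g_smooth u x
    have h2 : ‖u - x‖ ≤ Metric.diam (effDom p.h) := by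
      rw [← dist_eq_norm]; exact Metric.dist_le_diam_of_mem hA.dom_bounded hu hx
    have h3 := norm_sub_norm_le (gradient p.g u) (gradient p.g x)
    have h4 : Lg * ‖u - x‖ ≤ |Lg| * Metric.diam (effDom p.h) :=
      mul_le_mul (le_abs_self _) h2 (norm_nonneg _) (abs_nonneg _)
    linarith
  refine ⟨‖gradient p.g x‖ + |Lg| * Metric.diam (effDom p.h), ?_⟩
  rintro _ ⟨u, hu, rfl⟩
  exact hc u hu

theorem g_sub_le (hA : p.Assumptions μ Lf Lg xs zs) {x u : E} (hx : x ∈ effDom p.h) :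
    p.g x - p.g u ≤ p.Bg * ‖x - u‖ := by
  have h1 := hA.smoothStrong_g.lower x u
  have h2 := abs_real_inner_le_norm (gradient p.g x) (u - x)
  have h3 := neg_abs_le (inner ℝ (gradient p.g x) (u - x))
  have h4 := mul_le_mul_of_nonneg_right (hA.norm_gradient_le hx) (norm_nonneg (u - x))
  rw [norm_sub_rev x u]
  linarith

theorem abs_g_sub_le (hA : p.Assumptions μ Lf Lg xs zs) {x u : E} (hx : x ∈ effDom p.h)
    (hu : u ∈ effDom p.h) : |p.g x - p.g u| ≤ p.Bg * ‖x - u‖ := by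
  rw [abs_le]
  have h1 := hA.g_sub_le (u := u) hx
  have h2 := hA.g_sub_le (u := x) hu
  rw [norm_sub_rev] at h2
  constructor <;> linarith

theorem exists_isLagMin [ProperSpace E] (hA : p.Assumptions μ Lf Lg xs zs) {c : ℝ} (hc : 0 ≤ c) :
    ∃ x, p.IsLagMin c x := by
  have hψ := hA.smoothStrong_smoothPart hc 0
  obtain ⟨x, hx, hmin⟩ := hA.h_closed_convex.exists_isMin hA.dom_bounded hψ.cont
  refine ⟨x, hx, ?_⟩
  have := (hψ.mem_subdiff_iff hA.mu_pos.le hA.h_closed_convex (v := 0) hx).1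
    (by intro u; simpa using hmin u)
  rwa [hA.gradient_smoothPart, zero_sub] at this

theorem isLagMin_kkt (hA : p.Assumptions μ Lf Lg xs zs) : p.IsLagMin zs xs := by
  obtain ⟨v, hv, h0⟩ := hA.kkt_stationary
  have hm := hA.h_closed_convex.mem_effDom_of_subdiff _ hv
  refine ⟨hm, ?_⟩
  have := (hA.smoothStrong_f.mem_subdiff_iff hA.mu_pos.le hA.h_closed_convex hm).1 hv
  rwa [eq_neg_of_add_eq_zero_left h0, ← neg_add', add_comm] at this

theorem mem_subdiff_smoothPart (hA : p.Assumptions μ Lf Lg xs zs) {c : ℝ} (hc : 0 ≤ c) (d : ℝ)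
    {x v : E} (hx : x ∈ effDom p.h) : v ∈ subdiff (addExt (p.smoothPart c d) p.h) x ↔
      IsSubgradAt p.h x (v - (gradient p.f x + c • gradient p.g x)) := by
  rw [(hA.smoothStrong_smoothPart hc d).mem_subdiff_iff hA.mu_pos.le hA.h_closed_convex hx,
    hA.gradient_smoothPart]

/-- Strong monotonicity of the Lagrangian saddle operator, between a nearly stationary point and a
minimizer. It yields the stability of subproblem solutions, the continuity of exact solutions in the
multiplier, and, at a KKT point, the sign information that drives the outer method. -/
theorem norm_sq_le_of_nearStationary (hA : p.Assumptions μ Lf Lg xs zs) {c c' τ : ℝ} (hc : 0 ≤ c)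
    (hc' : 0 ≤ c') (hτ : 0 ≤ τ) {x x' : E} (hx : x ∈ effDom p.h)
    (hn : NearStationary (p.lagrangian c) τ x) (hx' : p.IsLagMin c' x') :
    μ * ‖x - x'‖ ^ 2 ≤ (c - c') * (p.g x' - p.g x) + τ * ‖x - x'‖ := by
  suffices H : ∀ η : ℝ, 0 < η →
      μ * ‖x - x'‖ ^ 2 ≤ (c - c') * (p.g x' - p.g x) + τ * ‖x - x'‖ + η by
    exact le_of_forall_pos_le_add H
  intro η hη
  obtain ⟨v, hv, hvτ⟩ := hn.exists_mem hτ (show 0 < η / (‖x - x'‖ + 1) by positivity)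
  rw [lagrangian_eq, hA.mem_subdiff_smoothPart hc 0 hx] at hv
  rw [← hA.gradient_smoothPart c 0] at hv
  have h1 := (hA.smoothStrong_smoothPart hc 0).growth hv hx'.1
  have h2 := (hA.smoothStrong_smoothPart hc' 0).growth (v := 0) (x := x')
    (by rw [hA.gradient_smoothPart, zero_sub]; exact hx'.2) hx
  rw [inner_zero_left] at h2
  have h3 := neg_abs_le (inner ℝ v (x' - x))
  have h4 := abs_real_inner_le_norm v (x' - x)
  rw [norm_sub_rev x' x] at h1 h4
  have h5 : ‖v‖ * ‖x - x'‖ ≤ τ * ‖x - x'‖ + η := by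
    refine (mul_le_mul_of_nonneg_right hvτ.le (norm_nonneg _)).trans ?_
    have : η / (‖x - x'‖ + 1) * ‖x - x'‖ ≤ η := by
      rw [div_mul_eq_mul_div, div_le_iff₀ (by positivity)]
      nlinarith [norm_nonneg (x - x')]
    linarith
  simp only [smoothPart] at h1 h2
  nlinarith

theorem nearStationary_of_isLagMin (hA : p.Assumptions μ Lf Lg xs zs) {c : ℝ} (hc : 0 ≤ c) {x : E}
    (hx : p.IsLagMin c x) : NearStationary (p.lagrangian c) 0 x := by
  refine nearStationary_of_mem (v := 0) ?_ (by simp)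
  rw [lagrangian_eq, hA.mem_subdiff_smoothPart hc 0 hx.1, zero_sub]
  exact hx.2

theorem norm_sub_le_of_nearStationary (hA : p.Assumptions μ Lf Lg xs zs) {c τ : ℝ} (hc : 0 ≤ c)
    (hτ : 0 ≤ τ) {x x' : E} (hx : x ∈ effDom p.h)
    (hn : NearStationary (p.lagrangian c) τ x) (hx' : p.IsLagMin c x') : ‖x - x'‖ ≤ τ / μ := by
  have h := hA.norm_sq_le_of_nearStationary hc hc hτ hx hn hx'
  rw [sub_self, zero_mul, zero_add] at h
  rw [le_div_iff₀ hA.mu_pos]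
  rcases (norm_nonneg (x - x')).eq_or_lt with h0 | h0
  · rw [← h0, zero_mul]; exact hτ
  · exact le_of_mul_le_mul_right (by nlinarith) h0

/-- The constraint value at minimizers of the Lagrangian is Lipschitz in the multiplier. -/
theorem abs_g_isLagMin_sub_le (hA : p.Assumptions μ Lf Lg xs zs) {c c' : ℝ} (hc : 0 ≤ c)
    (hc' : 0 ≤ c') {x x' : E} (hx : p.IsLagMin c x) (hx' : p.IsLagMin c' x') :
    |p.g x - p.g x'| ≤ p.Bg ^ 2 / μ * |c - c'| := by
  have hμ := hA.mu_pos
  have h := hA.norm_sq_le_of_nearStationary hc hc' le_rfl hx.1 (hA.nearStationary_of_isLagMin hc hx) hx'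
  rw [zero_mul, add_zero] at h
  have h1 := hA.abs_g_sub_le hx.1 hx'.1
  have hB : 0 ≤ p.Bg := (norm_nonneg _).trans (hA.norm_gradient_le hx.1)
  have h2 : (c - c') * (p.g x' - p.g x) ≤ |c - c'| * (p.Bg * ‖x - x'‖) := by
    refine (le_abs_self _).trans ?_
    rw [abs_mul, abs_sub_comm (p.g x')]
    exact mul_le_mul_of_nonneg_left h1 (abs_nonneg _)
  have h3 : ‖x - x'‖ ≤ p.Bg * |c - c'| / μ := by
    rw [le_div_iff₀ hμ]
    rcases (norm_nonneg (x - x')).eq_or_lt with h0 | h0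
    · rw [← h0, zero_mul]; positivity
    · exact le_of_mul_le_mul_right (by nlinarith) h0
  calc |p.g x - p.g x'| ≤ p.Bg * (p.Bg * |c - c'| / μ) :=
        h1.trans (mul_le_mul_of_nonneg_left h3 hB)
    _ = p.Bg ^ 2 / μ * |c - c'| := by ring

/-- Beyond the optimal multiplier, Lagrangian minimizers are feasible. -/
theorem g_isLagMin_nonpos (hA : p.Assumptions μ Lf Lg xs zs) {c : ℝ} (hc : zs < c) {x : E}
    (hx : p.IsLagMin c x) : p.g x ≤ 0 := by
  have hc0 : 0 ≤ c := hA.kkt_dual.trans hc.le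
  have h := hA.norm_sq_le_of_nearStationary hc0 hA.kkt_dual le_rfl hx.1
    (hA.nearStationary_of_isLagMin hc0 hx) hA.isLagMin_kkt
  have h1 : 0 ≤ μ * ‖x - xs‖ ^ 2 := mul_nonneg hA.mu_pos.le (sq_nonneg _)
  have h2 : 0 ≤ (c - zs) * (p.g xs - p.g x) := by linarith
  have h3 := nonneg_of_mul_nonneg_right h2 (sub_pos.2 hc)
  linarith [hA.kkt_primal]

/-- The sign inequality at an approximate solution, relative to the KKT pair. -/
theorem mul_g_le (hA : p.Assumptions μ Lf Lg xs zs) {c τ : ℝ} (hc : 0 ≤ c) (hτ : 0 ≤ τ) {x : E}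
    (hx : x ∈ effDom p.h) (hn : NearStationary (p.lagrangian c) τ x) :
    (c - zs) * p.g x ≤ τ ^ 2 / (4 * μ) := by
  have hμ := hA.mu_pos
  have h := hA.norm_sq_le_of_nearStationary hc hA.kkt_dual hτ hx hn hA.isLagMin_kkt
  have h1 : c * p.g xs ≤ 0 := mul_nonpos_of_nonneg_of_nonpos hc hA.kkt_primal
  have h2 := hA.kkt_compl
  rw [le_div_iff₀ (by positivity)]
  nlinarith [sq_nonneg (2 * μ * ‖x - xs‖ - τ)]

/-- Changing the multiplier changes near-stationarity by at most `|c - c'| B_g`. -/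
theorem nearStationary_shift (hA : p.Assumptions μ Lf Lg xs zs) {c c' τ : ℝ} (hc : 0 ≤ c)
    (hc' : 0 ≤ c') (hτ : 0 ≤ τ) {x : E} (hx : x ∈ effDom p.h)
    (hn : NearStationary (p.lagrangian c) τ x) :
    NearStationary (p.lagrangian c') (τ + |c' - c| * p.Bg) x := by
  have hB : 0 ≤ p.Bg := (norm_nonneg _).trans (hA.norm_gradient_le hx)
  refine nearStationary_of_forall_pos (by positivity) fun η hη => ?_
  obtain ⟨v, hv, hvτ⟩ := hn.exists_mem hτ hη
  refine ⟨v + (c' - c) • gradient p.g x, ?_, ?_⟩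
  · rw [lagrangian_eq, hA.mem_subdiff_smoothPart hc 0 hx] at hv
    rw [lagrangian_eq, hA.mem_subdiff_smoothPart hc' 0 hx]
    convert hv using 1
    module
  · refine (norm_add_le _ _).trans ?_
    rw [norm_smul, Real.norm_eq_abs]
    have := mul_le_mul_of_nonneg_left (hA.norm_gradient_le hx) (abs_nonneg (c' - c))
    linarith

theorem apgSetup [Nontrivial E] (hA : p.Assumptions μ Lf Lg xs zs) {ls : LineSearch}
    (hls : ls.Valid) {c Λ : ℝ} (hc : 0 ≤ c) (hΛ : ls.Lmin ≤ Λ) (hΛ' : ls.γ₁ * (Lf + c * Lg) ≤ Λ)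
    (d : ℝ) {xo : E} (hxo : p.IsLagMin c xo) :
    APGSetup (p.smoothPart c d) p.h μ (Lf + c * Lg) Λ ls xo where
  proper := hA.h_closed_convex
  smooth := hA.smoothStrong_smoothPart hc d
  mu_pos := hA.mu_pos
  mu_le := by nlinarith [hA.mu_le, hA.Lg_nonneg]
  one_lt := hls.one_lt
  one_le := hls.one_le
  Lmin_pos := hls.Lmin_pos
  Lmin_le := hΛ
  mul_le := hΛ'
  mem := hxo.1
  opt u hu := by
    have h := (hA.smoothStrong_smoothPart hc d).growth (v := 0) (x := xo)
      (by rw [hA.gradient_smoothPart, zero_sub]; exact hxo.2) hu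
    rw [inner_zero_left] at h
    have : 0 ≤ μ / 2 * ‖u - xo‖ ^ 2 := mul_nonneg (by linarith [hA.mu_pos]) (sq_nonneg _)
    unfold objVal
    linarith

theorem solve_spec [Nontrivial E] [ProperSpace E] (hA : p.Assumptions μ Lf Lg xs zs)
    {ls : LineSearch} (hls : ls.Valid) {c d τ : ℝ} (hc : 0 ≤ c) {y₀ x : E} {N : ℕ}
    (hs : p.Solve μ ls (p.smoothPart c d) τ y₀ x N) :
    x ∈ effDom p.h ∧ NearStationary (p.lagrangian c) τ x := by
  obtain ⟨xo, hxo⟩ := hA.exists_isLagMin hc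
  obtain ⟨t, ht, -⟩ := hs
  obtain ⟨h1, h2⟩ := (hA.apgSetup hls hc (le_max_left _ _) (le_max_right _ _) d hxo).apg_spec ht
  refine ⟨h1, ?_⟩
  have e : subdiff (p.lagrangian c) x = subdiff (addExt (p.smoothPart c d) p.h) x := by
    ext v
    rw [lagrangian_eq, hA.mem_subdiff_smoothPart hc 0 h1, hA.mem_subdiff_smoothPart hc d h1]
  rwa [NearStationary, e]

theorem exists_solve [Nontrivial E] [ProperSpace E] (hA : p.Assumptions μ Lf Lg xs zs)
    {ls : LineSearch} (hls : ls.Valid) {c τ : ℝ} (d : ℝ) (hc : 0 ≤ c) (hτ : 0 < τ) (y₀ : E) :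
    ∃ x N, p.Solve μ ls (p.smoothPart c d) τ y₀ x N := by
  obtain ⟨xo, hxo⟩ := hA.exists_isLagMin hc
  obtain ⟨x, N, h⟩ := (hA.apgSetup hls hc (le_max_left _ _) (le_max_right _ _) d hxo).exists_apg
    hA.dom_bounded hτ y₀
  exact ⟨x, _, N, h, rfl⟩

theorem solve_cost [Nontrivial E] [ProperSpace E] (hA : p.Assumptions μ Lf Lg xs zs)
    {ls : LineSearch} (hls : ls.Valid) {c d τ Λ thr R : ℝ} (hc : 0 ≤ c) {y₀ x : E} {N : ℕ}
    (hs : p.Solve μ ls (p.smoothPart c d) τ y₀ x N) (hy₀ : y₀ ∈ effDom p.h)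
    (hΛ : ls.Lmin ≤ Λ) (hΛ' : ls.γ₁ * (Lf + c * Lg) ≤ Λ) (hτ : 0 ≤ τ) (hthr0 : 0 < thr)
    (hthr : 8 * Λ ^ 2 * thr ≤ τ ^ 2 * ls.Lmin) (hR : Metric.diam (effDom p.h) ≤ R) :
    (N : ℝ) ≤ 2 * (10 + 6 * (Real.log Λ - Real.log ls.Lmin) / Real.log ls.γ₁ +
      (7 + 3 * Real.log ls.γ₂ / Real.log ls.γ₁ + 6 / Real.log ls.γ₁) / Real.sqrt (μ / Λ) *
        (Real.log (Λ * R ^ 2 + thr) - Real.log thr)) := by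
  obtain ⟨xo, hxo⟩ := hA.exists_isLagMin hc
  obtain ⟨t, ht, rfl⟩ := hs
  have hd : ‖xo - y₀‖ ≤ R := by
    rw [← dist_eq_norm]
    exact (Metric.dist_le_diam_of_mem hA.dom_bounded hxo.1 hy₀).trans hR
  have := (hA.apgSetup hls hc hΛ hΛ' d hxo).apg_cost ht hτ hthr0 hthr hd
  push_cast
  linarith

end Assumptions

end Lagrangian

end Problem

/-! ### The interval search and the bisection -/

/-- The endpoints enclose a root of `q` with margin `δ / 2`, or coincide at an approximate root. -/
def Brackets (q : ℝ → ℝ) (δ a b : ℝ) : Prop :=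
  0 ≤ a ∧ a ≤ b ∧ ((a = b ∧ |q b| ≤ δ) ∨ (δ / 2 < q a ∧ q b < -(δ / 2)))

/-- A failed acceptance test with `θ > b` at an approximate solution gives the sign of the exact `q`,
with margin `δ / 2`. -/
theorem margin_of_test_pos {t b q δ : ℝ} (hb : 0 ≤ b) (h : |max t 0 - b - q| ≤ δ / 4)
    (h1 : |max t 0 - b| > 3 * δ / 4) (h2 : t - b > 0) : δ / 2 < q := by
  rw [max_eq_left (by linarith)] at h h1
  rw [abs_of_pos h2] at h1
  linarith [(abs_le.1 h).2]

theorem margin_of_test_neg {t b q δ : ℝ} (hb : 0 ≤ b) (h : |max t 0 - b - q| ≤ δ / 4)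
    (h1 : |max t 0 - b| > 3 * δ / 4) (h2 : ¬ (t - b > 0)) : q < -(δ / 2) := by
  have h3 : max t 0 - b ≤ 0 := by
    have := max_le (show t ≤ b by linarith [not_lt.1 h2]) hb
    linarith
  rw [abs_of_nonpos h3] at h1
  linarith [(abs_le.1 h).1]

theorem abs_le_of_test {t b q δ : ℝ} (h : |max t 0 - b - q| ≤ δ / 4)
    (h1 : |max t 0 - b| ≤ 3 * δ / 4) : |q| ≤ δ := by
  rw [abs_le] at *
  constructor <;> linarith [h.1, h.2, h1.1, h1.2]

namespace Problem

section Bisection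

variable {E : Type*} [NormedAddCommGroup E] [InnerProductSpace ℝ E] [CompleteSpace E]

/-- What the search needs to know about the subproblems. The function `q` stands for the positive
part of `θ` at the exact subproblem solution, minus `y`; its root is sought. It decreases at a bounded
rate, approximate solutions determine it up to `δ / 4`, and it is positive only at points `y > 0` with
`β y ≤ cm`. -/
structure SearchOracle (p : Problem E) (μ : ℝ) (ls : LineSearch) (β z δ : ℝ) (q : ℝ → ℝ) (cm : ℝ) :
    Prop where
  lip : ∀ a b, 0 ≤ a → a ≤ b → q a - q b ≤ (μ + β * p.Bg ^ 2) / μ * (b - a)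
  spec : ∀ y, 0 ≤ y → ∀ y₀ x N, p.Solve μ ls (p.Φsmooth β z y) (p.tol μ δ) y₀ x N →
    x ∈ effDom p.h ∧ NearStationary (p.lagrangian (β * y)) (p.tol μ δ) x ∧
      |max (p.θ β z x) 0 - y - q y| ≤ δ / 4
  exists_solve : ∀ y, 0 ≤ y → ∀ y₀, ∃ x N, p.Solve μ ls (p.Φsmooth β z y) (p.tol μ δ) y₀ x N
  sign : ∀ y, 0 < y → 0 < q y → β * y ≤ cm

theorem Assumptions.exists_searchOracle [Nontrivial E] [ProperSpace E] {p : Problem E}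
    {μ Lf Lg : ℝ} {xs : E} {zs : ℝ} (hA : p.Assumptions μ Lf Lg xs zs) {ls : LineSearch}
    (hls : ls.Valid) {β z δ : ℝ} (hβ : 0 < β) (hδ : 0 < δ) (hB : 0 < p.Bg) :
    ∃ q : ℝ → ℝ, p.SearchOracle μ ls β z δ q (max zs z) ∧
      ∀ y, 0 ≤ y → ∃ xo, p.IsLagMin (β * y) xo ∧ q y = max (p.θ β z xo) 0 - y := by
  have hμ := hA.mu_pos
  have hex : ∀ y : ℝ, ∃ xo, 0 ≤ y → p.IsLagMin (β * y) xo := by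
    intro y
    by_cases hy : 0 ≤ y
    · obtain ⟨xo, hxo⟩ := hA.exists_isLagMin (mul_nonneg hβ.le hy)
      exact ⟨xo, fun _ => hxo⟩
    · exact ⟨0, fun h => absurd h hy⟩
  choose xm hxm using hex
  refine ⟨fun y => max (p.θ β z (xm y)) 0 - y, ⟨?_, ?_, ?_, ?_⟩, fun y hy => ⟨xm y, hxm y hy, rfl⟩⟩
  · intro a b ha hab
    have hb := ha.trans hab
    have h1 := hA.abs_g_isLagMin_sub_le (mul_nonneg hβ.le ha) (mul_nonneg hβ.le hb)
      (hxm a ha) (hxm b hb)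
    have h2 := abs_max_sub_max_le_abs (p.θ β z (xm a)) (p.θ β z (xm b)) 0
    have h3 : p.θ β z (xm a) - p.θ β z (xm b) = p.g (xm a) - p.g (xm b) := by
      unfold θ; ring
    have h4 : |β * a - β * b| = β * (b - a) := by
      rw [← mul_sub, abs_mul, abs_of_pos hβ, abs_sub_comm, abs_of_nonneg (sub_nonneg.2 hab)]
    rw [h3] at h2
    rw [h4] at h1
    have h5 := (le_abs_self _).trans (h2.trans h1)
    have e : (μ + β * p.Bg ^ 2) / μ * (b - a) = (b - a) + p.Bg ^ 2 / μ * (β * (b - a)) := by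
      field_simp
    rw [e]
    linarith
  · intro y hy y₀ x N hs
    rw [Φsmooth_eq] at hs
    have hc := mul_nonneg hβ.le hy
    have htol : 0 ≤ p.tol μ δ := by unfold tol; positivity
    obtain ⟨h1, h2⟩ := hA.solve_spec hls hc hs
    refine ⟨h1, h2, ?_⟩
    have h3 := hA.norm_sub_le_of_nearStationary hc htol h1 h2 (hxm y hy)
    have h4 := hA.abs_g_sub_le h1 (hxm y hy).1
    have h5 := abs_max_sub_max_le_abs (p.θ β z x) (p.θ β z (xm y)) 0
    have h6 : p.θ β z x - p.θ β z (xm y) = p.g x - p.g (xm y) := by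
      unfold θ; ring
    rw [h6] at h5
    have h7 : p.Bg * (p.tol μ δ / μ) = δ / 4 := by
      unfold tol; field_simp
    rw [sub_sub, add_sub_cancel, ← h7]
    exact h5.trans (h4.trans (mul_le_mul_of_nonneg_left h3 hB.le))
  · intro y hy y₀
    rw [Φsmooth_eq]
    exact hA.exists_solve hls _ (mul_nonneg hβ.le hy) (by unfold tol; positivity) y₀
  · intro y hy hq
    rw [le_max_iff]
    by_contra! hcon
    have h1 := hA.g_isLagMin_nonpos hcon.1 (hxm y hy.le)
    have h2 : y < max (p.θ β z (xm y)) 0 := by linarith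
    rcases lt_max_iff.1 h2 with h3 | h3
    · unfold θ at h3
      have h4 : y < z / β := by linarith
      rw [lt_div_iff₀ hβ] at h4
      linarith [hcon.2]
    · linarith

variable {p : Problem E} {μ β z δ cm : ℝ} {ls : LineSearch} {q : ℝ → ℝ} {start : ℕ → E}

/-- The bisection returns an approximate root of `q`. An interval with distinct endpoints stays wider
than the final tolerance, because `q` is Lipschitz and drops by more than `δ` across it. -/
theorem SearchOracle.biSecLoop_spec (O : p.SearchOracle μ ls β z δ q cm) (hμ : 0 < μ) (hβ : 0 < β)
    {a b : ℝ} {i : ℕ} {x : E} {y : ℝ} {i' N : ℕ}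
    (hr : p.BiSecLoop μ ls β z δ start a b i x y i' N) (hab : Brackets q δ a b) :
    0 ≤ y ∧ y ≤ b ∧ |q y| ≤ δ ∧ x ∈ effDom p.h ∧
      NearStationary (p.lagrangian (β * y)) (p.tol μ δ) x ∧
      |max (p.θ β z x) 0 - y - q y| ≤ δ / 4 := by
  induction hr with
  | @done a b i x N h1 hs =>
    obtain ⟨h0, hle, hab⟩ := hab
    obtain ⟨s1, s2, s3⟩ := O.spec _ (by linarith) _ _ _ hs
    refine ⟨by linarith, by linarith, ?_, s1, s2, s3⟩
    rcases hab with ⟨rfl, hq⟩ | ⟨ha, hb⟩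
    · rwa [add_self_div_two]
    -- A drop of more than `δ` over a width of at most the final tolerance contradicts `lip`.
    · exfalso
      have h2 := O.lip a b h0 hle
      have hd : 0 < μ + β * p.Bg ^ 2 := by positivity
      have h3 := not_lt.1 h1
      rw [le_div_iff₀ hd] at h3
      rw [div_mul_eq_mul_div, le_div_iff₀ hμ] at h2
      nlinarith
  | @hit a b i x N h1 hs h2 =>
    obtain ⟨h0, hle, hab⟩ := hab
    obtain ⟨s1, s2, s3⟩ := O.spec _ (by linarith) _ _ _ hs
    exact ⟨by linarith, by linarith, abs_le_of_test s3 h2, s1, s2, s3⟩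
  | @raise_left a b i x x' y i' N N' h1 hs h2 h3 hl ih =>
    obtain ⟨h0, hle, hab⟩ := hab
    obtain ⟨s1, s2, s3⟩ := O.spec _ (by linarith) _ _ _ hs
    have hm := margin_of_test_pos (by linarith) s3 (not_le.1 h2) h3
    refine ih ⟨by linarith, by linarith, ?_⟩
    rcases hab with ⟨rfl, hq⟩ | ⟨ha, hb⟩
    · exact Or.inl ⟨by ring, hq⟩
    · exact Or.inr ⟨hm, hb⟩
  | @lower_right a b i x x' y i' N N' h1 hs h2 h3 hl ih =>
    obtain ⟨h0, hle, hab⟩ := hab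
    obtain ⟨s1, s2, s3⟩ := O.spec _ (by linarith) _ _ _ hs
    have hm := margin_of_test_neg (by linarith) s3 (not_le.1 h2) h3
    obtain ⟨r1, r2, r3⟩ := ih ⟨by linarith, by linarith, by
      rcases hab with ⟨rfl, hq⟩ | ⟨ha, hb⟩
      · exact Or.inl ⟨by ring, by rwa [add_self_div_two]⟩
      · exact Or.inr ⟨ha, hm⟩⟩
    exact ⟨r1, by linarith, r3⟩

/-- The width is halved in every pass, so that an interval of width at most `2 ^ n` times the final
tolerance needs at most `n + 1` calls. -/
theorem biSecLoop_cost {w U Cm : ℝ} (hw : w = μ * δ / (μ + β * p.Bg ^ 2)) (hβ : 0 < β)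
    (hU0 : 0 ≤ U) (hU : ∀ y, 0 ≤ y → β * y ≤ Cm → ∀ i x N,
      p.Solve μ ls (p.Φsmooth β z y) (p.tol μ δ) (start i) x N → (N : ℝ) ≤ U)
    {a b : ℝ} {i : ℕ} {x : E} {y : ℝ} {i' N : ℕ}
    (hr : p.BiSecLoop μ ls β z δ start a b i x y i' N) :
    ∀ n : ℕ, 0 ≤ a → a ≤ b → β * b ≤ Cm → b - a ≤ 2 ^ n * w → (N : ℝ) ≤ (n + 1) * (U + 1) := by
  subst hw
  induction hr with
  | @done a b i x N h1 hs =>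
    intro n h0 hle hb hn
    have := hU ((a + b) / 2) (by linarith) (by nlinarith) _ _ _ hs
    nlinarith [(Nat.cast_nonneg n : (0 : ℝ) ≤ n)]
  | @hit a b i x N h1 hs h2 =>
    intro n h0 hle hb hn
    have := hU ((a + b) / 2) (by linarith) (by nlinarith) _ _ _ hs
    push_cast
    nlinarith [(Nat.cast_nonneg n : (0 : ℝ) ≤ n)]
  | @raise_left a b i x x' y i' N N' h1 hs h2 h3 hl ih =>
    intro n h0 hle hb hn
    have h4 := hU ((a + b) / 2) (by linarith) (by nlinarith) _ _ _ hs
    cases n with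
    | zero => rw [pow_zero, one_mul] at hn; linarith
    | succ n =>
      have := ih n (by linarith) (by linarith) hb (by rw [pow_succ] at hn; linarith)
      push_cast
      linarith
  | @lower_right a b i x x' y i' N N' h1 hs h2 h3 hl ih =>
    intro n h0 hle hb hn
    have h4 := hU ((a + b) / 2) (by linarith) (by nlinarith) _ _ _ hs
    cases n with
    | zero => rw [pow_zero, one_mul] at hn; linarith
    | succ n =>
      have := ih n (by linarith) (by linarith) (by nlinarith) (by rw [pow_succ] at hn; linarith)
      push_cast
      linarith

theorem SearchOracle.exists_biSecLoop (O : p.SearchOracle μ ls β z δ q cm) (hμ : 0 < μ)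
    (hβ : 0 < β) (hδ : 0 < δ) {a b : ℝ} (ha : 0 ≤ a) (hab : a ≤ b) (i : ℕ) :
    ∃ x y i' N, p.BiSecLoop μ ls β z δ start a b i x y i' N := by
  have hw : 0 < μ * δ / (μ + β * p.Bg ^ 2) := by positivity
  have key : ∀ (n : ℕ) (a b : ℝ) (i : ℕ), 0 ≤ a → a ≤ b →
      b - a ≤ 2 ^ n * (μ * δ / (μ + β * p.Bg ^ 2)) →
      ∃ x y i' N, p.BiSecLoop μ ls β z δ start a b i x y i' N := by
    intro n
    induction n with
    | zero =>
      intro a b i ha hab hn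
      obtain ⟨x, N, hs⟩ := O.exists_solve ((a + b) / 2) (by linarith) (start i)
      exact ⟨_, _, _, _, .done (by rw [pow_zero, one_mul] at hn; linarith) hs⟩
    | succ n ih =>
      intro a b i ha hab hn
      obtain ⟨x, N, hs⟩ := O.exists_solve ((a + b) / 2) (by linarith) (start i)
      rw [pow_succ] at hn
      by_cases h1 : b - a > μ * δ / (μ + β * p.Bg ^ 2)
      · by_cases h2 : |max (p.θ β z x) 0 - (a + b) / 2| ≤ 3 * δ / 4
        · exact ⟨_, _, _, _, .hit h1 hs h2⟩
        · by_cases h3 : p.θ β z x - (a + b) / 2 > 0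
          · obtain ⟨_, _, _, _, hr⟩ := ih ((a + b) / 2) b (i + 1) (by linarith) (by linarith)
              (by linarith)
            exact ⟨_, _, _, _, .raise_left h1 hs h2 h3 hr⟩
          · obtain ⟨_, _, _, _, hr⟩ := ih a ((a + b) / 2) (i + 1) (by linarith) (by linarith)
              (by linarith)
            exact ⟨_, _, _, _, .lower_right h1 hs h2 h3 hr⟩
      · exact ⟨_, _, _, _, .done h1 hs⟩
  obtain ⟨n, hn⟩ := pow_unbounded_of_one_lt ((b - a) / (μ * δ / (μ + β * p.Bg ^ 2)))
    (one_lt_two : (1 : ℝ) < 2)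
  exact key n a b i ha hab (by rw [div_lt_iff₀ hw] at hn; exact hn.le)

/-- The interval search brackets a root. It moves right only from points with `q > 0`, where
`β b ≤ cm`, so doubling keeps `β b ≤ 2 cm`; this bounds both the multipliers that occur and the
number of doublings. -/
theorem SearchOracle.intVLoop_spec (O : p.SearchOracle μ ls β z δ q cm) (hδ : 0 < δ)
    {Cm U : ℝ} (hCm : 2 * cm ≤ Cm) (hU0 : 0 ≤ U) (hU : ∀ y, 0 ≤ y → β * y ≤ Cm → ∀ i x N,
      p.Solve μ ls (p.Φsmooth β z y) (p.tol μ δ) (start i) x N → (N : ℝ) ≤ U)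
    {a b : ℝ} {x : E} {i : ℕ} {a' b' : ℝ} {i' N : ℕ}
    (hr : p.IntVLoop μ ls β z δ start a b x i a' b' i' N) :
    ∀ n : ℕ, 0 ≤ a → a ≤ b → 0 < b → δ / 2 < q a → |max (p.θ β z x) 0 - b - q b| ≤ δ / 4 →
      β * b ≤ Cm → Cm ≤ 2 ^ n * (β * b) → 0 < β →
      Brackets q δ a' b' ∧ β * b' ≤ Cm ∧ (N : ℝ) ≤ n * (U + 1) + 1 := by
  induction hr with
  | @grow a b x x' i a' b' i' N N' h1 h2 hs hl ih =>
    intro n ha hab hb hqa hx hbC hn hβ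
    have hq := margin_of_test_pos hb.le hx h1 h2
    have h3 := O.sign b hb (by linarith)
    obtain ⟨-, -, s3⟩ := O.spec _ (by linarith) _ _ _ hs
    have h4 := hU (2 * b) (by linarith) (by linarith) _ _ _ hs
    cases n with
    | zero =>
      rw [pow_zero, one_mul] at hn
      have := mul_pos hβ hb
      linarith
    | succ n =>
      obtain ⟨r1, r2, r3⟩ := ih n hb.le (by linarith) (by linarith) hq s3 (by linarith)
        (by rw [pow_succ] at hn; linarith) hβ
      refine ⟨r1, r2, ?_⟩
      push_cast
      linarith
  | @point a b x i h1 =>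
    intro n ha hab hb hqa hx hbC hn hβ
    refine ⟨⟨hb.le, le_rfl, Or.inl ⟨rfl, abs_le_of_test hx h1⟩⟩, hbC, ?_⟩
    have : (0 : ℝ) ≤ n * (U + 1) := by positivity
    push_cast
    linarith
  | @interval a b x i h1 h2 =>
    intro n ha hab hb hqa hx hbC hn hβ
    refine ⟨⟨ha, hab, Or.inr ⟨hqa, margin_of_test_neg hb.le hx h1 h2⟩⟩, hbC, ?_⟩
    have : (0 : ℝ) ≤ n * (U + 1) := by positivity
    push_cast
    linarith

/-- The interval search ends, because `q` is nonpositive once `β b > cm`. -/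
theorem SearchOracle.exists_intVLoop (O : p.SearchOracle μ ls β z δ q cm) (hδ : 0 < δ)
    (hβ : 0 < β) {b : ℝ} (hb : 0 < b) {x : E} (hx : |max (p.θ β z x) 0 - b - q b| ≤ δ / 4)
    (a : ℝ) (i : ℕ) : ∃ a' b' i' N, p.IntVLoop μ ls β z δ start a b x i a' b' i' N := by
  have key : ∀ (n : ℕ) (a b : ℝ) (x : E) (i : ℕ), 0 < b → |max (p.θ β z x) 0 - b - q b| ≤ δ / 4 →
      cm < 2 ^ n * (β * b) → ∃ a' b' i' N, p.IntVLoop μ ls β z δ start a b x i a' b' i' N := by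
    intro n
    induction n with
    | zero =>
      intro a b x i hb hx hn
      by_cases h1 : |max (p.θ β z x) 0 - b| ≤ 3 * δ / 4
      · exact ⟨_, _, _, _, .point h1⟩
      · by_cases h2 : p.θ β z x - b > 0
        · have hq := margin_of_test_pos hb.le hx (not_le.1 h1) h2
          have h3 := O.sign b hb (by linarith)
          rw [pow_zero, one_mul] at hn
          linarith
        · exact ⟨_, _, _, _, .interval (not_le.1 h1) h2⟩
    | succ n ih =>
      intro a b x i hb hx hn
      by_cases h1 : |max (p.θ β z x) 0 - b| ≤ 3 * δ / 4
      · exact ⟨_, _, _, _, .point h1⟩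
      · by_cases h2 : p.θ β z x - b > 0
        · obtain ⟨x', N, hs⟩ := O.exists_solve (2 * b) (by linarith) (start i)
          obtain ⟨-, -, s3⟩ := O.spec _ (by linarith) _ _ _ hs
          obtain ⟨_, _, _, _, hr⟩ := ih b (2 * b) x' (i + 1) (by linarith) s3
            (by rw [pow_succ] at hn; linarith)
          exact ⟨_, _, _, _, .grow (not_le.1 h1) h2 hs hr⟩
        · exact ⟨_, _, _, _, .interval (not_le.1 h1) h2⟩
  obtain ⟨n, hn⟩ := pow_unbounded_of_one_lt (cm / (β * b)) (one_lt_two : (1 : ℝ) < 2)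
  exact key n a b x i hb hx (by rwa [div_lt_iff₀ (mul_pos hβ hb)] at hn)

theorem SearchOracle.intV_spec (O : p.SearchOracle μ ls β z δ q cm) (hδ : 0 < δ) (hβ : 0 < β)
    {Cm U : ℝ} (hCm : 2 * cm ≤ Cm) (hCm1 : 1 ≤ Cm) (hU0 : 0 ≤ U)
    (hU : ∀ y, 0 ≤ y → β * y ≤ Cm → ∀ i x N,
      p.Solve μ ls (p.Φsmooth β z y) (p.tol μ δ) (start i) x N → (N : ℝ) ≤ U)
    {i : ℕ} {a b : ℝ} {i' N : ℕ} (hr : p.IntV μ ls β z δ start i a b i' N) {n : ℕ}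
    (hn : Cm ≤ 2 ^ n) :
    Brackets q δ a b ∧ β * b ≤ Cm ∧ (N : ℝ) ≤ (n + 2) * (U + 1) := by
  have hn0 : (0 : ℝ) ≤ n * (U + 1) := by positivity
  cases hr with
  | zero hs h1 =>
    obtain ⟨-, -, s3⟩ := O.spec 0 le_rfl _ _ _ hs
    have h2 := hU 0 le_rfl (by linarith) _ _ _ hs
    refine ⟨⟨le_rfl, le_rfl, Or.inl ⟨rfl, abs_le_of_test s3 ?_⟩⟩, by linarith, ?_⟩
    · rwa [sub_zero, abs_of_nonneg (le_max_right _ _)]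
    · push_cast
      linarith
  | search hs h1 hs' hl =>
    obtain ⟨-, -, s3⟩ := O.spec 0 le_rfl _ _ _ hs
    have hb : 0 < 1 / β := by positivity
    have e : β * (1 / β) = 1 := by field_simp
    obtain ⟨-, -, s3'⟩ := O.spec _ hb.le _ _ _ hs'
    have h2 := hU 0 le_rfl (by linarith) _ _ _ hs
    have h3 := hU (1 / β) hb.le (by linarith) _ _ _ hs'
    have h4 : δ / 2 < q 0 := by
      have := (abs_le.1 s3).2
      linarith [not_le.1 h1]
    obtain ⟨r1, r2, r3⟩ := O.intVLoop_spec hδ hCm hU0 hU hl n le_rfl hb.le hb h4 s3'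
      (by rw [e]; exact hCm1) (by rw [e, mul_one]; exact hn) hβ
    refine ⟨r1, r2, ?_⟩
    push_cast
    linarith

theorem SearchOracle.exists_intV (O : p.SearchOracle μ ls β z δ q cm) (hδ : 0 < δ) (hβ : 0 < β)
    (i : ℕ) : ∃ a b i' N, p.IntV μ ls β z δ start i a b i' N := by
  obtain ⟨x, N, hs⟩ := O.exists_solve 0 le_rfl (start i)
  by_cases h1 : max (p.θ β z x) 0 ≤ 3 * δ / 4
  · exact ⟨_, _, _, _, .zero hs h1⟩
  · have hb : 0 < 1 / β := by positivity
    obtain ⟨x', N', hs'⟩ := O.exists_solve (1 / β) hb.le (start (i + 1))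
    obtain ⟨-, -, s3⟩ := O.spec _ hb.le _ _ _ hs'
    obtain ⟨_, _, _, _, hl⟩ := O.exists_intVLoop (start := start) hδ hβ hb s3 0 (i + 2)
    exact ⟨_, _, _, _, .search hs h1 hs' hl⟩

theorem intVLoop_le {a b : ℝ} {x : E} {i : ℕ} {a' b' : ℝ} {i' N : ℕ}
    (hr : p.IntVLoop μ ls β z δ start a b x i a' b' i' N) (ha : 0 ≤ a) (hab : a ≤ b) :
    0 ≤ a' ∧ a' ≤ b' := by
  induction hr with
  | grow _ _ _ _ ih => exact ih (by linarith) (by linarith)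
  | point _ => exact ⟨ha.trans hab, le_rfl⟩
  | interval _ _ => exact ⟨ha, hab⟩

theorem intV_le {i : ℕ} {a b : ℝ} {i' N : ℕ} (hr : p.IntV μ ls β z δ start i a b i' N)
    (hβ : 0 < β) : 0 ≤ a ∧ a ≤ b := by
  cases hr with
  | zero => exact ⟨le_rfl, le_rfl⟩
  | search _ _ _ hl => exact intVLoop_le hl le_rfl (by positivity)

theorem biSecLoop_nonneg {a b : ℝ} {i : ℕ} {x : E} {y : ℝ} {i' N : ℕ}
    (hr : p.BiSecLoop μ ls β z δ start a b i x y i' N) (ha : 0 ≤ a) (hab : a ≤ b) : 0 ≤ y := by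
  induction hr with
  | done _ _ => linarith
  | hit _ _ _ => linarith
  | raise_left _ _ _ _ _ ih => exact ih (by linarith) (by linarith)
  | lower_right _ _ _ _ _ ih => exact ih ha (by linarith)

end Bisection

end Problem

/-! ### The primal update -/

namespace Problem

section PrimalUpdate

variable {E : Type*} [NormedAddCommGroup E] [InnerProductSpace ℝ E] [CompleteSpace E]

/-- `U` bounds the cost of every call of the accelerated method with multiplier at most `Cm` and
tolerance at least `τ₀`. -/
def SolveCostLE (p : Problem E) (μ : ℝ) (ls : LineSearch) (start : ℕ → E) (Cm τ₀ U : ℝ) : Prop :=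
  ∀ c d τ, 0 ≤ c → c ≤ Cm → τ₀ ≤ τ → ∀ i x N,
    p.Solve μ ls (p.smoothPart c d) τ (start i) x N → (N : ℝ) ≤ U

variable {p : Problem E} {μ Lf Lg : ℝ} {xs : E} {zs : ℝ}

namespace Assumptions

theorem solveCostLE [Nontrivial E] [ProperSpace E] (hA : p.Assumptions μ Lf Lg xs zs)
    {ls : LineSearch} (hls : ls.Valid) {start : ℕ → E} (hst : ∀ i, start i ∈ effDom p.h)
    {Cm τ₀ Λ thr R : ℝ} (hΛ : ls.Lmin ≤ Λ) (hΛ' : ls.γ₁ * (Lf + Cm * Lg) ≤ Λ) (hτ : 0 ≤ τ₀)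
    (hthr0 : 0 < thr) (hthr : 8 * Λ ^ 2 * thr ≤ τ₀ ^ 2 * ls.Lmin)
    (hR : Metric.diam (effDom p.h) ≤ R) :
    p.SolveCostLE μ ls start Cm τ₀
      (2 * (10 + 6 * (Real.log Λ - Real.log ls.Lmin) / Real.log ls.γ₁ +
        (7 + 3 * Real.log ls.γ₂ / Real.log ls.γ₁ + 6 / Real.log ls.γ₁) / Real.sqrt (μ / Λ) *
          (Real.log (Λ * R ^ 2 + thr) - Real.log thr))) := by
  intro c d τ hc hcC hτ' i x N hs
  have hγ : 0 ≤ ls.γ₁ := by linarith [hls.one_lt]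
  refine hA.solve_cost hls hc hs (hst i) hΛ ?_ (hτ.trans hτ') hthr0 ?_ hR
  · refine le_trans (mul_le_mul_of_nonneg_left ?_ hγ) hΛ'
    have := mul_le_mul_of_nonneg_right hcC hA.Lg_nonneg
    linarith
  · refine hthr.trans ?_
    have := hls.Lmin_pos
    gcongr

theorem exists_solveCostLE [Nontrivial E] [ProperSpace E] (hA : p.Assumptions μ Lf Lg xs zs)
    {ls : LineSearch} (hls : ls.Valid) {start : ℕ → E} (hst : ∀ i, start i ∈ effDom p.h)
    (Cm : ℝ) {τ₀ : ℝ} (hτ : 0 < τ₀) : ∃ U, 0 ≤ U ∧ p.SolveCostLE μ ls start Cm τ₀ U := by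
  have hm := hls.Lmin_pos
  set Λ := max ls.Lmin (ls.γ₁ * (Lf + Cm * Lg)) with hΛ
  have hΛ0 : 0 < Λ := hm.trans_le (le_max_left _ _)
  have h := hA.solveCostLE hls hst (Cm := Cm) (τ₀ := τ₀) (Λ := Λ)
    (thr := τ₀ ^ 2 * ls.Lmin / (8 * Λ ^ 2))
    (le_max_left _ _) (le_max_right _ _) hτ.le (by positivity)
    (by rw [mul_div_cancel₀ _ (by positivity)]) le_rfl
  exact ⟨_, le_max_left 0 _, fun c d τ h1 h2 h3 i x N hs =>
    (h c d τ h1 h2 h3 i x N hs).trans (le_max_right _ _)⟩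

end Assumptions

theorem SolveCostLE.searchCost {ls : LineSearch} {start : ℕ → E} {Cm τ₀ U β z δ : ℝ}
    (hU : p.SolveCostLE μ ls start Cm τ₀ U) (hβ : 0 < β) (hτ : τ₀ ≤ p.tol μ δ) :
    ∀ y, 0 ≤ y → β * y ≤ Cm → ∀ i x N,
      p.Solve μ ls (p.Φsmooth β z y) (p.tol μ δ) (start i) x N → (N : ℝ) ≤ U := by
  intro y hy hyC i x N hs
  rw [Φsmooth_eq] at hs
  exact hU _ _ _ (mul_nonneg hβ.le hy) hyC hτ i x N hs

theorem SearchOracle.biSec_spec {ls : LineSearch} {start : ℕ → E} {β z δ cm Cm τ₀ U : ℝ}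
    {q : ℝ → ℝ} (O : p.SearchOracle μ ls β z δ q cm) (hμ : 0 < μ) (hδ : 0 < δ) (hβ : 0 < β)
    (hCm : 2 * cm ≤ Cm) (hCm1 : 1 ≤ Cm) (hU0 : 0 ≤ U) (hU : p.SolveCostLE μ ls start Cm τ₀ U)
    (hτ : τ₀ ≤ p.tol μ δ) {i : ℕ} {x : E} {y : ℝ} {i' N : ℕ}
    (hr : p.BiSec μ ls β z δ start i x y i' N) {n m : ℕ} (hn : Cm ≤ 2 ^ n)
    (hm : Cm / β ≤ 2 ^ m * (μ * δ / (μ + β * p.Bg ^ 2))) :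
    0 ≤ y ∧ β * y ≤ Cm ∧ |q y| ≤ δ ∧ x ∈ effDom p.h ∧
      NearStationary (p.lagrangian (β * y)) (p.tol μ δ) x ∧
      |max (p.θ β z x) 0 - y - q y| ≤ δ / 4 ∧ (N : ℝ) ≤ (n + m + 3) * (U + 1) := by
  obtain ⟨a, b, j, N₁, N₂, h1, h2, rfl⟩ := hr
  obtain ⟨hbr, hbC, hN₁⟩ := O.intV_spec hδ hβ hCm hCm1 hU0 (hU.searchCost hβ hτ) h1 hn
  obtain ⟨r1, r2, r3, r4, r5, r6⟩ := O.biSecLoop_spec hμ hβ h2 hbr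
  have hN₂ := biSecLoop_cost rfl hβ hU0 (hU.searchCost hβ hτ) h2 m hbr.1 hbr.2.1 hbC (by
    refine le_trans ?_ hm
    rw [le_div_iff₀ hβ]
    have := mul_nonneg hβ.le hbr.1
    linarith)
  refine ⟨r1, (mul_le_mul_of_nonneg_left r2 hβ.le).trans hbC, r3, r4, r5, r6, ?_⟩
  push_cast
  linarith

/-- The result of a primal update is nearly stationary for the Lagrangian with the updated
multiplier. In the bisection alone the tolerance `μ δ / (4 B_g)` is at most `ε_k / 3` when
`μ ≤ 4 β B_g²`; otherwise the extra call provides that accuracy. -/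
theorem Assumptions.primalUpdate_spec [Nontrivial E] [ProperSpace E]
    (hA : p.Assumptions μ Lf Lg xs zs) {ls : LineSearch} (hls : ls.Valid) {start : ℕ → E}
    {β z εk Cm τ₀ U : ℝ} (hβ : 0 < β) (hεk : 0 < εk) (hB : 0 < p.Bg)
    (hCm : 2 * max zs z ≤ Cm) (hCm1 : 1 ≤ Cm) (hU0 : 0 ≤ U)
    (hU : p.SolveCostLE μ ls start Cm τ₀ U)
    (hτ : τ₀ ≤ p.tol μ (εk / (3 * β * p.Bg))) (hτ' : τ₀ ≤ εk / 3) {n m : ℕ} (hn : Cm ≤ 2 ^ n)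
    (hm : Cm / β ≤ 2 ^ m * (μ * (εk / (3 * β * p.Bg)) / (μ + β * p.Bg ^ 2)))
    {i : ℕ} {x : E} {i' N : ℕ} (hr : p.PrimalUpdate μ ls β z εk start i x i' N) :
    x ∈ effDom p.h ∧ NearStationary (p.lagrangian (max (z + β * p.g x) 0)) εk x ∧
      (N : ℝ) ≤ (n + m + 4) * (U + 1) := by
  have hμ := hA.mu_pos
  obtain ⟨x₁, y, i₁, N₁, h1, h2⟩ := hr
  set δ := εk / (3 * β * p.Bg) with hδ
  have hδ0 : 0 < δ := by positivity
  obtain ⟨q, O, hq⟩ := hA.exists_searchOracle hls (z := z) hβ hδ0 hB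
  obtain ⟨r1, r2, r3, r4, r5, r6, hN⟩ :=
    O.biSec_spec hμ hδ0 hβ hCm hCm1 hU0 hU hτ h1 hn hm
  have hc : 0 ≤ β * y := mul_nonneg hβ.le r1
  have hmul : ∀ x, max (z + β * p.g x) 0 - β * y = β * (max (p.θ β z x) 0 - y) := by
    intro x
    have : z + β * p.g x = β * p.θ β z x := by
      unfold θ; field_simp; ring
    rw [this, mul_sub, mul_max_of_nonneg _ _ hβ.le, mul_zero]
  have hβδ : β * δ * p.Bg = εk / 3 := by
    rw [hδ]; field_simp
  rcases h2 with ⟨h3, rfl, N₂, hs, rfl⟩ | ⟨h3, rfl, rfl, rfl⟩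
  · have e : (fun u => p.f u + β * (y * p.g u)) = p.smoothPart (β * y) 0 := by
      funext u; unfold smoothPart; ring
    rw [e] at hs
    obtain ⟨s1, s2⟩ := hA.solve_spec hls hc hs
    refine ⟨s1, ?_, ?_⟩
    · refine (hA.nearStationary_shift hc (le_max_right _ _) (by positivity) s1 s2).mono ?_
      rw [hmul, abs_mul, abs_of_pos hβ]
      obtain ⟨xo, hxo, hqy⟩ := hq y r1
      have t1 := hA.norm_sub_le_of_nearStationary hc (by positivity) s1 s2 hxo
      have t2 := hA.abs_g_sub_le s1 hxo.1
      have t3 := abs_max_sub_max_le_abs (p.θ β z x) (p.θ β z xo) 0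
      have t4 : p.θ β z x - p.θ β z xo = p.g x - p.g xo := by
        unfold θ; ring
      rw [t4] at t3
      have t5 : |max (p.θ β z x) 0 - y| ≤ p.Bg * (εk / 3 / μ) + δ := by
        have : max (p.θ β z x) 0 - y =
            (max (p.θ β z x) 0 - max (p.θ β z xo) 0) + q y := by rw [hqy]; ring
        rw [this]
        refine (abs_add_le _ _).trans (add_le_add (t3.trans (t2.trans ?_)) r3)
        exact mul_le_mul_of_nonneg_left t1 hB.le
      have t6 : β * p.Bg * (p.Bg * (εk / 3 / μ)) ≤ εk / 12 := by
        rw [gt_iff_lt, lt_div_iff₀ (by positivity)] at h3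
        have : β * p.Bg * (p.Bg * (εk / 3 / μ)) = (4 * β * p.Bg ^ 2) * εk / (12 * μ) := by
          field_simp; ring
        rw [this, div_le_div_iff₀ (by positivity) (by positivity)]
        nlinarith
      have t7 := mul_le_mul_of_nonneg_left t5 (mul_pos hβ hB).le
      nlinarith
    · have := hU _ _ _ hc r2 hτ' _ _ _ hs
      push_cast
      linarith
  · refine ⟨r4, ?_, by linarith⟩
    have htol0 : 0 ≤ p.tol μ δ := by unfold tol; positivity
    refine (hA.nearStationary_shift hc (le_max_right _ _) htol0 r4 r5).mono ?_
    rw [hmul, abs_mul, abs_of_pos hβ]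
    have t5 : |max (p.θ β z x) 0 - y| ≤ 5 / 4 * δ := by
      rw [abs_le] at *
      constructor <;> linarith [r6.1, r6.2, r3.1, r3.2]
    have t6 : p.tol μ δ ≤ εk / 3 := by
      rw [gt_iff_lt, not_lt, div_le_one (by positivity)] at h3
      have : p.tol μ δ = μ * εk / (12 * β * p.Bg ^ 2) := by
        unfold tol; rw [hδ]; field_simp; ring
      rw [this, div_le_div_iff₀ (by positivity) (by positivity)]
      nlinarith
    have t7 := mul_le_mul_of_nonneg_left t5 (mul_pos hβ hB).le
    nlinarith

theorem Assumptions.primalUpdate_nearStationary [Nontrivial E] [ProperSpace E]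
    (hA : p.Assumptions μ Lf Lg xs zs) {ls : LineSearch} (hls : ls.Valid) {start : ℕ → E}
    (hst : ∀ i, start i ∈ effDom p.h) {β z εk : ℝ} (hβ : 0 < β) (hεk : 0 < εk) (hB : 0 < p.Bg)
    {i : ℕ} {x : E} {i' N : ℕ} (hr : p.PrimalUpdate μ ls β z εk start i x i' N) :
    x ∈ effDom p.h ∧ NearStationary (p.lagrangian (max (z + β * p.g x) 0)) εk x := by
  have hμ := hA.mu_pos
  have htol : 0 < p.tol μ (εk / (3 * β * p.Bg)) := by unfold tol; positivity
  set Cm := max 1 (2 * max zs z) with hCm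
  obtain ⟨U, hU0, hU⟩ := hA.exists_solveCostLE hls hst Cm
    (show 0 < min (p.tol μ (εk / (3 * β * p.Bg))) (εk / 3) from lt_min htol (by positivity))
  have hw : 0 < μ * (εk / (3 * β * p.Bg)) / (μ + β * p.Bg ^ 2) := by positivity
  obtain ⟨n, hn⟩ := pow_unbounded_of_one_lt Cm (one_lt_two : (1 : ℝ) < 2)
  obtain ⟨m, hm⟩ := pow_unbounded_of_one_lt
    (Cm / β / (μ * (εk / (3 * β * p.Bg)) / (μ + β * p.Bg ^ 2))) (one_lt_two : (1 : ℝ) < 2)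
  obtain ⟨h1, h2, -⟩ := hA.primalUpdate_spec hls hβ hεk hB (le_max_right _ _) (le_max_left _ _)
    hU0 hU (min_le_left _ _) (min_le_right _ _) hn.le
    (by rw [div_lt_iff₀ hw] at hm; exact hm.le) hr
  exact ⟨h1, h2⟩

theorem Assumptions.exists_primalUpdate [Nontrivial E] [ProperSpace E]
    (hA : p.Assumptions μ Lf Lg xs zs) {ls : LineSearch} (hls : ls.Valid) (start : ℕ → E)
    {β εk : ℝ} (z : ℝ) (hβ : 0 < β) (hεk : 0 < εk) (hB : 0 < p.Bg) (i : ℕ) :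
    ∃ x i' N, p.PrimalUpdate μ ls β z εk start i x i' N := by
  have hμ := hA.mu_pos
  have hδ0 : 0 < εk / (3 * β * p.Bg) := by positivity
  obtain ⟨q, O, -⟩ := hA.exists_searchOracle hls (z := z) hβ hδ0 hB
  obtain ⟨a, b, j, N₁, hI⟩ := O.exists_intV (start := start) hδ0 hβ i
  obtain ⟨ha, hab⟩ := intV_le hI hβ
  obtain ⟨x₁, y, i₁, N₂, hL⟩ := O.exists_biSecLoop (start := start) hμ hβ hδ0 ha hab j
  have hbi : p.BiSec μ ls β z (εk / (3 * β * p.Bg)) start i x₁ y i₁ (N₁ + N₂) :=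
    ⟨a, b, j, N₁, N₂, hI, hL, rfl⟩
  by_cases h3 : μ / (4 * β * p.Bg ^ 2) > 1
  · have e : (fun u => p.f u + β * (y * p.g u)) = p.smoothPart (β * y) 0 := by
      funext u; unfold smoothPart; ring
    obtain ⟨x, N, hs⟩ := hA.exists_solve hls 0
      (mul_nonneg hβ.le (biSecLoop_nonneg hL ha hab)) (show 0 < εk / 3 by positivity) (start i₁)
    rw [← e] at hs
    exact ⟨x, _, _, x₁, y, i₁, _, hbi, Or.inl ⟨h3, rfl, N, hs, rfl⟩⟩
  · exact ⟨x₁, _, _, x₁, y, i₁, _, hbi, Or.inr ⟨h3, rfl, rfl, rfl⟩⟩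

end PrimalUpdate

end Problem

/-! ### The outer augmented Lagrangian loop -/

namespace Problem

section Outer

variable {E : Type*} [NormedAddCommGroup E] [InnerProductSpace ℝ E] [CompleteSpace E]

variable {p : Problem E} {μ Lf Lg : ℝ} {xs : E} {zs : ℝ}

/-- The multiplier update is a proximal point step for the dual function, hence nonexpansive towards
the optimal multiplier up to the error of the subproblem. -/
theorem Assumptions.multiplier_step (hA : p.Assumptions μ Lf Lg xs zs) {β τ z : ℝ} (hβ : 0 < β)
    (hτ : 0 ≤ τ) {x : E} (hx : x ∈ effDom p.h)
    (hn : NearStationary (p.lagrangian (max (z + β * p.g x) 0)) τ x) :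
    (max (z + β * p.g x) 0 - zs) ^ 2 + (max (z + β * p.g x) 0 - z) ^ 2 ≤
      (z - zs) ^ 2 + β * τ ^ 2 / (2 * μ) := by
  have h1 := hA.mul_g_le (le_max_right _ _) hτ hx hn
  have hzs := hA.kkt_dual
  set w := max (z + β * p.g x) 0 with hw
  have hproj : (w - zs) * (w - (z + β * p.g x)) ≤ 0 := by
    rcases le_total (z + β * p.g x) 0 with h | h
    · rw [max_eq_right h] at hw
      rw [hw]
      nlinarith
    · rw [max_eq_left h] at hw
      rw [hw]
      simp
  have e : β * τ ^ 2 / (2 * μ) = 2 * (β * (τ ^ 2 / (4 * μ))) := by ring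
  rw [e]
  have h2 := mul_le_mul_of_nonneg_left h1 hβ.le
  -- The polarization `2 (w - zs) (w - z) = (w - zs)² + (w - z)² - (z - zs)²` is implicit here.
  linear_combination 2 * hproj + 2 * h2

/-- The bound on the multipliers that the outer loop maintains. -/
def MultiplierInv (σ ε zs β z : ℝ) : Prop :=
  0 ≤ z ∧ (z - zs) ^ 2 ≤ zs ^ 2 + ε * β / (2 * (8 * σ + 1))

theorem subTol_pos {σ ε : ℝ} (hμ : 0 < μ) (hσ : 1 < σ) (hε : 0 < ε) : 0 < subTol μ σ ε := by
  have h1 : 0 < σ - 1 := by linarith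
  exact lt_min hε (Real.sqrt_pos.2 (by positivity))

theorem subTol_sq_le {σ ε : ℝ} (hμ : 0 < μ) (hσ : 1 < σ) (hε : 0 < ε) :
    subTol μ σ ε ^ 2 ≤ ε * μ * (σ - 1) / (8 * σ + 1) := by
  have h1 : 0 < σ - 1 := by linarith
  have h2 := pow_le_pow_left₀ (subTol_pos hμ hσ hε).le (min_le_right ε _) 2
  rwa [Real.sq_sqrt (by positivity)] at h2

/-- The error of a step is `ε β (σ - 1) / (2 (8 σ + 1))` by the choice of the tolerance, which is
exactly what the invariant gains when `β` is multiplied by `σ`. -/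
theorem Assumptions.multiplier_dist (hA : p.Assumptions μ Lf Lg xs zs) {σ ε β z : ℝ} (hσ : 1 < σ)
    (hε : 0 < ε) (hβ : 0 < β) (hz : MultiplierInv σ ε zs β z) {x : E} (hx : x ∈ effDom p.h)
    (hn : NearStationary (p.lagrangian (max (z + β * p.g x) 0)) (subTol μ σ ε) x) :
    (max (z + β * p.g x) 0 - zs) ^ 2 + (max (z + β * p.g x) 0 - z) ^ 2 ≤
      zs ^ 2 + ε * (β * σ) / (2 * (8 * σ + 1)) := by
  have hμ := hA.mu_pos
  have h1 := hA.multiplier_step hβ (subTol_pos hμ hσ hε).le hx hn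
  have h2 : β * subTol μ σ ε ^ 2 / (2 * μ) ≤ ε * β * (σ - 1) / (2 * (8 * σ + 1)) := by
    rw [div_le_iff₀ (by positivity)]
    have := mul_le_mul_of_nonneg_left (subTol_sq_le hμ hσ hε) hβ.le
    refine this.trans (le_of_eq ?_)
    field_simp
  have e : ε * (β * σ) / (2 * (8 * σ + 1)) =
      ε * β / (2 * (8 * σ + 1)) + ε * β * (σ - 1) / (2 * (8 * σ + 1)) := by ring
  rw [e]
  linarith [hz.2]

theorem Assumptions.multiplierInv_next (hA : p.Assumptions μ Lf Lg xs zs) {σ ε β z : ℝ}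
    (hσ : 1 < σ) (hε : 0 < ε) (hβ : 0 < β) (hz : MultiplierInv σ ε zs β z) {x : E}
    (hx : x ∈ effDom p.h)
    (hn : NearStationary (p.lagrangian (max (z + β * p.g x) 0)) (subTol μ σ ε) x) :
    MultiplierInv σ ε zs (β * σ) (max (z + β * p.g x) 0) := by
  have := hA.multiplier_dist hσ hε hβ hz hx hn
  exact ⟨le_max_right _ _, by linarith [sq_nonneg (max (z + β * p.g x) 0 - z)]⟩

/-- Once the penalty parameter is of order `(1 + z*)² / ε`, the outer iteration stops. -/
theorem Assumptions.isEpsKKTPair_of_le (hA : p.Assumptions μ Lf Lg xs zs) {σ ε β z : ℝ}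
    (hσ : 1 < σ) (hε : 0 < ε) (hβ : 0 < β) (hz : MultiplierInv σ ε zs β z) {x : E}
    (hx : x ∈ effDom p.h)
    (hn : NearStationary (p.lagrangian (max (z + β * p.g x) 0)) (subTol μ σ ε) x)
    (hlarge : 4 * (1 + zs) ^ 2 / ε ≤ β) : p.IsEpsKKTPair ε x (max (z + β * p.g x) 0) := by
  have hzs := hA.kkt_dual
  have h1 := hA.multiplier_dist hσ hε hβ hz hx hn
  refine ⟨hx, le_max_right _ _, hn.mono (min_le_left _ _), ?_⟩
  have hz0 := hz.1
  have h2 : ε * (β * σ) / (2 * (8 * σ + 1)) ≤ ε * β / 16 := by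
    rw [div_le_div_iff₀ (by positivity) (by norm_num)]
    nlinarith [mul_pos hε hβ]
  rw [div_le_iff₀ hε] at hlarge
  have h3 : zs ^ 2 ≤ ε * β / 4 := by nlinarith
  have hεβ : 4 ≤ ε * β := by nlinarith
  set w := max (z + β * p.g x) 0 with hw
  have hA1 : (w - z) ^ 2 ≤ 5 / 16 * (ε * β) := by nlinarith [sq_nonneg (w - zs)]
  have hA2 : (w - zs) ^ 2 ≤ 5 / 16 * (ε * β) := by nlinarith [sq_nonneg (w - z)]
  have hwz : β * p.g x ≤ w - z := by
    have := le_max_left (z + β * p.g x) 0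
    linarith
  constructor
  · rw [abs_of_nonneg (le_max_right _ _)]
    refine max_le ?_ hε.le
    by_contra! hcon
    have h4 : β * ε < w - z := (mul_lt_mul_of_pos_left hcon hβ).trans_le hwz
    have h5 : 0 < β * ε := by positivity
    nlinarith
  · rcases le_total (z + β * p.g x) 0 with h | h
    · rw [max_eq_right h] at hw
      rw [hw, zero_mul, abs_zero]
      exact hε.le
    · rw [max_eq_left h] at hw
      have h4 : β * p.g x = w - z := by linarith
      have h5 : β * |w * p.g x| ≤ β * ε := by
        rw [← abs_of_pos hβ, ← abs_mul, abs_of_pos hβ,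
          show β * (w * p.g x) = ((w - zs) + zs) * (w - z) by rw [← h4]; ring]
        rw [abs_le]
        constructor
        · nlinarith [sq_nonneg (w - zs + (w - z)), sq_nonneg (zs + (w - z))]
        · nlinarith [sq_nonneg (w - zs - (w - z)), sq_nonneg (zs - (w - z))]
      exact le_of_mul_le_mul_left h5 hβ

/-- The cost of the outer loop when every primal update costs at most `V` and `m` further increases
of the penalty parameter reach the stopping threshold. -/
theorem Assumptions.ialmLoop_cost [Nontrivial E] [ProperSpace E]
    (hA : p.Assumptions μ Lf Lg xs zs) {ls : LineSearch} (hls : ls.Valid) {start : ℕ → E}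
    (hst : ∀ i, start i ∈ effDom p.h) (hB : 0 < p.Bg) {β₀ σ ε βmax V : ℝ} (hβ₀ : 0 < β₀)
    (hσ : 1 < σ) (hε : 0 < ε) (hβmax : 4 * (1 + zs) ^ 2 / ε * σ ≤ βmax) (hV0 : 0 ≤ V)
    (hV : ∀ β z, β₀ ≤ β → β ≤ βmax → MultiplierInv σ ε zs β z → ∀ i x i' N,
      p.PrimalUpdate μ ls β z (subTol μ σ ε) start i x i' N → (N : ℝ) ≤ V)
    {k : ℕ} {z : ℝ} {i : ℕ} {x : E} {z' : ℝ} {N : ℕ}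
    (hr : p.IALMLoop μ ls β₀ σ ε (fun _ => subTol μ σ ε) start k z i x z' N) :
    ∀ m : ℕ, MultiplierInv σ ε zs (β₀ * σ ^ k) z → β₀ * σ ^ k ≤ βmax →
      4 * (1 + zs) ^ 2 / ε ≤ β₀ * σ ^ k * σ ^ m → (N : ℝ) ≤ (m + 1) * (V + 4) := by
  have hσ0 : 0 < σ := by linarith
  have hge : ∀ k : ℕ, β₀ ≤ β₀ * σ ^ k := fun k =>
    le_mul_of_one_le_right hβ₀.le (one_le_pow₀ hσ.le)
  induction hr with
  | @finish k z i x i' N hu hk =>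
    intro m hz hmax hm
    have := hV _ z (hge k) hmax hz _ _ _ _ hu
    have h0 : (0 : ℝ) ≤ m * (V + 4) := by positivity
    push_cast
    linarith
  | @next k z i x x' z' i' N N' hu hk hl ih =>
    intro m hz hmax hm
    have hβ : 0 < β₀ * σ ^ k := by positivity
    obtain ⟨h1, h2⟩ := hA.primalUpdate_nearStationary hls hst hβ
      (subTol_pos hA.mu_pos hσ hε) hB hu
    -- Without termination the penalty parameter is still small, so the next one is below `βmax`.
    have hlt : β₀ * σ ^ k < 4 * (1 + zs) ^ 2 / ε := by
      by_contra! hcon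
      exact hk (hA.isEpsKKTPair_of_le hσ hε hβ hz h1 h2 hcon)
    cases m with
    | zero =>
      rw [pow_zero, mul_one] at hm
      linarith
    | succ m =>
      have hz' := hA.multiplierInv_next hσ hε hβ hz h1 h2
      have hN := hV _ z (hge k) hmax hz _ _ _ _ hu
      rw [mul_assoc, ← pow_succ] at hz'
      have hih := ih m hz'
        (by
          rw [pow_succ, ← mul_assoc]
          exact (mul_le_mul_of_nonneg_right hlt.le hσ0.le).trans hβmax)
        (by rw [pow_succ' σ m, ← mul_assoc] at hm; rwa [pow_succ σ k, ← mul_assoc])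
      push_cast
      linarith

theorem Assumptions.exists_ialmLoop [Nontrivial E] [ProperSpace E]
    (hA : p.Assumptions μ Lf Lg xs zs) {ls : LineSearch} (hls : ls.Valid) {start : ℕ → E}
    (hst : ∀ i, start i ∈ effDom p.h) (hB : 0 < p.Bg) {β₀ σ ε : ℝ} (hβ₀ : 0 < β₀)
    (hσ : 1 < σ) (hε : 0 < ε) : ∀ (m k : ℕ) (z : ℝ) (i : ℕ),
      MultiplierInv σ ε zs (β₀ * σ ^ k) z → 4 * (1 + zs) ^ 2 / ε ≤ β₀ * σ ^ k * σ ^ m →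
      ∃ x z' N, p.IALMLoop μ ls β₀ σ ε (fun _ => subTol μ σ ε) start k z i x z' N := by
  have hσ0 : 0 < σ := by linarith
  intro m
  induction m with
  | zero =>
    intro k z i hz hm
    have hβ : 0 < β₀ * σ ^ k := by positivity
    have ht := subTol_pos hA.mu_pos hσ hε
    obtain ⟨x, i', N, hu⟩ := hA.exists_primalUpdate hls start z hβ ht hB i
    obtain ⟨h1, h2⟩ := hA.primalUpdate_nearStationary hls hst hβ ht hB hu
    rw [pow_zero, mul_one] at hm
    exact ⟨_, _, _, .finish hu (hA.isEpsKKTPair_of_le hσ hε hβ hz h1 h2 hm)⟩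
  | succ m ih =>
    intro k z i hz hm
    have hβ : 0 < β₀ * σ ^ k := by positivity
    have ht := subTol_pos hA.mu_pos hσ hε
    obtain ⟨x, i', N, hu⟩ := hA.exists_primalUpdate hls start z hβ ht hB i
    obtain ⟨h1, h2⟩ := hA.primalUpdate_nearStationary hls hst hβ ht hB hu
    by_cases hk : p.IsEpsKKTPair ε x (max (z + β₀ * σ ^ k * p.g x) 0)
    · exact ⟨_, _, _, .finish hu hk⟩
    · have hz' := hA.multiplierInv_next hσ hε hβ hz h1 h2
      rw [mul_assoc, ← pow_succ] at hz'
      obtain ⟨_, _, _, hl⟩ := ih (k + 1) _ i' hz'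
        (by rw [pow_succ' σ m, ← mul_assoc] at hm; rwa [pow_succ σ k, ← mul_assoc])
      exact ⟨_, _, _, .next hu hk hl⟩

theorem multiplierInv_zero {σ ε β : ℝ} (hσ : 1 < σ) (hε : 0 < ε) (hβ : 0 < β) :
    MultiplierInv σ ε zs β 0 := by
  refine ⟨le_rfl, ?_⟩
  have : 0 < 8 * σ + 1 := by linarith
  have : 0 ≤ ε * β / (2 * (8 * σ + 1)) := by positivity
  nlinarith

theorem Assumptions.exists_ialm [Nontrivial E] [ProperSpace E]
    (hA : p.Assumptions μ Lf Lg xs zs) {ls : LineSearch} (hls : ls.Valid) {start : ℕ → E}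
    (hst : ∀ i, start i ∈ effDom p.h) (hB : 0 < p.Bg) {β₀ σ ε : ℝ} (hβ₀ : 0 < β₀)
    (hσ : 1 < σ) (hε : 0 < ε) :
    ∃ x z N, p.IALM μ ls β₀ σ ε (fun _ => subTol μ σ ε) start x z N := by
  obtain ⟨m, hm⟩ := pow_unbounded_of_one_lt (4 * (1 + zs) ^ 2 / ε / β₀) hσ
  rw [div_lt_iff₀ hβ₀] at hm
  refine hA.exists_ialmLoop hls hst hB hβ₀ hσ hε m 0 0 0 ?_ ?_
  · exact multiplierInv_zero hσ hε (by simpa using hβ₀)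
  · rw [pow_zero, mul_one, mul_comm β₀]; exact hm.le

theorem isEpsKKT_of_ialmLoop {ls : LineSearch} {β₀ σ ε : ℝ} {εs : ℕ → ℝ} {start : ℕ → E} {k : ℕ}
    {z : ℝ} {i : ℕ} {x : E} {z' : ℝ} {N : ℕ}
    (hr : p.IALMLoop μ ls β₀ σ ε εs start k z i x z' N) : p.IsEpsKKT ε x := by
  induction hr with
  | finish _ hk => exact ⟨_, hk⟩
  | next _ _ _ ih => exact ih

end Outer

end Problem

/-! ### The total complexity -/

theorem exists_pow_le_pow {b H : ℝ} (hb : 1 < b) (hH : 1 ≤ H) (a : ℕ) :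
    ∃ n : ℕ, H ^ a ≤ b ^ n ∧ (n : ℝ) ≤ a * Real.log H / Real.log b + 1 := by
  have hlb := Real.log_pos hb
  have hlH := Real.log_nonneg hH
  refine ⟨⌈a * Real.log H / Real.log b⌉₊, ?_, (Nat.ceil_lt_add_one (by positivity)).le⟩
  have h := Nat.le_ceil (a * Real.log H / Real.log b)
  rw [div_le_iff₀ hlb] at h
  rw [← Real.log_le_log_iff (by positivity) (by positivity), Real.log_pow, Real.log_pow]
  exact h

namespace Problem

section Complexity

variable {E : Type*} [NormedAddCommGroup E] [InnerProductSpace ℝ E] [CompleteSpace E]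
variable {p : Problem E} {μ Lf Lg : ℝ} {xs : E} {zs : ℝ}

/-- The subproblem tolerance is at least `ε³`, written with `H = 1 / ε`. -/
theorem one_le_subTol_mul {σ ε H : ℝ} (hσ : 1 < σ) (hH : 100 ≤ H) (hεH : ε * H = 1)
    (hμH : 1 ≤ μ * H) (hσH : σ ≤ H) (hσH' : 1 ≤ (σ - 1) * H) : 1 ≤ subTol μ σ ε * H ^ 3 := by
  have hH0 : 0 < H := by linarith
  have hσ1 : 0 < σ - 1 := by linarith
  have hd : 0 < 8 * σ + 1 := by linarith
  rw [← div_le_iff₀ (by positivity)]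
  refine le_min ?_ (Real.le_sqrt_of_sq_le ?_)
  · rw [div_le_iff₀ (by positivity)]
    have : ε * H ^ 3 = H ^ 2 := by
      rw [show ε * H ^ 3 = (ε * H) * H ^ 2 by ring, hεH, one_mul]
    rw [this]
    nlinarith
  · rw [div_pow, one_pow, div_le_div_iff₀ (by positivity) hd, one_mul]
    have e : ε * μ * (σ - 1) * (H ^ 3) ^ 2 = (ε * H) * (μ * H) * ((σ - 1) * H) * H ^ 3 := by ring
    rw [e, hεH, one_mul]
    have h1 : 1 ≤ μ * H * ((σ - 1) * H) := by nlinarith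
    have h2 : 8 * σ + 1 ≤ H ^ 3 := by nlinarith [pow_pos hH0 2]
    have h3 : 0 < H ^ 3 := by positivity
    nlinarith

/-- With multipliers of the size that the outer loop maintains, the search never exceeds
`6 (1 + z*)`. -/
theorem MultiplierInv.two_mul_max_le {σ ε β z : ℝ} (hz : MultiplierInv σ ε zs β z) (hσ : 1 < σ)
    (hzs : 0 ≤ zs) (hβ : ε * β ≤ 4 * σ * (1 + zs) ^ 2) : 2 * max zs z ≤ 6 * (1 + zs) := by
  have hd : 0 < 2 * (8 * σ + 1) := by linarith
  have h1 : ε * β / (2 * (8 * σ + 1)) ≤ (1 + zs) ^ 2 := by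
    rw [div_le_iff₀ hd]
    nlinarith [sq_nonneg (1 + zs)]
  have h2 : (z - zs) ^ 2 ≤ (2 * (1 + zs)) ^ 2 := by nlinarith [hz.2]
  have h3 := (abs_le_of_sq_le_sq' h2 (by linarith)).2
  have : max zs z ≤ 3 * (1 + zs) := max_le (by linarith) (by linarith)
  linarith

/-- The constant in the cost of a single call of the accelerated method. -/
noncomputable def solveConst (γ₁ γ₂ r : ℝ) : ℝ :=
  20 + 60 / Real.log γ₁ +
    82 * (7 + 3 * Real.log γ₂ / Real.log γ₁ + 6 / Real.log γ₁) * Real.sqrt r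

/-- The cost of one call of the accelerated method, when all data are at most `H`. The bound
`Λ = r (L_f + L_g (1 + z*))` on the accepted values is kept in the square root, while inside the
logarithms it is only used that `Λ ≤ H⁴`. -/
theorem Assumptions.solveCostLE_log [Nontrivial E] [ProperSpace E]
    (hA : p.Assumptions μ Lf Lg xs zs) {ls : LineSearch} (hls : ls.Valid) {start : ℕ → E}
    (hst : ∀ i, start i ∈ effDom p.h) {r H : ℝ} (hH : 100 ≤ H) (hr : 6 * ls.γ₁ ≤ r) (hrH : r ≤ H)
    (hLr : ls.Lmin ≤ r * (Lf + Lg * (1 + zs))) (hLf : Lf ≤ H) (hLg : Lg ≤ H) (hzs : zs ≤ H)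
    (hD : Metric.diam (effDom p.h) ≤ H) (hLmin : 1 ≤ ls.Lmin * H) :
    p.SolveCostLE μ ls start (6 * (1 + zs)) (1 / H ^ 12)
      (solveConst ls.γ₁ ls.γ₂ r * Real.sqrt ((Lf + Lg * (1 + zs)) / μ) * Real.log H) := by
  have hH0 : 0 < H := by linarith
  have hμ := hA.mu_pos
  have hzs0 := hA.kkt_dual
  have hLg0 := hA.Lg_nonneg
  have hμL := hA.mu_le
  have hγ := hls.one_lt
  have hm := hls.Lmin_pos
  have hG : 0 < Real.log ls.γ₁ := Real.log_pos hγ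
  have hγ₂ : 0 ≤ Real.log ls.γ₂ := Real.log_nonneg hls.one_le
  set Λ₀ := Lf + Lg * (1 + zs) with hΛ₀
  have hΛ₀μ : μ ≤ Λ₀ := by nlinarith
  have hΛ₀0 : 0 < Λ₀ := hμ.trans_le hΛ₀μ
  have hr0 : 0 < r := by linarith
  have hΛ₀H : Λ₀ ≤ H ^ 3 := by
    have h1 : Lg * (1 + zs) ≤ H * (1 + H) :=
      mul_le_mul hLg (by linarith) (by linarith) hH0.le
    nlinarith [pow_pos hH0 2]
  have hΛH : r * Λ₀ ≤ H ^ 4 := by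
    calc r * Λ₀ ≤ H * H ^ 3 := mul_le_mul hrH hΛ₀H hΛ₀0.le hH0.le
      _ = H ^ 4 := by ring
  have hΛ0 : 0 < r * Λ₀ := by positivity
  have hl1 : 1 ≤ Real.log H := by
    rw [Real.le_log_iff_exp_le hH0]
    linarith [Real.exp_one_lt_d9]
  -- The threshold `8 Λ² thr ≤ τ₀² Lmin` holds since `8 Λ² ≤ H⁹` and `τ₀² Lmin ≥ 1 / H²⁵`.
  have h := hA.solveCostLE hls hst (Cm := 6 * (1 + zs)) (τ₀ := 1 / H ^ 12) (Λ := r * Λ₀)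
    (thr := 1 / H ^ 34) (R := H) hLr ?_ (by positivity) (by positivity) ?_ hD
  · intro c d τ h1 h2 h3 i x N hs
    refine (h c d τ h1 h2 h3 i x N hs).trans ?_
    have b1 : Real.log (r * Λ₀) - Real.log ls.Lmin ≤ 5 * Real.log H := by
      have c1 : Real.log (r * Λ₀) ≤ 4 * Real.log H := by
        have := Real.log_le_log hΛ0 hΛH
        rwa [Real.log_pow] at this
      have c2 : 0 ≤ Real.log ls.Lmin + Real.log H := by
        rw [← Real.log_mul hm.ne' hH0.ne']
        exact Real.log_nonneg hLmin
      linarith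
    have b2 : Real.log (r * Λ₀ * H ^ 2 + 1 / H ^ 34) - Real.log (1 / H ^ 34) ≤
        41 * Real.log H := by
      have c1 : r * Λ₀ * H ^ 2 + 1 / H ^ 34 ≤ H ^ 7 := by
        have d1 : 1 / H ^ 34 ≤ 1 := by
          rw [div_le_one (by positivity)]
          exact one_le_pow₀ (by linarith)
        have d2 : r * Λ₀ * H ^ 2 ≤ H ^ 4 * H ^ 2 := mul_le_mul_of_nonneg_right hΛH (by positivity)
        have d3 : (1 : ℝ) ≤ H ^ 6 := one_le_pow₀ (by linarith)
        have d4 : H ^ 7 = H * H ^ 6 := by ring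
        rw [d4]
        nlinarith
      have c2 := Real.log_le_log (by positivity) c1
      rw [Real.log_pow] at c2
      rw [one_div (H ^ 34), Real.log_inv, Real.log_pow, ← one_div]
      push_cast at *
      linarith
    have b3 : 1 / Real.sqrt (μ / (r * Λ₀)) = Real.sqrt r * Real.sqrt (Λ₀ / μ) := by
      rw [← Real.sqrt_mul hr0.le, one_div, ← Real.sqrt_inv, inv_div, mul_div_assoc]
    set κ := Real.sqrt (Λ₀ / μ) with hκ
    have hκ1 : 1 ≤ κ := Real.one_le_sqrt.2 ((one_le_div hμ).2 hΛ₀μ)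
    set A := 7 + 3 * Real.log ls.γ₂ / Real.log ls.γ₁ + 6 / Real.log ls.γ₁ with hAdef
    have hA0 : 0 ≤ A := by positivity
    have b4 : A / Real.sqrt (μ / (r * Λ₀)) *
        (Real.log (r * Λ₀ * H ^ 2 + 1 / H ^ 34) - Real.log (1 / H ^ 34)) ≤
        A * (Real.sqrt r * κ) * (41 * Real.log H) := by
      rw [div_eq_mul_one_div A, b3]
      exact mul_le_mul_of_nonneg_left b2 (by positivity)
    have b5 : 6 * (Real.log (r * Λ₀) - Real.log ls.Lmin) / Real.log ls.γ₁ ≤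
        30 / Real.log ls.γ₁ * (κ * Real.log H) := by
      have c1 : 6 * (Real.log (r * Λ₀) - Real.log ls.Lmin) / Real.log ls.γ₁ ≤
          6 * (5 * Real.log H) / Real.log ls.γ₁ := by gcongr
      refine c1.trans ?_
      have c2 : 6 * (5 * Real.log H) / Real.log ls.γ₁ =
          30 / Real.log ls.γ₁ * (1 * Real.log H) := by ring
      rw [c2]
      gcongr
    have b6 : 1 ≤ κ * Real.log H := one_le_mul_of_one_le_of_one_le hκ1 hl1
    have e : solveConst ls.γ₁ ls.γ₂ r * κ * Real.log H =
        2 * (10 * (κ * Real.log H) + 30 / Real.log ls.γ₁ * (κ * Real.log H) +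
          A * (Real.sqrt r * κ) * (41 * Real.log H)) := by
      unfold solveConst
      rw [← hAdef]
      ring
    rw [e]
    linarith
  · have h1 : Lf + 6 * (1 + zs) * Lg ≤ 6 * Λ₀ := by rw [hΛ₀]; linarith
    calc ls.γ₁ * (Lf + 6 * (1 + zs) * Lg) ≤ ls.γ₁ * (6 * Λ₀) :=
          mul_le_mul_of_nonneg_left h1 (by linarith)
      _ = 6 * ls.γ₁ * Λ₀ := by ring
      _ ≤ r * Λ₀ := mul_le_mul_of_nonneg_right hr hΛ₀0.le
  · have h1 : (r * Λ₀) ^ 2 ≤ (H ^ 4) ^ 2 := pow_le_pow_left₀ hΛ0.le hΛH 2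
    have h2 : 8 * (r * Λ₀) ^ 2 ≤ H ^ 9 := by
      have : H ^ 9 = H * (H ^ 4) ^ 2 := by ring
      rw [this]
      have : 0 ≤ (H ^ 4) ^ 2 := by positivity
      nlinarith
    have h3 : (1 / H ^ 12) ^ 2 * ls.Lmin = (ls.Lmin * H) / H ^ 25 := by
      field_simp
    rw [h3, mul_one_div]
    calc 8 * (r * Λ₀) ^ 2 / H ^ 34 ≤ H ^ 9 / H ^ 34 := by gcongr
      _ = 1 / H ^ 25 := by field_simp
      _ ≤ ls.Lmin * H / H ^ 25 := by gcongr

theorem solveConst_nonneg {γ₁ γ₂ r : ℝ} (h₁ : 1 < γ₁) (h₂ : 1 ≤ γ₂) : 0 ≤ solveConst γ₁ γ₂ r := by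
  have hG : 0 < Real.log γ₁ := Real.log_pos h₁
  have hγ₂ : 0 ≤ Real.log γ₂ := Real.log_nonneg h₂
  unfold solveConst
  positivity

/-- The tolerance in the bisection is at least polynomially small in `H`. -/
theorem inv_pow_le_tol {H β εk μ : ℝ} (hH : 100 ≤ H) (hβ : 0 < β) (hB : 0 < p.Bg)
    (hεk : 0 < εk) (hμ : 0 < μ) (hμH : 1 ≤ μ * H) (hεkH : 1 ≤ εk * H ^ 3) (hβH : β ≤ H ^ 5)
    (hBH : p.Bg ≤ H) : 1 / H ^ 12 ≤ p.tol μ (εk / (3 * β * p.Bg)) := by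
  have hH0 : 0 < H := by linarith
  have e : p.tol μ (εk / (3 * β * p.Bg)) = μ * εk / (12 * (β * p.Bg ^ 2)) := by
    unfold tol; field_simp; ring
  have hβB : β * p.Bg ^ 2 ≤ H ^ 5 * H ^ 2 :=
    mul_le_mul hβH (pow_le_pow_left₀ hB.le hBH 2) (by positivity) (by positivity)
  rw [e, div_le_div_iff₀ (by positivity) (by positivity), one_mul]
  calc 12 * (β * p.Bg ^ 2) ≤ H * (H ^ 5 * H ^ 2) :=
        mul_le_mul (by linarith) hβB (by positivity) hH0.le
    _ = 1 * H ^ 8 := by ring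
    _ ≤ (μ * H * (εk * H ^ 3)) * H ^ 8 :=
        mul_le_mul_of_nonneg_right (one_le_mul_of_one_le_of_one_le hμH hεkH) (by positivity)
    _ = μ * εk * H ^ 12 := by ring

/-- The final width of the bisection is at least polynomially small in `H`. -/
theorem inv_pow_le_width {H β εk μ : ℝ} (hH : 100 ≤ H) (hβ : 0 < β) (hB : 0 < p.Bg)
    (hεk : 0 < εk) (hμ : 0 < μ) (hμH : 1 ≤ μ * H) (hμH' : μ ≤ H) (hεkH : 1 ≤ εk * H ^ 3)
    (hβH : β ≤ H ^ 5) (hBH : p.Bg ≤ H) :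
    1 / H ^ 19 ≤ μ * (εk / (3 * β * p.Bg)) / (μ + β * p.Bg ^ 2) := by
  have hH0 : 0 < H := by linarith
  have e : μ * (εk / (3 * β * p.Bg)) / (μ + β * p.Bg ^ 2) =
      μ * εk / (3 * β * p.Bg * (μ + β * p.Bg ^ 2)) := by field_simp
  have hβB : β * p.Bg ^ 2 ≤ H ^ 7 := by
    rw [show H ^ 7 = H ^ 5 * H ^ 2 by ring]
    exact mul_le_mul hβH (pow_le_pow_left₀ hB.le hBH 2) (by positivity) (by positivity)
  have h2 : 3 * β * p.Bg ≤ H * H ^ 5 * H :=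
    mul_le_mul (mul_le_mul (by linarith) hβH hβ.le hH0.le) hBH hB.le (by positivity)
  have h3 : μ + β * p.Bg ^ 2 ≤ H * H ^ 7 := by
    have a1 : H ≤ H ^ 7 := le_self_pow₀ (by linarith) (by norm_num)
    have a2 : 2 * H ^ 7 ≤ H * H ^ 7 := mul_le_mul_of_nonneg_right (by linarith) (by positivity)
    linarith
  rw [e, div_le_div_iff₀ (by positivity) (by positivity), one_mul]
  calc 3 * β * p.Bg * (μ + β * p.Bg ^ 2) ≤ H * H ^ 5 * H * (H * H ^ 7) :=
        mul_le_mul h2 h3 (by positivity) (by positivity)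
    _ = 1 * H ^ 15 := by ring
    _ ≤ (μ * H * (εk * H ^ 3)) * H ^ 15 :=
        mul_le_mul_of_nonneg_right (one_le_mul_of_one_le_of_one_le hμH hεkH) (by positivity)
    _ = μ * εk * H ^ 19 := by ring

/-- One outer iteration makes `O(log H)` calls: up to rounding there are `log₂ H²` doublings and
`log₂ H²²` halvings, as the initial width is at most `H³` and the final one at least
`1 / H¹⁹`. -/
theorem Assumptions.primalUpdate_cost [Nontrivial E] [ProperSpace E]
    (hA : p.Assumptions μ Lf Lg xs zs) {ls : LineSearch} (hls : ls.Valid) {start : ℕ → E}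
    {β z εk H U κ : ℝ} (hH : 100 ≤ H) (hB : 0 < p.Bg) (hβ : 0 < β) (hεk : 0 < εk)
    (hz : 2 * max zs z ≤ 6 * (1 + zs))
    (hU0 : 0 ≤ U) (hκ : 1 ≤ κ)
    (hU : p.SolveCostLE μ ls start (6 * (1 + zs)) (1 / H ^ 12) (U * κ * Real.log H))
    (hμH : 1 ≤ μ * H) (hμH' : μ ≤ H) (hεkH : 1 ≤ εk * H ^ 3) (hβH : β ≤ H ^ 5)
    (hβH' : 1 ≤ β * H) (hBH : p.Bg ≤ H) (hzs : zs ≤ H) {i : ℕ} {x : E} {i' N : ℕ}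
    (hr : p.PrimalUpdate μ ls β z εk start i x i' N) :
    (N : ℝ) ≤ 94 * (U + 1) * κ * Real.log H ^ 2 := by
  have hH0 : 0 < H := by linarith
  have hμ := hA.mu_pos
  have hzs0 := hA.kkt_dual
  have hl1 : 1 ≤ Real.log H := by
    rw [Real.le_log_iff_exp_le hH0]
    linarith [Real.exp_one_lt_d9]
  obtain ⟨n, hn, hnl⟩ := exists_pow_le_pow (one_lt_two : (1 : ℝ) < 2) (by linarith : 1 ≤ H) 22
  have hn45 : (n : ℝ) ≤ 45 * Real.log H := by
    have h1 : 22 * Real.log H / Real.log 2 ≤ 44 * Real.log H := by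
      rw [div_le_iff₀ (Real.log_pos one_lt_two)]
      nlinarith [Real.log_two_gt_d9]
    push_cast at hnl
    linarith
  have hCm : 6 * (1 + zs) ≤ H ^ 2 := by
    rw [sq]
    exact (show 6 * (1 + zs) ≤ 100 * H by linarith).trans (mul_le_mul_of_nonneg_right hH hH0.le)
  have hCm3 : 6 * (1 + zs) / β ≤ H ^ 3 := by
    rw [div_le_iff₀ hβ, show H ^ 3 * β = H ^ 2 * (β * H) by ring]
    exact hCm.trans (le_mul_of_one_le_right (by positivity) hβH')
  have htol : 1 / H ^ 12 ≤ p.tol μ (εk / (3 * β * p.Bg)) :=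
    inv_pow_le_tol hH hβ hB hεk hμ hμH hεkH hβH hBH
  have htol' : 1 / H ^ 12 ≤ εk / 3 := by
    rw [div_le_div_iff₀ (by positivity) (by norm_num), one_mul,
      show εk * H ^ 12 = (εk * H ^ 3) * H ^ 9 by ring]
    have h2 : H ≤ H ^ 9 := le_self_pow₀ (by linarith) (by norm_num)
    have h3 : H ^ 9 ≤ (εk * H ^ 3) * H ^ 9 := le_mul_of_one_le_left (by positivity) hεkH
    linarith
  have hw : 6 * (1 + zs) / β ≤ 2 ^ n * (μ * (εk / (3 * β * p.Bg)) / (μ + β * p.Bg ^ 2)) :=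
    calc 6 * (1 + zs) / β ≤ H ^ 3 := hCm3
      _ = H ^ 22 * (1 / H ^ 19) := by field_simp
      _ ≤ _ := mul_le_mul hn (inv_pow_le_width hH hβ hB hεk hμ hμH hμH' hεkH hβH hBH)
        (by positivity) (by positivity)
  have hn2 : 6 * (1 + zs) ≤ 2 ^ n :=
    hCm.trans ((pow_le_pow_right₀ (by linarith) (by norm_num)).trans hn)
  obtain ⟨-, -, hN⟩ := hA.primalUpdate_spec hls hβ hεk hB hz (by linarith)
    (by positivity) hU htol htol' hn2 hw hr
  refine hN.trans ?_
  have h1 : (n : ℝ) + n + 4 ≤ 94 * Real.log H := by linarith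
  have hκl : 1 ≤ κ * Real.log H := one_le_mul_of_one_le_of_one_le hκ hl1
  have h2 : U * κ * Real.log H + 1 ≤ (U + 1) * (κ * Real.log H) := by linarith
  calc ((n : ℝ) + n + 4) * (U * κ * Real.log H + 1) ≤
        94 * Real.log H * ((U + 1) * (κ * Real.log H)) :=
        mul_le_mul h1 h2 (by positivity) (by positivity)
    _ = 94 * (U + 1) * κ * Real.log H ^ 2 := by ring

/-- The total cost: at most `log_σ H⁵ + 2` outer iterations, since the stopping threshold for the
penalty parameter is at most `16 H³` and `β₀ ≥ 1 / H`. -/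
theorem Assumptions.ialm_cost [Nontrivial E] [ProperSpace E]
    (hA : p.Assumptions μ Lf Lg xs zs) {ls : LineSearch} (hls : ls.Valid) {start : ℕ → E}
    (hst : ∀ i, start i ∈ effDom p.h) {σ ε β₀ r H : ℝ} (hσ : 1 < σ) (hε : 0 < ε)
    (hβ₀ : 0 < β₀) (hB : 0 < p.Bg)
    (hH : 100 ≤ H) (hεH : ε * H = 1) (hr : 6 * ls.γ₁ ≤ r) (hrH : r ≤ H) (hσH : σ ≤ H)
    (hσH' : 1 ≤ (σ - 1) * H)
    (hLr : ls.Lmin ≤ r * (Lf + Lg * (1 + zs))) (hLf : Lf ≤ H) (hLg : Lg ≤ H) (hzs : zs ≤ H)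
    (hD : Metric.diam (effDom p.h) ≤ H) (hLmin : 1 ≤ ls.Lmin * H) (hBH : p.Bg ≤ H)
    (hμH : 1 ≤ μ * H) (hβH : β₀ ≤ H) (hβH' : 1 ≤ β₀ * H) {x : E} {z : ℝ} {N : ℕ}
    (hrun : p.IALM μ ls β₀ σ ε (fun _ => subTol μ σ ε) start x z N) :
    (N : ℝ) ≤ (5 / Real.log σ + 2) * (94 * (solveConst ls.γ₁ ls.γ₂ r + 1) + 4) *
      Real.sqrt ((Lf + Lg * (1 + zs)) / μ) * Real.log H ^ 3 := by
  have hH0 : 0 < H := by linarith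
  have hμ := hA.mu_pos
  have hzs0 := hA.kkt_dual
  have hl1 : 1 ≤ Real.log H := by
    rw [Real.le_log_iff_exp_le hH0]
    linarith [Real.exp_one_lt_d9]
  have hU := hA.solveCostLE_log hls hst hH hr hrH hLr hLf hLg hzs hD hLmin
  have hU0 := solveConst_nonneg (r := r) hls.one_lt hls.one_le
  set U := solveConst ls.γ₁ ls.γ₂ r
  set κ := Real.sqrt ((Lf + Lg * (1 + zs)) / μ) with hκ
  have hκ1 : 1 ≤ κ := by
    refine Real.one_le_sqrt.2 ((one_le_div hμ).2 ?_)
    have := mul_nonneg hA.Lg_nonneg (show 0 ≤ 1 + zs by linarith)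
    linarith [hA.mu_le]
  have hlσ := Real.log_pos hσ
  have hHe : H = 1 / ε := by field_simp; linarith
  have hzs2 : (1 + zs) ^ 2 ≤ (2 * H) ^ 2 := pow_le_pow_left₀ (by linarith) (by linarith) 2
  have hmax : 4 * (1 + zs) ^ 2 / ε ≤ 16 * H ^ 3 := by
    rw [div_eq_mul_one_div, ← hHe, show 16 * H ^ 3 = 4 * (2 * H) ^ 2 * H by ring]
    exact mul_le_mul_of_nonneg_right (by linarith) hH0.le
  obtain ⟨m, hm, hml⟩ := exists_pow_le_pow hσ (by linarith : 1 ≤ H) 5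
  have hV : ∀ β z, β₀ ≤ β → β ≤ max β₀ (4 * (1 + zs) ^ 2 / ε * σ) → MultiplierInv σ ε zs β z →
      ∀ i x i' N, p.PrimalUpdate μ ls β z (subTol μ σ ε) start i x i' N →
        (N : ℝ) ≤ 94 * (U + 1) * κ * Real.log H ^ 2 := by
    intro β z hβ1 hβ2 hz i x i' N hu
    have hβ : 0 < β := hβ₀.trans_le hβ1
    refine hA.primalUpdate_cost hls hH hB hβ (subTol_pos hμ hσ hε) ?_ hU0 hκ1 hU hμH
      (hA.mu_le.trans hLf) (one_le_subTol_mul hσ hH hεH hμH hσH hσH') ?_ ?_ hBH hzs hu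
    · refine hz.two_mul_max_le hσ hzs0 ?_
      rcases le_max_iff.1 hβ2 with h | h
      · have h1 : ε * β ≤ ε * H := mul_le_mul_of_nonneg_left (h.trans hβH) hε.le
        have h2 : 1 ≤ σ * (1 + zs) ^ 2 :=
          one_le_mul_of_one_le_of_one_le hσ.le (one_le_pow₀ (by linarith))
        linarith
      · have h1 := mul_le_mul_of_nonneg_left h hε.le
        have h2 : ε * (4 * (1 + zs) ^ 2 / ε * σ) = 4 * σ * (1 + zs) ^ 2 := by field_simp
        linarith
    · refine hβ2.trans (max_le (hβH.trans (le_self_pow₀ (by linarith) (by norm_num))) ?_)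
      calc 4 * (1 + zs) ^ 2 / ε * σ ≤ 16 * H ^ 3 * H :=
            mul_le_mul hmax hσH (by linarith) (by positivity)
        _ ≤ H ^ 5 := by
            have : H ^ 5 = H * (H ^ 3 * H) := by ring
            rw [this, mul_assoc]
            exact mul_le_mul_of_nonneg_right (by linarith) (by positivity)
    · exact hβH'.trans (mul_le_mul_of_nonneg_right hβ1 hH0.le)
  have hN := hA.ialmLoop_cost hls hst hB hβ₀ hσ hε (le_max_right _ _) (by positivity) hV hrun m
    (by rw [pow_zero, mul_one]; exact multiplierInv_zero hσ hε hβ₀)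
    (by rw [pow_zero, mul_one]; exact le_max_left _ _)
    (by
      rw [pow_zero, mul_one]
      refine hmax.trans ?_
      have h1 := mul_le_mul_of_nonneg_left hm hβ₀.le
      have h2 : β₀ * H ^ 5 = (β₀ * H) * H ^ 4 := by ring
      have h3 : 16 * H ^ 3 ≤ H ^ 4 := by
        have : H ^ 4 = H * H ^ 3 := by ring
        rw [this]
        exact mul_le_mul_of_nonneg_right (by linarith) (by positivity)
      have h4 : H ^ 4 ≤ (β₀ * H) * H ^ 4 := le_mul_of_one_le_left (by positivity) hβH'
      linarith)
  refine hN.trans ?_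
  have h1 : (m : ℝ) + 1 ≤ (5 / Real.log σ + 2) * Real.log H := by
    push_cast at hml
    have : 5 * Real.log H / Real.log σ = 5 / Real.log σ * Real.log H := by ring
    linarith
  have hκl : 1 ≤ κ * Real.log H ^ 2 :=
    one_le_mul_of_one_le_of_one_le hκ1 (one_le_pow₀ hl1)
  have h2 : 94 * (U + 1) * κ * Real.log H ^ 2 + 4 ≤
      (94 * (U + 1) + 4) * (κ * Real.log H ^ 2) := by linarith
  calc ((m : ℝ) + 1) * (94 * (U + 1) * κ * Real.log H ^ 2 + 4) ≤
        (5 / Real.log σ + 2) * Real.log H * ((94 * (U + 1) + 4) * (κ * Real.log H ^ 2)) :=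
        mul_le_mul h1 h2 (by positivity) (by positivity)
    _ = _ := by ring

end Complexity

end Problem

theorem mainTheorem2 (σ γ₁ γ₂ ρ : ℝ) (hσ : 1 < σ) (hγ₁ : 1 < γ₁) (hγ₂ : 1 ≤ γ₂) :
    ∃ C : ℝ, 0 < C ∧ ∀ M : ℝ, ∃ ε₀ : ℝ, 0 < ε₀ ∧
      ∀ (n : ℕ), 0 < n →
      ∀ (p : Problem (EuclideanSpace ℝ (Fin n))) (μ Lf Lg : ℝ)
        (xs : EuclideanSpace ℝ (Fin n)) (zs : ℝ), p.Assumptions μ Lf Lg xs zs →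
      ∀ (β₀ Lmin ε : ℝ), 0 < β₀ → 0 < Lmin → 0 < ε →
        (∀ k : ℕ, subTol μ σ ε ≤
          min ε (24 * p.Bg * (μ + β₀ * σ ^ k * p.Bg ^ 2) / μ)) →
      ∀ start : ℕ → EuclideanSpace ℝ (Fin n), (∀ i, start i ∈ effDom p.h) →
        (∃ x z N, p.IALM μ ⟨Lmin, γ₁, γ₂⟩ β₀ σ ε (fun _ => subTol μ σ ε) start x z N) ∧
        ∀ x z N, p.IALM μ ⟨Lmin, γ₁, γ₂⟩ β₀ σ ε (fun _ => subTol μ σ ε) start x z N →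
          p.IsEpsKKT ε x ∧
          (Lmin ≤ ρ * (Lf + Lg * (1 + zs)) →
            (Lf ≤ M ∧ Lg ≤ M ∧ zs ≤ M ∧ Metric.diam (effDom p.h) ≤ M ∧ p.Bg ≤ M ∧ 1 / μ ≤ M ∧
              β₀ ≤ M ∧ 1 / β₀ ≤ M ∧ 1 / Lmin ≤ M) →
            ε ≤ ε₀ →
            (N : ℝ) ≤ C * Real.sqrt ((Lf + Lg * (1 + zs)) / μ) * |Real.log ε| ^ 3) := by
  set r := max ρ (6 * γ₁) with hr
  have hU0 := Problem.solveConst_nonneg (r := r) hγ₁ hγ₂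
  have hlσ := Real.log_pos hσ
  have hσ1 : 0 < σ - 1 := by linarith
  refine ⟨(5 / Real.log σ + 2) * (94 * (Problem.solveConst γ₁ γ₂ r + 1) + 4), by positivity, ?_⟩
  intro M
  set K := max 100 (max M (max r (max σ (1 / (σ - 1))))) with hK
  have hK100 : 100 ≤ K := le_max_left _ _
  have hKM : M ≤ K := (le_max_left _ _).trans (le_max_right _ _)
  have hKr : r ≤ K := (le_max_left _ _).trans ((le_max_right _ _).trans (le_max_right _ _))
  have hKσ : σ ≤ K := (le_max_left _ _).trans ((le_max_right _ _).trans
    ((le_max_right _ _).trans (le_max_right _ _)))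
  have hKσ' : 1 / (σ - 1) ≤ K := (le_max_right _ _).trans ((le_max_right _ _).trans
    ((le_max_right _ _).trans (le_max_right _ _)))
  refine ⟨1 / K, by positivity, ?_⟩
  intro n hn p μ Lf Lg xs zs hA β₀ Lmin ε hβ₀ hLmin hε htol start hst
  have : Nonempty (Fin n) := ⟨⟨0, hn⟩⟩
  have hμ := hA.mu_pos
  -- The smallness assumption on the tolerance excludes `B_g = 0`.
  have hB : 0 < p.Bg := by
    have hB0 : 0 ≤ p.Bg := (norm_nonneg _).trans (hA.norm_gradient_le (hst 0))
    rcases hB0.eq_or_lt with h | h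
    · have h1 := (htol 0).trans (min_le_right _ _)
      rw [← h] at h1
      simp only [mul_zero, zero_mul, zero_div] at h1
      exact absurd h1 (not_le.2 (Problem.subTol_pos hμ hσ hε))
    · exact h
  have hls : LineSearch.Valid ⟨Lmin, γ₁, γ₂⟩ := ⟨hLmin, hγ₁, hγ₂⟩
  refine ⟨hA.exists_ialm hls hst hB hβ₀ hσ hε, ?_⟩
  intro x z N hrun
  refine ⟨Problem.isEpsKKT_of_ialmLoop hrun, ?_⟩
  rintro hLρ ⟨hLf, hLg, hzs, hD, hBM, hμM, hβM, hβM', hLM⟩ hεε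
  have hKH : K ≤ 1 / ε := by
    rw [le_div_iff₀ hε]
    rwa [le_div_iff₀ (by positivity), mul_comm] at hεε
  have hMH : M ≤ 1 / ε := hKM.trans hKH
  have hinv : ∀ {a : ℝ}, 0 < a → 1 / a ≤ 1 / ε → 1 ≤ a * (1 / ε) := by
    intro a ha h
    rwa [div_le_iff₀ ha, mul_comm] at h
  have hΛ₀ : 0 ≤ Lf + Lg * (1 + zs) := by
    nlinarith [hA.mu_le, hA.Lg_nonneg, hA.kkt_dual]
  have hcost := hA.ialm_cost hls hst (r := r) (H := 1 / ε) hσ hε hβ₀ hB (hK100.trans hKH)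
    (by field_simp) (le_max_right _ _) (hKr.trans hKH) (hKσ.trans hKH)
    (hinv hσ1 (hKσ'.trans hKH))
    (hLρ.trans (mul_le_mul_of_nonneg_right (le_max_left _ _) hΛ₀))
    (hLf.trans hMH) (hLg.trans hMH) (hzs.trans hMH) (hD.trans hMH)
    (hinv hLmin (hLM.trans hMH)) (hBM.trans hMH) (hinv hμ (hμM.trans hMH))
    (hβM.trans hMH) (hinv hβ₀ (hβM'.trans hMH)) hrun
  have hlog : |Real.log ε| = Real.log (1 / ε) := by
    rw [one_div, Real.log_inv, abs_of_nonpos]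
    refine Real.log_nonpos hε.le ?_
    have h1 : 1 ≤ 1 / ε := by linarith
    rwa [le_div_iff₀ hε, one_mul] at h1
  rw [hlog]
  exact hcost
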